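/- Setting. A graph $G=(V,E,w)$ is a finite weighted undirected simple graph with $n\ge 1$ vertices, $m$ edges and positive edge weights; $A$ is its weighted adjacency matrix, $D$ its diagonal matrix of weighted degrees $d_u$, $L_G=D-A$. For $k\ge 1$ the $k$-step random walk graph $G^k$ has the Laplacian $L_{G^k}=D-A(D^{-1}A)^{k-1}$ (with $D^{-1}$ taken to be $0$ at isolated vertices). The effective resistance is $R^G_{\rm eff}(u,v)=\chi_{uv}^{T}L_G^{\dagger}\chi_{uv}$, where $\chi_{uv}$ is $1$ at $u$ and $-1$ at $v$. The double cover $G\times P_2$ has two copies $u^{(A)},u^{(B)}$ of every vertex $u$, and for every edge $uv$ of $G$ the two edges $u^{(A)}v^{(B)}$ and $u^{(B)}v^{(A)}$ of weight $w_{uv}$. For $\varepsilon\in(0,1)$, a graph $H$ on $V$ (a list of positively weighted edges; loops and parallel edges allowed) is an $\varepsilon$-sparsifier of $G^k$ if $(1-\varepsilon)L_{G^k}\preceq L_H\preceq(1+\varepsilon)L_{G^k}$. Estimators. Let $f:\mathbb N^2\to\mathbb R$, $T:\mathbb N^2\to\mathbb N$, $\delta:\mathbb N\to[0,\infty]$ with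 $f(n,m)\le f(2n,2m)$, $T(n,m)\le T(2n,2m)$ and $T(n,m)\ge n+m$ for all $n,m$. An estimator is a randomized procedure that, on every graph $G$ with $n$ vertices and $m$ edges, returns numbers $\tilde r_e$ ($e\in E$) at cost $T(n,m)$, such that, except with probability at most $\delta(n)$, the answer is admissible: $\tilde r_{uv}\ge R^G_{\rm eff}(u,v)$ for every edge $uv$, and $\sum_{e\in E}w_e\tilde r_e\le f(n,m)$. Algorithm $\mathrm{SparsifyG}^k$ (with a constant $C_0$). If $k$ is odd, call the estimator on $G$ to get $\tilde r$; if $k$ is even, call it on $G\times P_2$ and let $\tilde r_{uv}$ be its estimate for the edge $u^{(A)}v^{(B)}$ (for one fixed ordering of the endpoints of each edge $uv$). Put $S=k\sum_{e\in E}w_e\tilde r_e$, $N=\lceil C_0\varepsilon^{-2}\lceil\log_2 n\rceil S\rceil$ and $h=N/S$. Then $N$ times independently: pick an edge $e$ of $G$ with probability proportional to $w_e\tilde r_e$ and a uniformly random integer $0\le i<k$, let $u_i,u_{i+1}$ be the endpoints of $e$, complete them to a walk $u_0,\dots,u_k$ by $i$ steps of the random walk of $G$ (from $u$ to $v$ with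 probability $w_{uv}/d_u$) from $u_i$ and $k-1-i$ steps from $u_{i+1}$, and add to $H$ the edge $u_0u_k$ with weight $\bigl(h\sum_{0\le j<k}\tilde r_{u_ju_{j+1}}\bigr)^{-1}$. If $G$ has no edge, $H$ is empty. Theorem. For every $c\in\mathbb N$ there are constants $C_0\in\mathbb N$ and $C>0$, and a program $P$ for the randomized unit-cost real RAM (integer and real registers and arrays; addition, subtraction and halving of integers, field operations on reals, comparisons, uniform random numbers of $[0,1]$, calls of the estimator; no rounding of reals), such that the following holds for all $f,T,\delta$ and every estimator as above, every graph $G$ with $n\ge1$ vertices and $m$ edges, every $k\ge1$ and every $\varepsilon\in(0,1)$. Let $n'=n$ if $k$ is odd and $n'=2n$ if $k$ is even. 1. With probability at least $1-\delta(n')-n^{-c}$, the output $H$ of $\mathrm{SparsifyG}^k$ is an $\varepsilon$-sparsifier of $G^k$ with at most $C\,\varepsilon^{-2}\,k\,\log n\cdot f(2n,2m)$ edges. 2. $P$ implements $\mathrm{SparsifyG}^k$: whenever the answer of the estimator is admissible, $P$ calls the estimator exactly once, on $G$ for odd $k$ and on $G\times P_2$ for even $k$; given this answer, its output has exactly the distribution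 of the output of $\mathrm{SparsifyG}^k$; and for every outcome of its random numbers, its total time, including the cost of the call, is at most $$C\,T(2n,2m)+C\,\varepsilon^{-2}\,k^2\,\log^2 n\cdot f(2n,2m).$$ -/

import Mathlib

open MeasureTheory

noncomputable section

namespace WalkSparsify

/-! ### Weighted graphs and their matrices -/

/-- A finite weighted undirected graph without loops and parallel edges, with vertices
`0, …, n - 1` and edges numbered `0, …, m - 1`; edge `e` joins `fst e` and `snd e` and has the
positive weight `w e`. -/
structure Graph where
  n : ℕ
  m : ℕ
  fst : Fin m → Fin n
  snd : Fin m → Fin n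
  w : Fin m → ℝ
  ne : ∀ e, fst e ≠ snd e
  simple : Function.Injective fun e => s(fst e, snd e)
  w_pos : ∀ e, 0 < w e

/-- The Laplacian `D - A` of a weighted adjacency matrix `A`. -/
def lap {n : ℕ} (A : Matrix (Fin n) (Fin n) ℝ) : Matrix (Fin n) (Fin n) ℝ :=
  Matrix.diagonal (fun u => ∑ v, A u v) - A

namespace Graph

variable (G : Graph)

/-- A quantity `x e` given on the edges, as a symmetric matrix: the entry at `u, v` is `x e` if
`e` is the edge `uv`, and `0` if `u` and `v` are not adjacent. -/
def onPairs (x : Fin G.m → ℝ) : Matrix (Fin G.n) (Fin G.n) ℝ :=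
  Matrix.of fun u v =>
    ∑ e, if (G.fst e = u ∧ G.snd e = v) ∨ (G.fst e = v ∧ G.snd e = u) then x e else 0

/-- The weighted adjacency matrix. -/
def adj : Matrix (Fin G.n) (Fin G.n) ℝ := G.onPairs G.w

/-- The weighted degree. -/
def deg (u : Fin G.n) : ℝ := ∑ v, G.adj u v

/-- The Laplacian `D - A` of the graph. -/
def laplacian : Matrix (Fin G.n) (Fin G.n) ℝ := lap G.adj

/-- The Laplacian `D - A (D⁻¹ A) ^ (k - 1)` of the `k`-step random walk graph; the entry of `D⁻¹`
at an isolated vertex (where no walk passes) is `0`. -/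
def powLaplacian (k : ℕ) : Matrix (Fin G.n) (Fin G.n) ℝ :=
  Matrix.diagonal G.deg -
    G.adj * (Matrix.diagonal (fun u => (G.deg u)⁻¹) * G.adj) ^ (k - 1)

theorem laplacian_isHermitian : G.laplacian.IsHermitian := by
  apply Matrix.IsHermitian.ext
  intro u v
  have h : G.adj v u = G.adj u v := by
    simp only [adj, onPairs, Matrix.of_apply]
    exact Finset.sum_congr rfl fun e _ => if_congr or_comm rfl rfl
  by_cases huv : u = v
  · subst huv; simp
  · simp [laplacian, lap, huv, Ne.symm huv, h]

end Graph

/-- The (Moore-Penrose) pseudoinverse of a symmetric real matrix: in an orthonormal basis of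
eigenvectors every nonzero eigenvalue is inverted and the eigenvalue `0` is kept. -/
def pinv {n : ℕ} {M : Matrix (Fin n) (Fin n) ℝ} (hM : M.IsHermitian) :
    Matrix (Fin n) (Fin n) ℝ :=
  (hM.eigenvectorUnitary : Matrix (Fin n) (Fin n) ℝ) *
    Matrix.diagonal (fun i => (hM.eigenvalues i)⁻¹) *
    star (hM.eigenvectorUnitary : Matrix (Fin n) (Fin n) ℝ)

namespace Graph

variable (G : Graph)

/-- The effective resistance `χᵀ L† χ`, where `χ` is `1` at `u` and `-1` at `v`. -/
def reff (u v : Fin G.n) : ℝ :=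
  let χ : Fin G.n → ℝ := Pi.single u 1 - Pi.single v 1
  χ ⬝ᵥ (pinv G.laplacian_isHermitian).mulVec χ

/-- The double cover (tensor product with a single edge): vertex `u` has the copies `u` (side A)
and `n + u` (side B). If edge `e` of `G` is `uv`, then edge `e` of the double cover is
`u^A v^B` and its edge `m + e` is `v^A u^B`. -/
def doubleCover : Graph where
  n := G.n + G.n
  m := G.m + G.m
  fst := Fin.addCases (fun e => Fin.castAdd G.n (G.fst e)) (fun e => Fin.castAdd G.n (G.snd e))
  snd := Fin.addCases (fun e => Fin.natAdd G.n (G.snd e)) (fun e => Fin.natAdd G.n (G.fst e))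
  w := Fin.addCases G.w G.w
  ne := by
    intro e
    induction e using Fin.addCases with
    | left e =>
      simp only [Fin.addCases_left, ne_eq, Fin.ext_iff, Fin.val_castAdd, Fin.val_natAdd]; omega
    | right e =>
      simp only [Fin.addCases_right, ne_eq, Fin.ext_iff, Fin.val_castAdd, Fin.val_natAdd]; omega
  simple := by
    have key : ∀ e e' : Fin G.m, G.fst e = G.snd e' → G.snd e = G.fst e' → False := by
      intro e e' h1 h2
      have : e = e' := G.simple (by simp [h1, h2, Sym2.eq_swap])
      subst this
      exact G.ne e h1
    intro e e' h
    induction e using Fin.addCases with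
    | left e =>
      induction e' using Fin.addCases with
      | left e' =>
        simp only [Fin.addCases_left, Sym2.eq_iff, Fin.ext_iff, Fin.val_castAdd,
          Fin.val_natAdd] at h
        have : e = e' := G.simple (by
          have h1 : G.fst e = G.fst e' := Fin.ext (by omega)
          have h2 : G.snd e = G.snd e' := Fin.ext (by omega)
          simp [h1, h2])
        rw [this]
      | right e' =>
        simp only [Fin.addCases_left, Fin.addCases_right, Sym2.eq_iff, Fin.ext_iff,
          Fin.val_castAdd, Fin.val_natAdd] at h
        exact (key e e' (Fin.ext (by omega)) (Fin.ext (by omega))).elim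
    | right e =>
      induction e' using Fin.addCases with
      | left e' =>
        simp only [Fin.addCases_left, Fin.addCases_right, Sym2.eq_iff, Fin.ext_iff,
          Fin.val_castAdd, Fin.val_natAdd] at h
        exact (key e' e (Fin.ext (by omega)) (Fin.ext (by omega))).elim
      | right e' =>
        simp only [Fin.addCases_right, Sym2.eq_iff, Fin.ext_iff, Fin.val_castAdd,
          Fin.val_natAdd] at h
        have : e = e' := G.simple (by
          have h1 : G.fst e = G.fst e' := Fin.ext (by omega)
          have h2 : G.snd e = G.snd e' := Fin.ext (by omega)
          simp [h1, h2])
        rw [this]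
  w_pos := by
    intro e
    induction e using Fin.addCases with
    | left e => rw [Fin.addCases_left]; exact G.w_pos e
    | right e => rw [Fin.addCases_right]; exact G.w_pos e

/-- The graph on which the estimator is called. -/
def estimatorInput (k : ℕ) : Graph := if Odd k then G else G.doubleCover

theorem m_le_estimatorInput (k : ℕ) : G.m ≤ (G.estimatorInput k).m := by
  unfold estimatorInput
  split
  · exact le_rfl
  · exact Nat.le_add_right _ _

/-- The estimates used for the edges of `G`: edge `e = uv` receives the estimate of edge number `e`
of the graph passed to the estimator, which is `uv` itself for odd `k` and `u^A v^B` for even `k`. -/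
def pullEstimates (k : ℕ) (r : Fin (G.estimatorInput k).m → ℝ) : Fin G.m → ℝ :=
  fun e => r (Fin.castLE (G.m_le_estimatorInput k) e)

/-- `r` is an admissible answer of an estimator with bound `f` on the graph `G`: it dominates the
effective resistances of the edges, and `∑ w_e r_e` is at most `f(n, m)`. -/
def IsGoodEstimate (f : ℕ → ℕ → ℝ) (r : Fin G.m → ℝ) : Prop :=
  (∀ e, G.reff (G.fst e) (G.snd e) ≤ r e) ∧ ∑ e, G.w e * r e ≤ f G.n G.m

end Graph

/-! ### Weighted edge lists and spectral sparsifiers -/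

/-- The adjacency matrix of the multigraph on `n` vertices given by a list of weighted edges;
parallel edges add up, and loops cancel in the Laplacian. -/
def listAdj {n : ℕ} (H : List (Fin n × Fin n × ℝ)) : Matrix (Fin n) (Fin n) ℝ :=
  Matrix.of fun u v => (H.map fun e =>
    (if e.1 = u ∧ e.2.1 = v then e.2.2 else 0) + (if e.1 = v ∧ e.2.1 = u then e.2.2 else 0)).sum

/-- `H` is a graph (with positive edge weights) that is an `ε`-spectral sparsifier of the graph
with Laplacian `L`: `(1 - ε) L ≼ L_H ≼ (1 + ε) L`. -/
def IsSparsifier {n : ℕ} (ε : ℝ) (L : Matrix (Fin n) (Fin n) ℝ)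
    (H : List (Fin n × Fin n × ℝ)) : Prop :=
  (∀ e ∈ H, 0 < e.2.2) ∧
  (lap (listAdj H) - (1 - ε) • L).PosSemidef ∧ ((1 + ε) • L - lap (listAdj H)).PosSemidef

/-! ### The sampling algorithm -/

/-- A random element of `α` drawn with probability proportional to `x` (and `a₀` if `x` has no
positive value). -/
def draw {α : Type} [Fintype α] (a₀ : α) (x : α → ℝ) : PMF α :=
  if h : ∑' a, ENNReal.ofReal (x a) ≠ 0 then
    PMF.normalize (fun a => ENNReal.ofReal (x a)) h
      (by rw [tsum_fintype]; exact ENNReal.sum_ne_top.2 fun a _ => ENNReal.ofReal_ne_top)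
  else PMF.pure a₀

/-- The list of the results of `N` independent draws from `p`. -/
def repeatDraw {α : Type} (p : PMF α) : ℕ → PMF (List α)
  | 0 => PMF.pure []
  | N + 1 => p.bind fun a => (repeatDraw p N).bind fun l => PMF.pure (a :: l)

/-- The sum of `ρ` over the successive pairs of a sequence of vertices. -/
def pathSum {V : Type} (ρ : V → V → ℝ) : List V → ℝ
  | u :: v :: l => ρ u v + pathSum ρ (v :: l)
  | _ => 0

namespace Graph

variable (G : Graph)

/-- The vertices visited after `u` in a random walk of `j` steps that starts at `u`. -/
def randomWalk : ℕ → Fin G.n → PMF (List (Fin G.n))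
  | 0, _ => PMF.pure []
  | j + 1, u => (draw u (G.adj u)).bind fun v =>
      (randomWalk j v).bind fun l => PMF.pure (v :: l)

/-- One sample: pick an edge `ab` of `G` with probability proportional to `w_e r_e` and a uniform
index `i < k`, put `u_i = a`, `u_{i+1} = b`, complete this to a walk `u_0, …, u_k` by `i` random
steps from `a` and `k - 1 - i` random steps from `b`, and return the edge `u_0 u_k` with
weight `1 / (h * ∑ r_{u_i u_{i+1}})`. -/
def sampleEdge (hm : 0 < G.m) (k : ℕ) [NeZero k] (r : Fin G.m → ℝ) (h : ℝ) :
    PMF (Fin G.n × Fin G.n × ℝ) :=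
  (draw (⟨0, hm⟩ : Fin G.m) fun e => G.w e * r e).bind fun e =>
  (PMF.uniformOfFintype (Fin k)).bind fun i =>
  (G.randomWalk i (G.fst e)).bind fun left =>
  (G.randomWalk (k - 1 - i) (G.snd e)).bind fun right =>
  let walk := left.reverse ++ G.fst e :: G.snd e :: right
  PMF.pure (walk.headD (G.fst e), walk.getLastD (G.snd e),
    1 / (h * pathSum (G.onPairs r) walk))

/-- The sampling phase of `SparsifyG^k`, given the estimates `r` for the edges of `G`. The sampling
overhead is `C₀ ε⁻² ⌈log₂ n⌉`, and the number `N` of samples is the overhead times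
`S = k ∑ w_e r_e`, rounded up; `h = N / S` is the overhead after rounding, so that `N = h S`. -/
def sparsify (C₀ : ℕ) (k : ℕ) [NeZero k] (ε : ℝ) (r : Fin G.m → ℝ) :
    PMF (List (Fin G.n × Fin G.n × ℝ)) :=
  let S : ℝ := k * ∑ e, G.w e * r e
  let N : ℕ := ⌈(C₀ * Nat.clog 2 G.n / ε ^ 2) * S⌉₊
  if hm : 0 < G.m then repeatDraw (G.sampleEdge hm k r (N / S)) N else PMF.pure []

end Graph

/-! ### A randomized real RAM with access to an estimator

Integer and real registers, and integer and real arrays of unbounded length. Integers can be added,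
subtracted (truncated) and halved, reals can be added, subtracted, multiplied and divided, both can
be compared, and there is no rounding of reals. Every command and every test of a loop
or a branching takes one unit of time; expressions are part of the text of the fixed program, so
that they involve a bounded number of operations. -/

/-- Registers, arrays (array `a` has the entries `arr a 0, arr a 1, …`) and the number of random
numbers drawn so far. -/
structure State where
  natReg : ℕ → ℕ
  realReg : ℕ → ℝ
  natArr : ℕ → ℕ → ℕ
  realArr : ℕ → ℕ → ℝ
  pos : ℕ

inductive NatExp
  | const (c : ℕ)
  | reg (x : ℕ)
  | arr (a : ℕ) (i : NatExp)
  | add (i j : NatExp)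
  | sub (i j : NatExp)
  | half (i : NatExp)

inductive RealExp
  | ofNat (i : NatExp)
  | reg (x : ℕ)
  | arr (a : ℕ) (i : NatExp)
  | add (x y : RealExp)
  | sub (x y : RealExp)
  | mul (x y : RealExp)
  | div (x y : RealExp)

inductive Test
  | natLt (i j : NatExp)
  | realLt (x y : RealExp)
  | not (b : Test)
  | and (b c : Test)

def NatExp.eval (s : State) : NatExp → ℕ
  | const c => c
  | reg x => s.natReg x
  | arr a i => s.natArr a (i.eval s)
  | add i j => i.eval s + j.eval s
  | sub i j => i.eval s - j.eval s
  | half i => i.eval s / 2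

def RealExp.eval (s : State) : RealExp → ℝ
  | ofNat i => (i.eval s : ℝ)
  | reg x => s.realReg x
  | arr a i => s.realArr a (i.eval s)
  | add x y => x.eval s + y.eval s
  | sub x y => x.eval s - y.eval s
  | mul x y => x.eval s * y.eval s
  | div x y => x.eval s / y.eval s

def Test.Holds (s : State) : Test → Prop
  | natLt i j => i.eval s < j.eval s
  | realLt x y => x.eval s < y.eval s
  | not b => ¬ b.Holds s
  | and b c => b.Holds s ∧ c.Holds s

/-- Programs. `rand x` stores a uniform random number of `[0, 1]` in real register `x`.
`call N M a b w r` calls the estimator on the graph whose numbers of vertices and edges are in the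
integer registers `N` and `M`, whose edge list is in the integer arrays `a`, `b` and the
real array `w`, and stores its answer in the real array `r`. -/
inductive Program
  | skip
  | setNat (x : ℕ) (i : NatExp)
  | setReal (x : ℕ) (y : RealExp)
  | storeNat (a : ℕ) (i j : NatExp)
  | storeReal (a : ℕ) (i : NatExp) (y : RealExp)
  | rand (x : ℕ)
  | call (N M a b w r : ℕ)
  | seq (p q : Program)
  | ite (b : Test) (p q : Program)
  | loop (b : Test) (p : Program)

/-- The graph `G` is stored in the given registers and arrays. -/
def State.Stores (s : State) (N M a b w : ℕ) (G : Graph) : Prop :=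
  s.natReg N = G.n ∧ s.natReg M = G.m ∧
    ∀ e : Fin G.m, s.natArr a e = G.fst e ∧ s.natArr b e = G.snd e ∧ s.realArr w e = G.w e

/-- `Exec ans ω p s t Q s'`: if the random numbers are `ω 0, ω 1, …` and the estimator answers
`ans G` when called on `G`, then the program `p` started in the state `s` halts in the state
`s'` after `t` units of time (not counting the time spent inside the estimator), and `Q` is the list
of the graphs on which it called the estimator. -/
inductive Exec (ans : (G : Graph) → Fin G.m → ℝ) (ω : ℕ → unitInterval) :
    Program → State → ℕ → List Graph → State → Prop
  | skip (s : State) : Exec ans ω .skip s 1 [] s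
  | setNat (x : ℕ) (i : NatExp) (s : State) : Exec ans ω (.setNat x i) s 1 []
      { s with natReg := Function.update s.natReg x (i.eval s) }
  | setReal (x : ℕ) (y : RealExp) (s : State) : Exec ans ω (.setReal x y) s 1 []
      { s with realReg := Function.update s.realReg x (y.eval s) }
  | storeNat (a : ℕ) (i j : NatExp) (s : State) : Exec ans ω (.storeNat a i j) s 1 []
      { s with
        natArr := Function.update s.natArr a
          (Function.update (s.natArr a) (i.eval s) (j.eval s)) }
  | storeReal (a : ℕ) (i : NatExp) (y : RealExp) (s : State) :
      Exec ans ω (.storeReal a i y) s 1 []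
      { s with
        realArr := Function.update s.realArr a
          (Function.update (s.realArr a) (i.eval s) (y.eval s)) }
  | rand (x : ℕ) (s : State) : Exec ans ω (.rand x) s 1 []
      { s with realReg := Function.update s.realReg x (ω s.pos : ℝ), pos := s.pos + 1 }
  | call (N M a b w r : ℕ) (s : State) (G : Graph) (hG : s.Stores N M a b w G) :
      Exec ans ω (.call N M a b w r) s 1 [G]
      { s with
        realArr := Function.update s.realArr r
          (fun i => if h : i < G.m then ans G ⟨i, h⟩ else s.realArr r i) }
  | seq {p q : Program} {s s' s'' : State} {t t' : ℕ} {Q Q' : List Graph}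
      (h : Exec ans ω p s t Q s') (h' : Exec ans ω q s' t' Q' s'') :
      Exec ans ω (.seq p q) s (t + t') (Q ++ Q') s''
  | ite_true {b : Test} {p q : Program} {s s' : State} {t : ℕ} {Q : List Graph}
      (hb : b.Holds s) (h : Exec ans ω p s t Q s') :
      Exec ans ω (.ite b p q) s (1 + t) Q s'
  | ite_false {b : Test} {p q : Program} {s s' : State} {t : ℕ} {Q : List Graph}
      (hb : ¬ b.Holds s) (h : Exec ans ω q s t Q s') :
      Exec ans ω (.ite b p q) s (1 + t) Q s'
  | loop_true {b : Test} {p : Program} {s s' s'' : State} {t t' : ℕ} {Q Q' : List Graph}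
      (hb : b.Holds s) (h : Exec ans ω p s t Q s')
      (h' : Exec ans ω (.loop b p) s' t' Q' s'') :
      Exec ans ω (.loop b p) s (1 + t + t') (Q ++ Q') s''
  | loop_false {b : Test} {p : Program} {s : State} (hb : ¬ b.Holds s) :
      Exec ans ω (.loop b p) s 1 [] s

/-- The state at the start: `n`, `m`, `k` in the integer registers `0, 1, 2`, `ε` in the real
register `0`, the edge list in the integer arrays `0`, `1` and the real array `0`, and `0`
everywhere else. -/
def input (G : Graph) (k : ℕ) (ε : ℝ) : State where
  natReg x := if x = 0 then G.n else if x = 1 then G.m else if x = 2 then k else 0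
  realReg x := if x = 0 then ε else 0
  natArr a i := if h : i < G.m then
      (if a = 0 then (G.fst ⟨i, h⟩ : ℕ) else if a = 1 then (G.snd ⟨i, h⟩ : ℕ) else 0) else 0
  realArr a i := if h : i < G.m then (if a = 0 then G.w ⟨i, h⟩ else 0) else 0
  pos := 0

/-- The state presents the list `H` of weighted edges as the result: its length in the integer
register `0`, its entries in the integer arrays `0`, `1` and the real array `0`. -/
def State.Outputs (s : State) {n : ℕ} (H : List (Fin n × Fin n × ℝ)) : Prop :=
  s.natReg 0 = H.length ∧ ∀ i : Fin H.length,
    s.natArr 0 i = (H.get i).1 ∧ s.natArr 1 i = (H.get i).2.1 ∧ s.realArr 0 i = (H.get i).2.2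

/-- The law of a sequence of independent uniform random numbers of `[0, 1]`. -/
def uniformSeq : Measure (ℕ → unitInterval) :=
  Measure.infinitePi fun _ => (volume : Measure unitInterval)

end WalkSparsify

end

open WalkSparsify

/-! Write `D`, `A`, `P = D⁻¹A` for the degree, adjacency and transition matrices and `L` for the
Laplacian of `G^k`. Summed over all walks `u_0, …, u_k`, weighted by the product of the edge weights
over the product of the interior degrees, `(x u_0 - x u_k)²` gives `2 xᵀ L x`. This weight does not
depend on the step from which the walk is grown (`walkTotal_eq`). Hence, up to reversal, the
algorithm produces a walk with probability proportional to its weight times the sum of the estimates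
of its steps, one summand for each position of the drawn edge. Dividing by that sum makes a single
sample an unbiased estimate of `L / N` (`two_mul_sum_edges`, `expect_sampleEdge`).

Concentration needs in addition that a sample is at most `(2 / h) L`, that is, `(x u_0 - x u_k)² ≤ 2
(∑ r) xᵀ L x` along every walk. Effective resistance satisfies the triangle inequality
(`ResistanceLe.trans`), so `∑ r` bounds the resistance between the ends of the walk, and what
remains is to compare energies. With `a_j = xᵀ D P^j x`, the energy in `G` is `a_0 - a_1`, and for
odd `k` it is at most `2 (a_0 - a_k) = 2 xᵀ L x` (`energy_le_of_odd`). For even `k` this fails, for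
instance on bipartite graphs. The walk is then lifted to the double cover, where its ends lie on the
same side, and the function equal to `x` on that side and to `P x` on the other has energy `a_0 -
a_2 ≤ a_0 - a_k` (`energy_doubleCover_le_of_even`). `Admissible` collects what both parities
provide.

The matrix Chernoff bound is derived from the Golden-Thompson inequality (`trace_exp_add_le`), which
in turn follows from trace inequalities for powers of two and the Lie-Trotter formula. It is
transported to the possibly singular form `L` by whitening (`relative_matrix_chernoff`).

For the implementation, the sampler is first written as a deterministic function of a stream of
uniform numbers whose law is the required one (`Samples`, `samples_sample`). Every discrete choice
inverts a distribution function, and each sample consumes exactly `k + 1` numbers. The program is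
then shown to compute this function, in a calculus of timed triples (`Runs`) with a frame rule
(`Exec.agree`). After linear preprocessing, each step of a walk is one binary search of depth `O(log
n)` in an adjacency row. -/

open MeasureTheory

noncomputable section

namespace WalkSparsify

/-! ### Trace inequalities for powers of matrix products -/

section TraceInequalities

open Matrix

variable {ι : Type*} [Fintype ι]

theorem trace_sq_le (M : Matrix ι ι ℝ) : (M * M).trace ≤ (M * Mᵀ).trace := by
  have h : 0 ≤ ((M - Mᵀ) * (M - Mᵀ)ᵀ).trace := by
    simp only [trace, diag_apply, mul_apply, transpose_apply]
    exact Finset.sum_nonneg fun i _ => Finset.sum_nonneg fun j _ => mul_self_nonneg _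
  have h2 : ((M - Mᵀ) * (M - Mᵀ)ᵀ).trace = 2 * (M * Mᵀ).trace - 2 * (M * M).trace := by
    have e1 : (Mᵀ * Mᵀ).trace = (M * M).trace := by
      rw [← transpose_mul, trace_transpose]
    have e2 : (Mᵀ * M).trace = (M * Mᵀ).trace := trace_mul_comm _ _
    simp only [transpose_sub, transpose_transpose, sub_mul, mul_sub, trace_sub, e1, e2]
    ring
  linarith

theorem trace_mul_le_of_symm {X Y : Matrix ι ι ℝ} (hX : Xᵀ = X) (hY : Yᵀ = Y) :
    2 * (X * Y).trace ≤ (X * X).trace + (Y * Y).trace := by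
  have h : 0 ≤ ((X - Y) * (X - Y)ᵀ).trace := by
    simp only [trace, diag_apply, mul_apply, transpose_apply]
    exact Finset.sum_nonneg fun i _ => Finset.sum_nonneg fun j _ => mul_self_nonneg _
  have e2 : (Y * X).trace = (X * Y).trace := trace_mul_comm _ _
  simp only [transpose_sub, hX, hY, sub_mul, mul_sub, trace_sub, e2] at h
  linarith

variable [DecidableEq ι]

theorem trace_pow_mul_comm (X Y : Matrix ι ι ℝ) (j : ℕ) :
    ((X * Y) ^ j).trace = ((Y * X) ^ j).trace := by
  cases j with
  | zero => simp
  | succ j =>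
    have h : (X * Y) ^ (j + 1) = X * ((Y * X) ^ j * Y) := by
      induction j with
      | zero => simp
      | succ j ih => rw [pow_succ', ih, pow_succ' (Y * X)]; simp only [mul_assoc]
    rw [h, trace_mul_comm, mul_assoc, ← pow_succ]

/-- The two bounds support each other in one induction: doubling the exponent of the first is an
application of both to `M * M` and its Gram matrices, and doubling that of the second reduces,
through the first, to the squares of `P` and `Q`. Exponents that are powers of two suffice for the
Golden-Thompson limit. -/
theorem trace_pow_two_pow_le (k : ℕ) :
    (∀ M : Matrix ι ι ℝ, (M ^ 2 ^ (k + 1)).trace ≤ ((M * Mᵀ) ^ 2 ^ k).trace) ∧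
    (∀ P Q : Matrix ι ι ℝ, Pᵀ = P → Qᵀ = Q →
      ((P * Q) ^ 2 ^ k).trace ≤ (P ^ 2 ^ k * Q ^ 2 ^ k).trace) := by
  induction k with
  | zero =>
    refine ⟨fun M => ?_, fun P Q _ _ => by simp⟩
    simpa [pow_two] using trace_sq_le M
  | succ k ih =>
    obtain ⟨ih1, ih2⟩ := ih
    constructor
    · intro M
      have hs1 : (M * Mᵀ)ᵀ = M * Mᵀ := by simp
      have hs2 : (Mᵀ * M)ᵀ = Mᵀ * M := by simp
      have h1 := ih1 (M * M)
      rw [← pow_two, ← pow_mul, ← pow_succ'] at h1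
      -- A cyclic rotation produces a product of two symmetric matrices, to which the second
      -- induction hypothesis applies. Their powers have equal traces, so the inequality of the
      -- means in `h4` loses nothing.
      have h2 : ((M ^ 2 * (M ^ 2)ᵀ) ^ 2 ^ k).trace = (((M * Mᵀ) * (Mᵀ * M)) ^ 2 ^ k).trace := by
        rw [pow_two, transpose_mul, mul_assoc, trace_pow_mul_comm]
        simp only [mul_assoc]
      have h3 := ih2 _ _ hs1 hs2
      have h4 := trace_mul_le_of_symm (X := (M * Mᵀ) ^ 2 ^ k) (Y := (Mᵀ * M) ^ 2 ^ k)
        (by rw [transpose_pow, hs1]) (by rw [transpose_pow, hs2])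
      have h5 := trace_pow_mul_comm M Mᵀ (2 ^ (k + 1))
      simp only [← pow_add, ← two_mul, ← pow_succ'] at h4
      rw [h2] at h1
      linarith
    · intro P Q hP hQ
      have h1 := ih1 (P * Q)
      have h2 : ((P * Q * (P * Q)ᵀ) ^ 2 ^ k).trace = (((P * P) * (Q * Q)) ^ 2 ^ k).trace := by
        rw [transpose_mul, hP, hQ, mul_assoc, trace_pow_mul_comm, ← trace_transpose, transpose_pow]
        simp only [transpose_mul, hP, hQ, mul_assoc]
      have h3 := ih2 (P * P) (Q * Q) (by simp [hP]) (by simp [hQ])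
      rw [h2] at h1
      refine h1.trans (h3.trans (le_of_eq ?_))
      rw [← pow_two, ← pow_two, ← pow_mul, ← pow_mul, ← pow_succ']

end TraceInequalities

/-! ### The Lie-Trotter formula -/

section Trotter

open Filter Topology Asymptotics

variable {𝔸 : Type*} [NormedRing 𝔸] [NormOneClass 𝔸]

theorem norm_pow_sub_pow_le {x y : 𝔸} {M : ℝ} (hM : 1 ≤ M) (hx : ‖x‖ ≤ M) (hy : ‖y‖ ≤ M)
    (j : ℕ) : ‖x ^ j - y ^ j‖ ≤ j * M ^ j * ‖x - y‖ := by
  induction j with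
  | zero => simp
  | succ j ih =>
    have e : x ^ (j + 1) - y ^ (j + 1) = x ^ j * (x - y) + (x ^ j - y ^ j) * y := by
      rw [pow_succ, pow_succ, mul_sub, sub_mul]; abel
    have h0 : (0 : ℝ) ≤ M := by linarith
    have h1 : ‖x ^ j * (x - y)‖ ≤ M ^ (j + 1) * ‖x - y‖ := by
      refine (norm_mul_le _ _).trans (mul_le_mul_of_nonneg_right ?_ (norm_nonneg _))
      exact (norm_pow_le x j).trans ((pow_le_pow_left₀ (norm_nonneg _) hx j).trans
        (pow_le_pow_right₀ hM (Nat.le_succ j)))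
    have h2 : ‖(x ^ j - y ^ j) * y‖ ≤ (j * M ^ j * ‖x - y‖) * M :=
      (norm_mul_le _ _).trans (mul_le_mul ih hy (norm_nonneg _) (by positivity))
    rw [e]
    refine (norm_add_le _ _).trans ((add_le_add h1 h2).trans (le_of_eq ?_))
    push_cast
    ring

variable [NormedAlgebra ℝ 𝔸]

theorem eventually_norm_le_of_hasDerivAt {F : ℝ → 𝔸} {d : 𝔸} (h0 : F 0 = 1)
    (hF : HasDerivAt F d 0) : ∃ c : ℝ, 0 ≤ c ∧ ∀ᶠ t in 𝓝 (0 : ℝ), ‖F t‖ ≤ 1 + c * |t| := by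
  obtain ⟨c, hc, hb⟩ := hF.isBigO_sub.exists_nonneg
  refine ⟨c, hc, hb.bound.mono fun t ht => ?_⟩
  rw [h0, sub_zero, Real.norm_eq_abs] at ht
  calc ‖F t‖ = ‖1 + (F t - 1)‖ := by congr 1; abel
    _ ≤ ‖(1 : 𝔸)‖ + ‖F t - 1‖ := norm_add_le _ _
    _ ≤ _ := by rw [norm_one]; linarith

/-- By telescoping, the difference of the `m`-th powers at `1/m` is at most `m M^m ‖F - S‖`. Equal
derivatives make `‖F - S‖` of order `o(1/m)`, and `M = 1 + O(1/m)` keeps `M^m` bounded. -/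
theorem tendsto_pow_sub_pow {F S : ℝ → 𝔸} {d : 𝔸} (hF0 : F 0 = 1) (hS0 : S 0 = 1)
    (hF : HasDerivAt F d 0) (hS : HasDerivAt S d 0) {u : ℕ → ℕ} (hu : Tendsto u atTop atTop) :
    Tendsto (fun k => F (u k : ℝ)⁻¹ ^ u k - S (u k : ℝ)⁻¹ ^ u k) atTop (𝓝 0) := by
  obtain ⟨c, hc, hcF⟩ := eventually_norm_le_of_hasDerivAt hF0 hF
  obtain ⟨c', hc', hcS⟩ := eventually_norm_le_of_hasDerivAt hS0 hS
  have hlim : Tendsto (fun k => (u k : ℝ)⁻¹) atTop (𝓝 0) :=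
    tendsto_inv_atTop_zero.comp (tendsto_natCast_atTop_atTop.comp hu)
  have hlittle : (fun t => F t - S t) =o[𝓝 0] (fun t : ℝ => t) := by
    have := (hF.sub hS)
    rw [sub_self] at this
    have h := this.isLittleO
    simpa [hF0, hS0] using h
  have hl := hlittle.comp_tendsto hlim
  have hb : Tendsto (fun k => Real.exp (c + c') * (u k * ‖F (u k : ℝ)⁻¹ - S (u k : ℝ)⁻¹‖)) atTop
      (𝓝 0) := by
    have : Tendsto (fun k => ‖F (u k : ℝ)⁻¹ - S (u k : ℝ)⁻¹‖ / ‖(u k : ℝ)⁻¹‖) atTop (𝓝 0) :=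
      (isLittleO_iff_tendsto' (by
        filter_upwards [hu.eventually_gt_atTop 0] with k hk h
        simp [hk.ne'] at h)).1 hl.norm_norm
    have h2 := this.const_mul (Real.exp (c + c'))
    rw [mul_zero] at h2
    refine h2.congr fun k => ?_
    rw [Real.norm_eq_abs, abs_of_nonneg (by positivity : (0 : ℝ) ≤ (u k : ℝ)⁻¹), div_inv_eq_mul,
      mul_comm (‖_‖)]
  refine squeeze_zero_norm' ?_ hb
  filter_upwards [hlim.eventually hcF, hlim.eventually hcS, hu.eventually_gt_atTop 0] with k h1 h2 hk
  have hk' : (0 : ℝ) < u k := by exact_mod_cast hk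
  rw [abs_of_nonneg (by positivity)] at h1 h2
  have hpos : (0 : ℝ) ≤ (u k : ℝ)⁻¹ := by positivity
  have h := norm_pow_sub_pow_le (M := 1 + (c + c') * (u k : ℝ)⁻¹)
    (by nlinarith [mul_nonneg (add_nonneg hc hc') hpos])
    (h1.trans (by nlinarith [mul_nonneg hc' hpos])) (h2.trans (by nlinarith [mul_nonneg hc hpos]))
    (u k)
  refine h.trans ?_
  have hexp : (1 + (c + c') * (u k : ℝ)⁻¹) ^ u k ≤ Real.exp (c + c') := by
    have h3 := pow_le_pow_left₀ (by positivity) (Real.add_one_le_exp ((c + c') * (u k : ℝ)⁻¹)) (u k)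
    rw [← Real.exp_nat_mul, add_comm _ (1 : ℝ)] at h3
    refine h3.trans (le_of_eq ?_)
    congr 1
    field_simp
  nlinarith [mul_le_mul_of_nonneg_right hexp
    (mul_nonneg hk'.le (norm_nonneg (F (u k : ℝ)⁻¹ - S (u k : ℝ)⁻¹)))]

variable [CompleteSpace 𝔸]

open NormedSpace in
/-- The Lie-Trotter product formula. -/
theorem tendsto_exp_mul_exp_pow (a b : 𝔸) {u : ℕ → ℕ} (hu : Tendsto u atTop atTop) :
    Tendsto (fun k => (exp ((u k : ℝ)⁻¹ • a) * exp ((u k : ℝ)⁻¹ • b)) ^ u k) atTop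
      (𝓝 (exp (a + b))) := by
  have hd : ∀ x : 𝔸, HasDerivAt (fun t : ℝ => exp (t • x)) x 0 := fun x => by
    simpa using hasDerivAt_exp_smul_const (𝕂 := ℝ) x (0 : ℝ)
  have hF : HasDerivAt (fun t : ℝ => exp (t • a) * exp (t • b)) (a + b) 0 := by
    have h := (hd a).mul (hd b)
    simp only [zero_smul, exp_zero, mul_one, one_mul] at h
    exact h
  have h := tendsto_pow_sub_pow (by simp) (by simp) hF (hd (a + b)) hu
  have h2 := h.add_const (exp (a + b))
  rw [zero_add] at h2
  refine h2.congr' ?_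
  filter_upwards [hu.eventually_gt_atTop 0] with k hk
  have hk' : (u k : ℝ) ≠ 0 := by exact_mod_cast hk.ne'
  let _ : NormedAlgebra ℚ 𝔸 := NormedAlgebra.restrictScalars ℚ ℝ 𝔸
  have : exp ((u k : ℝ)⁻¹ • (a + b)) ^ u k = exp (a + b) := by
    rw [← NormedSpace.exp_nsmul, ← Nat.cast_smul_eq_nsmul ℝ, smul_smul, mul_inv_cancel₀ hk', one_smul]
  rw [this, sub_add_cancel]

end Trotter

/-! ### Golden-Thompson and exponentials of symmetric matrices -/

section MatrixExp

open Matrix Filter Topology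

variable {ι : Type*} [Fintype ι]

theorem transpose_mul_mul_apply_self (U M : Matrix ι ι ℝ) (i : ι) :
    (Uᵀ * M * U) i i = Uᵀ i ⬝ᵥ M *ᵥ Uᵀ i := by
  rw [mul_assoc]; rfl

theorem mul_transpose_dotProduct (C : Matrix ι ι ℝ) (z : ι → ℝ) :
    z ⬝ᵥ (C * Cᵀ) *ᵥ z = (Cᵀ *ᵥ z) ⬝ᵥ (Cᵀ *ᵥ z) := by
  rw [← mulVec_mulVec, dotProduct_mulVec, ← mulVec_transpose]

theorem mul_transpose_dotProduct_nonneg (C : Matrix ι ι ℝ) (z : ι → ℝ) :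
    0 ≤ z ⬝ᵥ (C * Cᵀ) *ᵥ z := by
  rw [mul_transpose_dotProduct]
  exact Finset.sum_nonneg fun i _ => mul_self_nonneg _

theorem trace_mul_transpose_mul (C X : Matrix ι ι ℝ) :
    (C * Cᵀ * X).trace = ∑ j, Cᵀ j ⬝ᵥ X *ᵥ Cᵀ j := by
  rw [mul_assoc, trace_mul_comm, trace]
  exact Finset.sum_congr rfl fun j _ => transpose_mul_mul_apply_self C X j

variable [DecidableEq ι]

open scoped Matrix.Norms.Operator in
theorem matrix_tendsto_exp_mul_exp_pow [Nonempty ι] (A B : Matrix ι ι ℝ) :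
    Tendsto (fun k : ℕ => (NormedSpace.exp (((2 ^ k : ℕ) : ℝ)⁻¹ • A) *
      NormedSpace.exp (((2 ^ k : ℕ) : ℝ)⁻¹ • B)) ^ 2 ^ k) atTop (𝓝 (NormedSpace.exp (A + B))) :=
  tendsto_exp_mul_exp_pow A B (tendsto_pow_atTop_atTop_of_one_lt one_lt_two)

/-- The Golden-Thompson inequality for real symmetric matrices. -/
theorem trace_exp_add_le {A B : Matrix ι ι ℝ} (hA : Aᵀ = A) (hB : Bᵀ = B) :
    (NormedSpace.exp (A + B)).trace ≤ (NormedSpace.exp A * NormedSpace.exp B).trace := by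
  -- The Trotter lemma needs an identity of norm one, so the empty index type is treated apart.
  rcases isEmpty_or_nonempty ι with hι | hι
  · simp [trace]
  have hlim : Tendsto (fun k : ℕ => ((NormedSpace.exp (((2 ^ k : ℕ) : ℝ)⁻¹ • A) *
      NormedSpace.exp (((2 ^ k : ℕ) : ℝ)⁻¹ • B)) ^ 2 ^ k).trace) atTop
      (𝓝 (NormedSpace.exp (A + B)).trace) :=
    ((continuous_id.matrix_trace).tendsto _).comp (matrix_tendsto_exp_mul_exp_pow A B)
  -- Each term of the Trotter sequence already obeys the bound, because the `2^k`-th power of `exp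
  -- (2^{-k} M)` is `exp M`.
  refine le_of_tendsto' hlim fun k => ?_
  have hsymm : ∀ M : Matrix ι ι ℝ, Mᵀ = M → ∀ t : ℝ,
      (NormedSpace.exp (t • M))ᵀ = NormedSpace.exp (t • M) := fun M hM t => by
    rw [← Matrix.exp_transpose, transpose_smul, hM]
  have hpow : ∀ M : Matrix ι ι ℝ,
      NormedSpace.exp (((2 ^ k : ℕ) : ℝ)⁻¹ • M) ^ 2 ^ k = NormedSpace.exp M := fun M => by
    rw [← Matrix.exp_nsmul, ← Nat.cast_smul_eq_nsmul ℝ, smul_smul, mul_inv_cancel₀ (by positivity),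
      one_smul]
  have h := (trace_pow_two_pow_le k).2 _ _ (hsymm A hA ((2 ^ k : ℕ) : ℝ)⁻¹)
    (hsymm B hB ((2 ^ k : ℕ) : ℝ)⁻¹)
  rwa [hpow, hpow] at h

theorem exists_orthogonal_diagonal {X : Matrix ι ι ℝ} (hX : Xᵀ = X) :
    ∃ (U : Matrix ι ι ℝ) (d : ι → ℝ), U * Uᵀ = 1 ∧ Uᵀ * U = 1 ∧ X = U * diagonal d * Uᵀ := by
  have hX' : X.IsHermitian := by rw [IsHermitian, conjTranspose_eq_transpose_of_trivial, hX]
  refine ⟨hX'.eigenvectorUnitary, hX'.eigenvalues, ?_, ?_, ?_⟩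
  · have := Unitary.coe_mul_star_self hX'.eigenvectorUnitary
    rwa [Unitary.coe_star, star_eq_conjTranspose, conjTranspose_eq_transpose_of_trivial] at this
  · have := Unitary.coe_star_mul_self hX'.eigenvectorUnitary
    rwa [star_eq_conjTranspose, conjTranspose_eq_transpose_of_trivial] at this
  · have h := hX'.spectral_theorem
    rw [Unitary.conjStarAlgAut_apply, star_eq_conjTranspose,
      conjTranspose_eq_transpose_of_trivial] at h
    simpa [Function.comp_def] using h

theorem exp_smul_conj_diagonal {U : Matrix ι ι ℝ} (d : ι → ℝ) (h : U * Uᵀ = 1) (θ : ℝ) :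
    NormedSpace.exp (θ • (U * diagonal d * Uᵀ)) =
      U * diagonal (fun i => Real.exp (θ * d i)) * Uᵀ := by
  have hinv : Uᵀ = U⁻¹ := (inv_eq_right_inv h).symm
  have hU : IsUnit U := IsUnit.of_mul_eq_one _ h
  have e : θ • (U * diagonal d * Uᵀ) = U * diagonal (fun i => θ * d i) * U⁻¹ := by
    rw [hinv, ← Matrix.smul_mul, ← Matrix.mul_smul, ← diagonal_smul]; rfl
  rw [e, Matrix.exp_conj _ _ hU, Matrix.exp_diagonal, hinv]
  congr 3
  ext i
  rw [Pi.coe_exp, Real.exp_eq_exp_ℝ]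

theorem trace_mul_conj_diagonal (B U : Matrix ι ι ℝ) (d : ι → ℝ) :
    (B * (U * diagonal d * Uᵀ)).trace = ∑ i, d i * (Uᵀ i ⬝ᵥ B *ᵥ Uᵀ i) := by
  rw [← mul_assoc, trace_mul_comm, ← mul_assoc, ← mul_assoc, trace]
  refine Finset.sum_congr rfl fun i _ => ?_
  rw [diag_apply, mul_diagonal, mul_comm, transpose_mul_mul_apply_self]

theorem conj_diagonal_dotProduct {U : Matrix ι ι ℝ} {d : ι → ℝ} (h : Uᵀ * U = 1) (i : ι) :
    Uᵀ i ⬝ᵥ (U * diagonal d * Uᵀ) *ᵥ Uᵀ i = d i ∧ Uᵀ i ⬝ᵥ Uᵀ i = 1 := by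
  have hcol : ∀ M : Matrix ι ι ℝ, Uᵀ i ⬝ᵥ M *ᵥ Uᵀ i = (Uᵀ * M * U) i i := fun M =>
    (transpose_mul_mul_apply_self U M i).symm
  constructor
  · rw [hcol, show Uᵀ * (U * diagonal d * Uᵀ) * U = (Uᵀ * U) * diagonal d * (Uᵀ * U) by
      simp only [mul_assoc], h]
    simp
  · have := hcol 1
    rw [mul_one, h, one_mulVec, one_apply_eq] at this
    exact this

/-- The trace of a positive semidefinite matrix times the exponential of a matrix between
`0` and `1` is bounded by the chord of the exponential function. -/
theorem trace_mul_exp_le {B X : Matrix ι ι ℝ} (hB : ∀ z, 0 ≤ z ⬝ᵥ B *ᵥ z) (hX : Xᵀ = X)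
    (h0 : ∀ z, 0 ≤ z ⬝ᵥ X *ᵥ z) (h1 : ∀ z, z ⬝ᵥ X *ᵥ z ≤ z ⬝ᵥ z) (θ : ℝ) :
    (B * NormedSpace.exp (θ • X)).trace ≤ B.trace + (Real.exp θ - 1) * (B * X).trace := by
  obtain ⟨U, d, hU, hU', rfl⟩ := exists_orthogonal_diagonal hX
  have e1 : B.trace = ∑ i, (1 : ℝ) * (Uᵀ i ⬝ᵥ B *ᵥ Uᵀ i) := by
    rw [← trace_mul_conj_diagonal]
    simp [hU]
  rw [exp_smul_conj_diagonal d hU, trace_mul_conj_diagonal, trace_mul_conj_diagonal, e1,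
    Finset.mul_sum, ← Finset.sum_add_distrib]
  refine Finset.sum_le_sum fun i _ => ?_
  obtain ⟨hd, hn⟩ := conj_diagonal_dotProduct (d := d) hU' i
  have hd0 : 0 ≤ d i := by rw [← hd]; exact h0 _
  have hd1 : d i ≤ 1 := by
    have := h1 (Uᵀ i)
    rwa [hd, hn] at this
  have hconv := convexOn_exp.2 (Set.mem_univ 0) (Set.mem_univ θ) (sub_nonneg.2 hd1) hd0 (by ring)
  simp only [smul_eq_mul, mul_zero, zero_add, Real.exp_zero, mul_one] at hconv
  have hBi := hB (Uᵀ i)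
  rw [mul_comm θ]
  nlinarith [mul_le_mul_of_nonneg_right hconv hBi]

theorem exp_symm {S : Matrix ι ι ℝ} (hS : Sᵀ = S) :
    (NormedSpace.exp S)ᵀ = NormedSpace.exp S := by
  rw [← Matrix.exp_transpose, hS]

/-- The factor is the exponential of `S / 2`. Through its columns, a trace against `exp S` becomes a
sum of values of a quadratic form. -/
theorem exists_exp_eq_mul_transpose {S : Matrix ι ι ℝ} (hS : Sᵀ = S) :
    ∃ C : Matrix ι ι ℝ, NormedSpace.exp S = C * Cᵀ := by
  refine ⟨NormedSpace.exp ((1 / 2 : ℝ) • S), ?_⟩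
  rw [exp_symm (by rw [transpose_smul, hS]), ← Matrix.exp_add_of_commute _ _ rfl, ← add_smul]
  norm_num

theorem dotProduct_conj_diagonal (U : Matrix ι ι ℝ) (d x : ι → ℝ) :
    x ⬝ᵥ (U * diagonal d * Uᵀ) *ᵥ x = ∑ i, d i * (Uᵀ *ᵥ x) i ^ 2 := by
  rw [← mulVec_mulVec, ← mulVec_mulVec, dotProduct_mulVec, ← mulVec_transpose, dotProduct]
  refine Finset.sum_congr rfl fun i _ => ?_
  rw [mulVec_diagonal]
  ring

/-- A Rayleigh quotient above `s` forces an eigenvalue of at least `s`, and the trace dominates the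
exponential of each eigenvalue. This converts a deviation in some direction into a lower bound for a
trace, ready for Markov's inequality. -/
theorem exp_le_trace_exp {S : Matrix ι ι ℝ} (hS : Sᵀ = S) {s : ℝ} {z : ι → ℝ}
    (hz : s * (z ⬝ᵥ z) < z ⬝ᵥ S *ᵥ z) : Real.exp s ≤ (NormedSpace.exp S).trace := by
  obtain ⟨U, d, hU, hU', rfl⟩ := exists_orthogonal_diagonal hS
  have htr : (NormedSpace.exp (U * diagonal d * Uᵀ)).trace = ∑ i, Real.exp (d i) := by
    have := exp_smul_conj_diagonal d hU 1
    rw [one_smul] at this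
    rw [this, trace_mul_comm, ← mul_assoc, hU', one_mul, trace_diagonal]
    simp
  have hone : z ⬝ᵥ z = ∑ i, (Uᵀ *ᵥ z) i ^ 2 := by
    have := dotProduct_conj_diagonal U 1 z
    simpa [hU] using this
  rw [dotProduct_conj_diagonal, hone, Finset.mul_sum] at hz
  obtain ⟨i, -, hi⟩ := Finset.exists_lt_of_sum_lt hz
  have hsd : s ≤ d i := by
    by_contra hcon
    exact absurd (mul_le_mul_of_nonneg_right (not_le.1 hcon).le (sq_nonneg ((Uᵀ *ᵥ z) i)))
      (not_le.2 hi)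
  rw [htr]
  exact (Real.exp_le_exp.2 hsd).trans
    (Finset.single_le_sum (fun j _ => (Real.exp_pos (d j)).le) (Finset.mem_univ i))

end MatrixExp

/-! ### Expectations under discrete laws -/

section Expectation

/-- The expectation of a nonnegative function. -/
def expect {α : Type*} (p : PMF α) (g : α → ENNReal) : ENNReal := ∑' a, p a * g a

variable {α β : Type*}

theorem expect_pure (a : α) (g : α → ENNReal) : expect (PMF.pure a) g = g a := by
  rw [expect, tsum_eq_single a]
  · simp
  · intro b hb
    simp [hb]

theorem expect_bind (p : PMF α) (q : α → PMF β) (g : β → ENNReal) :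
    expect (p.bind q) g = expect p fun a => expect (q a) g := by
  simp only [expect, PMF.bind_apply, ← ENNReal.tsum_mul_right, ← ENNReal.tsum_mul_left]
  rw [ENNReal.tsum_comm]
  simp only [mul_assoc]

theorem expect_mono {p : PMF α} {g g' : α → ENNReal} (h : ∀ a ∈ p.support, g a ≤ g' a) :
    expect p g ≤ expect p g' := by
  refine ENNReal.tsum_le_tsum fun a => ?_
  by_cases ha : p a = 0
  · simp [ha]
  · exact mul_le_mul_right (h a ((PMF.mem_support_iff p a).2 ha)) _

theorem expect_congr {p : PMF α} {g g' : α → ENNReal} (h : ∀ a ∈ p.support, g a = g' a) :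
    expect p g = expect p g' :=
  le_antisymm (expect_mono fun a ha => (h a ha).le) (expect_mono fun a ha => (h a ha).ge)

theorem expect_const (p : PMF α) (c : ENNReal) : expect p (fun _ => c) = c := by
  rw [expect, ENNReal.tsum_mul_right, p.tsum_coe, one_mul]

theorem expect_add (p : PMF α) (g g' : α → ENNReal) :
    expect p (fun a => g a + g' a) = expect p g + expect p g' := by
  simp only [expect, mul_add, ENNReal.tsum_add]

theorem expect_const_mul (p : PMF α) (c : ENNReal) (g : α → ENNReal) :
    expect p (fun a => c * g a) = c * expect p g := by
  simp only [expect, ← ENNReal.tsum_mul_left]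
  exact tsum_congr fun a => by ring

theorem expect_sum (p : PMF α) (s : Finset β) (g : β → α → ENNReal) :
    expect p (fun a => ∑ b ∈ s, g b a) = ∑ b ∈ s, expect p (g b) := by
  classical
  induction s using Finset.induction_on with
  | empty => simp [expect]
  | insert b s hb ih => simp only [Finset.sum_insert hb, expect_add, ih]

/-- Markov's inequality; only outcomes of positive probability have to be examined. -/
theorem toOuterMeasure_le_expect {p : PMF α} {s : Set α} {g : α → ENNReal}
    (h : ∀ a ∈ p.support, a ∈ s → 1 ≤ g a) : p.toOuterMeasure s ≤ expect p g := by
  rw [PMF.toOuterMeasure_apply]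
  refine ENNReal.tsum_le_tsum fun a => ?_
  by_cases ha : p a = 0
  · by_cases has : a ∈ s <;> simp [ha, has]
  by_cases has : a ∈ s
  · rw [Set.indicator_of_mem has]
    exact le_mul_of_one_le_right' (h a ((PMF.mem_support_iff p a).2 ha) has)
  · simp [has]

theorem measure_mono_of_support {p : PMF α} {s t : Set α} (h : ∀ a ∈ p.support, a ∈ s → a ∈ t) :
    p.toOuterMeasure s ≤ p.toOuterMeasure t := by
  rw [PMF.toOuterMeasure_apply, PMF.toOuterMeasure_apply]
  refine ENNReal.tsum_le_tsum fun a => ?_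
  by_cases ha : a ∈ p.support
  · by_cases has : a ∈ s
    · simp [has, h a ha has]
    · simp [has]
  · rw [PMF.mem_support_iff, not_not] at ha
    by_cases has : a ∈ s <;> simp [has, ha]

theorem mem_support_repeatDraw {α : Type} {p : PMF α} {N : ℕ} {l : List α}
    (hl : l ∈ (repeatDraw p N).support) : l.length = N ∧ ∀ a ∈ l, a ∈ p.support := by
  induction N generalizing l with
  | zero =>
    rw [repeatDraw, PMF.support_pure, Set.mem_singleton_iff] at hl
    simp [hl]
  | succ N ih =>
    simp only [repeatDraw, PMF.mem_support_bind_iff, PMF.support_pure,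
      Set.mem_singleton_iff] at hl
    obtain ⟨a, ha, l', hl', rfl⟩ := hl
    obtain ⟨h1, h2⟩ := ih hl'
    refine ⟨by simp [h1], fun b hb => ?_⟩
    rcases List.mem_cons.1 hb with rfl | hb
    · exact ha
    · exact h2 b hb

end Expectation

/-! ### The matrix Chernoff bound -/

section Chernoff

open Matrix

theorem list_sum_symm {ι : Type*} {α : Type} {X : α → Matrix ι ι ℝ} {l : List α}
    (h : ∀ a ∈ l, (X a)ᵀ = X a) :
    ((l.map X).sum)ᵀ = (l.map X).sum := by
  induction l with
  | nil => simp
  | cons a l ih =>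
    rw [List.map_cons, List.sum_cons, transpose_add, h a (by simp),
      ih fun b hb => h b (List.mem_cons_of_mem a hb)]

variable {ι : Type*} [Fintype ι] [DecidableEq ι] {α : Type} {p : PMF α} {X : α → Matrix ι ι ℝ}
  {μ : ℝ}

/-- The hypothesis `hE` says that the mean of `X` is `μ` times the identity. It is phrased through
quadratic forms because these are nonnegative, so that expectations can take values in `ENNReal`;
the columns of `C` reduce the trace to such forms. -/
theorem expect_trace_mul (hX0 : ∀ a ∈ p.support, ∀ z, 0 ≤ z ⬝ᵥ X a *ᵥ z)
    (hE : ∀ z, expect p (fun a => ENNReal.ofReal (z ⬝ᵥ X a *ᵥ z)) = ENNReal.ofReal (μ * (z ⬝ᵥ z)))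
    (hμ : 0 ≤ μ) (C : Matrix ι ι ℝ) :
    expect p (fun a => ENNReal.ofReal (C * Cᵀ * X a).trace) =
      ENNReal.ofReal (μ * (C * Cᵀ).trace) := by
  have h1 : (C * Cᵀ).trace = ∑ j, Cᵀ j ⬝ᵥ Cᵀ j := by
    have := trace_mul_transpose_mul C 1
    simpa using this
  have hn : ∀ j ∈ Finset.univ, 0 ≤ μ * (Cᵀ j ⬝ᵥ Cᵀ j) := fun j _ =>
    mul_nonneg hμ (Finset.sum_nonneg fun i _ => mul_self_nonneg _)
  rw [h1, Finset.mul_sum, ENNReal.ofReal_sum_of_nonneg hn]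
  simp only [← hE]
  rw [← expect_sum]
  refine expect_congr fun a ha => ?_
  rw [trace_mul_transpose_mul]
  exact ENNReal.ofReal_sum_of_nonneg fun j _ => hX0 a ha _

theorem trace_mul_transpose_nonneg (C : Matrix ι ι ℝ) : 0 ≤ (C * Cᵀ).trace := by
  have h1 : (C * Cᵀ).trace = ∑ j, Cᵀ j ⬝ᵥ Cᵀ j := by
    have := trace_mul_transpose_mul C 1
    simpa using this
  rw [h1]
  exact Finset.sum_nonneg fun j _ => Finset.sum_nonneg fun i _ => mul_self_nonneg _

/-- Golden-Thompson separates `S` from the random summand, the chord bound makes the remaining trace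
affine in `X a`, and the expectation becomes `(1 + (e^θ - 1) μ) tr (exp S)`. Then `1 + y ≤ e^y`. -/
theorem expect_trace_exp_add_le (hXs : ∀ a ∈ p.support, (X a)ᵀ = X a)
    (hX0 : ∀ a ∈ p.support, ∀ z, 0 ≤ z ⬝ᵥ X a *ᵥ z)
    (hX1 : ∀ a ∈ p.support, ∀ z, z ⬝ᵥ X a *ᵥ z ≤ z ⬝ᵥ z)
    (hE : ∀ z, expect p (fun a => ENNReal.ofReal (z ⬝ᵥ X a *ᵥ z)) = ENNReal.ofReal (μ * (z ⬝ᵥ z)))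
    (hμ : 0 ≤ μ) (θ : ℝ) {S : Matrix ι ι ℝ} (hS : Sᵀ = S) :
    expect p (fun a => ENNReal.ofReal (NormedSpace.exp (S + θ • X a)).trace) ≤
      ENNReal.ofReal (Real.exp ((Real.exp θ - 1) * μ) * (NormedSpace.exp S).trace) := by
  obtain ⟨C, hC⟩ := exists_exp_eq_mul_transpose hS
  have htr := trace_mul_transpose_nonneg C
  have hXtr : ∀ a ∈ p.support, 0 ≤ (C * Cᵀ * X a).trace := fun a ha => by
    rw [trace_mul_transpose_mul]
    exact Finset.sum_nonneg fun j _ => hX0 a ha _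
  have hstep : ∀ a ∈ p.support, (NormedSpace.exp (S + θ • X a)).trace ≤
      (C * Cᵀ).trace + (Real.exp θ - 1) * (C * Cᵀ * X a).trace := fun a ha => by
    refine (trace_exp_add_le hS (by rw [transpose_smul, hXs a ha])).trans ?_
    rw [hC]
    exact trace_mul_exp_le (mul_transpose_dotProduct_nonneg C) (hXs a ha) (hX0 a ha) (hX1 a ha) θ
  have hEC := expect_trace_mul hX0 hE hμ C
  have hfin : ENNReal.ofReal ((C * Cᵀ).trace + (Real.exp θ - 1) * (μ * (C * Cᵀ).trace)) ≤
      ENNReal.ofReal (Real.exp ((Real.exp θ - 1) * μ) * (NormedSpace.exp S).trace) := by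
    rw [hC]
    refine ENNReal.ofReal_le_ofReal ?_
    have := mul_le_mul_of_nonneg_right (Real.add_one_le_exp ((Real.exp θ - 1) * μ)) htr
    linarith
  refine le_trans ?_ hfin
  rcases le_total 0 θ with hθ | hθ
  · have hκ : 0 ≤ Real.exp θ - 1 := by linarith [Real.one_le_exp hθ]
    rw [ENNReal.ofReal_add htr (by positivity), ENNReal.ofReal_mul hκ, ← hEC, ← expect_const_mul]
    rw [← expect_const p (ENNReal.ofReal (C * Cᵀ).trace), ← expect_add]
    refine expect_mono fun a ha => ?_
    rw [← ENNReal.ofReal_mul hκ, ← ENNReal.ofReal_add htr (mul_nonneg hκ (hXtr a ha))]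
    exact ENNReal.ofReal_le_ofReal (hstep a ha)
  -- For `θ ≤ 0` the coefficient of the random trace is negative, so that term is first moved to the
  -- other side to keep all integrands nonnegative.
  · have hκ : 0 ≤ 1 - Real.exp θ := by linarith [Real.exp_le_one_iff.2 hθ]
    have h : expect p (fun a => ENNReal.ofReal (NormedSpace.exp (S + θ • X a)).trace) +
        ENNReal.ofReal ((1 - Real.exp θ) * (μ * (C * Cᵀ).trace)) ≤
        ENNReal.ofReal (C * Cᵀ).trace := by
      rw [ENNReal.ofReal_mul hκ, ← hEC, ← expect_const_mul, ← expect_add]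
      refine le_trans (expect_mono fun a ha => ?_)
        (expect_const p (ENNReal.ofReal (C * Cᵀ).trace)).le
      have hpos : 0 ≤ (NormedSpace.exp (S + θ • X a)).trace := by
        obtain ⟨C', hC'⟩ := exists_exp_eq_mul_transpose (S := S + θ • X a)
          (by rw [transpose_add, transpose_smul, hS, hXs a ha])
        rw [hC']
        exact trace_mul_transpose_nonneg C'
      rw [← ENNReal.ofReal_mul hκ, ← ENNReal.ofReal_add hpos (mul_nonneg hκ (hXtr a ha))]
      exact ENNReal.ofReal_le_ofReal (by linarith [hstep a ha])
    have h2 := ENNReal.le_sub_of_add_le_right ENNReal.ofReal_ne_top h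
    rw [← ENNReal.ofReal_sub _ (mul_nonneg hκ (mul_nonneg hμ htr))] at h2
    refine h2.trans (le_of_eq ?_)
    congr 1
    ring

/-- A free symmetric `S` lets the first draw be absorbed into it; the induction hypothesis handles
the later draws, and the single-draw bound then averages over the first. -/
theorem expect_trace_exp_sum_le (hXs : ∀ a ∈ p.support, (X a)ᵀ = X a)
    (hX0 : ∀ a ∈ p.support, ∀ z, 0 ≤ z ⬝ᵥ X a *ᵥ z)
    (hX1 : ∀ a ∈ p.support, ∀ z, z ⬝ᵥ X a *ᵥ z ≤ z ⬝ᵥ z)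
    (hE : ∀ z, expect p (fun a => ENNReal.ofReal (z ⬝ᵥ X a *ᵥ z)) = ENNReal.ofReal (μ * (z ⬝ᵥ z)))
    (hμ : 0 ≤ μ) (θ : ℝ) (N : ℕ) {S : Matrix ι ι ℝ} (hS : Sᵀ = S) :
    expect (repeatDraw p N)
        (fun l => ENNReal.ofReal (NormedSpace.exp (S + θ • (l.map X).sum)).trace) ≤
      ENNReal.ofReal (Real.exp (N * ((Real.exp θ - 1) * μ)) * (NormedSpace.exp S).trace) := by
  induction N generalizing S with
  | zero => simp [repeatDraw, expect_pure]
  | succ N ih =>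
    simp only [repeatDraw, expect_bind, expect_pure, List.map_cons, List.sum_cons, smul_add,
      ← add_assoc]
    calc _ ≤ expect p fun a => ENNReal.ofReal (Real.exp (N * ((Real.exp θ - 1) * μ)) *
          (NormedSpace.exp (S + θ • X a)).trace) :=
          expect_mono fun a ha => ih (by rw [transpose_add, transpose_smul, hS, hXs a ha])
      _ = ENNReal.ofReal (Real.exp (N * ((Real.exp θ - 1) * μ))) *
          expect p fun a => ENNReal.ofReal (NormedSpace.exp (S + θ • X a)).trace := by
          simp only [ENNReal.ofReal_mul (Real.exp_pos _).le, expect_const_mul]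
      _ ≤ _ := by
          refine (mul_le_mul_right (expect_trace_exp_add_le hXs hX0 hX1 hE hμ θ hS) _).trans ?_
          rw [← ENNReal.ofReal_mul (Real.exp_pos _).le, ← mul_assoc, ← Real.exp_add]
          refine le_of_eq ?_
          congr 3
          push_cast
          ring

/-- One tail of the matrix Chernoff bound; `θ` is `ε / 2` or `-ε / 2`. -/
theorem matrix_chernoff_tail (hXs : ∀ a ∈ p.support, (X a)ᵀ = X a)
    (hX0 : ∀ a ∈ p.support, ∀ z, 0 ≤ z ⬝ᵥ X a *ᵥ z)
    (hX1 : ∀ a ∈ p.support, ∀ z, z ⬝ᵥ X a *ᵥ z ≤ z ⬝ᵥ z)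
    (hE : ∀ z, expect p (fun a => ENNReal.ofReal (z ⬝ᵥ X a *ᵥ z)) = ENNReal.ofReal (μ * (z ⬝ᵥ z)))
    (hμ : 0 ≤ μ) (N : ℕ) {θ : ℝ} (hθ : |θ| ≤ 1) :
    (repeatDraw p N).toOuterMeasure
        {l | ∃ z, (θ + 2 * θ ^ 2) * (N * μ) * (z ⬝ᵥ z) < θ * (z ⬝ᵥ (l.map X).sum *ᵥ z)} ≤
      ENNReal.ofReal (Fintype.card ι * Real.exp (-(θ ^ 2 * (N * μ)))) := by
  set s := (θ + 2 * θ ^ 2) * (N * μ) with hs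
  have hb := expect_trace_exp_sum_le hXs hX0 hX1 hE hμ θ N (S := 0) (by simp)
  have hone : (NormedSpace.exp (0 : Matrix ι ι ℝ)).trace = Fintype.card ι := by
    rw [NormedSpace.exp_zero, trace_one]
  refine le_trans (toOuterMeasure_le_expect (g := fun l => ENNReal.ofReal (Real.exp (-s)) *
    ENNReal.ofReal (NormedSpace.exp (0 + θ • (l.map X).sum)).trace) ?_) ?_
  · rintro l hl ⟨z, hz⟩
    have hl' := (mem_support_repeatDraw hl).2
    have h := exp_le_trace_exp (S := θ • (l.map X).sum) (s := s) (z := z)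
      (by rw [transpose_smul, list_sum_symm fun a ha => hXs a (hl' a ha)])
      (by rwa [smul_mulVec, dotProduct_smul, smul_eq_mul])
    rw [zero_add, ← ENNReal.ofReal_mul (Real.exp_pos _).le, ← ENNReal.ofReal_one]
    refine ENNReal.ofReal_le_ofReal ?_
    calc (1 : ℝ) = Real.exp (-s) * Real.exp s := by rw [← Real.exp_add]; simp
      _ ≤ _ := mul_le_mul_of_nonneg_left h (Real.exp_pos _).le
  · rw [expect_const_mul]
    refine (mul_le_mul_right hb _).trans ?_
    rw [← ENNReal.ofReal_mul (Real.exp_pos _).le, hone, ← mul_assoc, ← Real.exp_add, mul_comm]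
    refine ENNReal.ofReal_le_ofReal (mul_le_mul_of_nonneg_left (Real.exp_le_exp.2 ?_)
      (Nat.cast_nonneg _))
    -- From `e^θ - 1 ≤ θ + θ²`, the threshold coefficient `θ + 2θ²` leaves `-θ²` in the exponent.
    have h2 := abs_le.1 (Real.abs_exp_sub_one_sub_id_le hθ)
    have h3 : 0 ≤ N * μ := mul_nonneg (Nat.cast_nonneg _) hμ
    have h4 := mul_le_mul_of_nonneg_right h2.2 h3
    rw [hs]
    linarith

/-- The matrix Chernoff bound. -/
theorem matrix_chernoff (hXs : ∀ a ∈ p.support, (X a)ᵀ = X a)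
    (hX0 : ∀ a ∈ p.support, ∀ z, 0 ≤ z ⬝ᵥ X a *ᵥ z)
    (hX1 : ∀ a ∈ p.support, ∀ z, z ⬝ᵥ X a *ᵥ z ≤ z ⬝ᵥ z)
    (hE : ∀ z, expect p (fun a => ENNReal.ofReal (z ⬝ᵥ X a *ᵥ z)) = ENNReal.ofReal (μ * (z ⬝ᵥ z)))
    (hμ : 0 ≤ μ) (N : ℕ) {ε : ℝ} (hε : 0 < ε) (hε1 : ε < 1) :
    (repeatDraw p N).toOuterMeasure
        {l | ∃ z, ε * (N * μ) * (z ⬝ᵥ z) <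
          |z ⬝ᵥ (l.map X).sum *ᵥ z - N * μ * (z ⬝ᵥ z)|} ≤
      ENNReal.ofReal (2 * Fintype.card ι * Real.exp (-(ε ^ 2 * (N * μ) / 4))) := by
  -- As `θ + 2θ² = θ (1 + 2θ)`, the values `θ = ±ε/2` give the deviations above the factor `1 + ε`
  -- and below `1 - ε`.
  have h1 := matrix_chernoff_tail hXs hX0 hX1 hE hμ N (θ := ε / 2)
    (by rw [abs_le]; constructor <;> linarith)
  have h2 := matrix_chernoff_tail hXs hX0 hX1 hE hμ N (θ := -(ε / 2))
    (by rw [abs_le]; constructor <;> linarith)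
  have e1 : (ε / 2) ^ 2 * (N * μ) = ε ^ 2 * (N * μ) / 4 := by ring
  rw [neg_sq, e1] at h2
  rw [e1] at h1
  have hsum := (measure_union_le _ _).trans (add_le_add h1 h2)
  rw [← ENNReal.ofReal_add (by positivity) (by positivity), ← two_mul,
    ← mul_assoc 2 (Fintype.card ι : ℝ)] at hsum
  refine (measure_mono fun l hl => ?_).trans hsum
  obtain ⟨z, hz⟩ := hl
  rw [Set.mem_union, Set.mem_ofPred_eq, Set.mem_ofPred_eq]
  rcases lt_abs.1 hz with hz | hz
  · left
    exact ⟨z, by linarith [mul_lt_mul_of_pos_left hz (half_pos hε)]⟩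
  · right
    exact ⟨z, by linarith [mul_lt_mul_of_pos_left hz (half_pos hε)]⟩

end Chernoff

/-! ### Whitening, and the Chernoff bound relative to a singular form -/

section RelativeChernoff

open Matrix

variable {ι κ : Type*} [Fintype ι] [Fintype κ]

theorem dotProduct_add_mulVec {M : Matrix ι ι ℝ} (hM : Mᵀ = M) (x y : ι → ℝ) :
    (x + y) ⬝ᵥ M *ᵥ (x + y) = x ⬝ᵥ M *ᵥ x + 2 * (x ⬝ᵥ M *ᵥ y) + y ⬝ᵥ M *ᵥ y := by
  have h : y ⬝ᵥ M *ᵥ x = x ⬝ᵥ M *ᵥ y := by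
    rw [dotProduct_mulVec, ← mulVec_transpose, hM, dotProduct_comm]
  rw [mulVec_add, add_dotProduct, dotProduct_add, dotProduct_add, h]
  ring

theorem dotProduct_mulVec_add_null {M : Matrix ι ι ℝ} (hM : Mᵀ = M)
    (h0 : ∀ x, 0 ≤ x ⬝ᵥ M *ᵥ x) {y : ι → ℝ} (hy : y ⬝ᵥ M *ᵥ y = 0) (x : ι → ℝ) :
    (x + y) ⬝ᵥ M *ᵥ (x + y) = x ⬝ᵥ M *ᵥ x := by
  have hb : x ⬝ᵥ M *ᵥ y = 0 := by
    by_contra hne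
    -- If the cross term did not vanish, this multiple of `y` would make it contribute `-(xᵀMx +
    -- 1)`, so the form would take the value `-1`.
    have h := h0 (x + (-(x ⬝ᵥ M *ᵥ x + 1) / (2 * (x ⬝ᵥ M *ᵥ y))) • y)
    rw [dotProduct_add_mulVec hM, mulVec_smul, dotProduct_smul, dotProduct_smul, smul_dotProduct,
      hy, smul_eq_mul, smul_zero, smul_zero, add_zero] at h
    have : 2 * (-(x ⬝ᵥ M *ᵥ x + 1) / (2 * (x ⬝ᵥ M *ᵥ y)) * (x ⬝ᵥ M *ᵥ y)) =
        -(x ⬝ᵥ M *ᵥ x + 1) := by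
      field_simp
    rw [this] at h
    linarith
  rw [dotProduct_add_mulVec hM, hb, hy]
  ring

theorem dotProduct_transpose_mul_mul (V : Matrix ι κ ℝ) (M : Matrix ι ι ℝ) (z : κ → ℝ) :
    z ⬝ᵥ (Vᵀ * M * V) *ᵥ z = (V *ᵥ z) ⬝ᵥ M *ᵥ (V *ᵥ z) := by
  rw [← mulVec_mulVec, ← mulVec_mulVec, dotProduct_mulVec, ← mulVec_transpose, transpose_transpose]

/-- A coordinate system in which a positive semidefinite form becomes the standard inner product. -/
theorem exists_whitening {n : ℕ} {L : Matrix (Fin n) (Fin n) ℝ} (hL : Lᵀ = L)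
    (hL0 : ∀ x, 0 ≤ x ⬝ᵥ L *ᵥ x) :
    ∃ (s : Finset (Fin n)) (V : Matrix (Fin n) s ℝ),
      (∀ z, (V *ᵥ z) ⬝ᵥ L *ᵥ (V *ᵥ z) = z ⬝ᵥ z) ∧
      ∀ x, ∃ z y, x = V *ᵥ z + y ∧ y ⬝ᵥ L *ᵥ y = 0 := by
  classical
  obtain ⟨U, d, hU, hU', rfl⟩ := exists_orthogonal_diagonal hL
  have hd : ∀ i, 0 ≤ d i := fun i => by
    rw [← (conj_diagonal_dotProduct (d := d) hU' i).1]; exact hL0 _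
  -- Coordinates are kept for the nonzero eigenvalues only, with eigenvectors divided by the square
  -- root of the eigenvalue. The other eigenvectors span the null part `y`.
  set s : Finset (Fin n) := Finset.univ.filter fun i => d i ≠ 0 with hs
  set E : Matrix (Fin n) s ℝ := Matrix.of fun i j => if i = j then (Real.sqrt (d i))⁻¹ else 0
  have hE1 : ∀ (z : s → ℝ) (j : s), (E *ᵥ z) j = (Real.sqrt (d j))⁻¹ * z j := fun z j => by
    simp only [mulVec, dotProduct, E, Matrix.of_apply, ite_mul, zero_mul, Subtype.coe_inj]
    rw [Finset.sum_ite_eq]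
    simp
  have hUV : ∀ z, Uᵀ *ᵥ ((U * E) *ᵥ z) = E *ᵥ z := fun z => by
    rw [mulVec_mulVec, ← Matrix.mul_assoc, hU', Matrix.one_mul]
  have hds : ∀ i, i ∉ s → d i = 0 := fun i hi => by simpa [hs] using hi
  have hsqrt : ∀ j : s, 0 < Real.sqrt (d j) := fun j =>
    Real.sqrt_pos.2 (lt_of_le_of_ne (hd j) (Ne.symm (Finset.mem_filter.1 j.2).2))
  refine ⟨s, U * E, fun z => ?_, fun x => ?_⟩
  · rw [dotProduct_conj_diagonal, hUV, ← Finset.sum_subset (Finset.subset_univ s)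
      (fun i _ hi => by rw [hds i hi, zero_mul]), ← Finset.sum_coe_sort, dotProduct]
    refine Finset.sum_congr rfl fun j _ => ?_
    rw [hE1, mul_pow, inv_pow, Real.sq_sqrt (hd j), ← mul_assoc, mul_inv_cancel₀, one_mul, sq]
    exact (Finset.mem_filter.1 j.2).2
  · refine ⟨fun j => Real.sqrt (d j) * (Uᵀ *ᵥ x) j,
      x - (U * E) *ᵥ (fun j => Real.sqrt (d j) * (Uᵀ *ᵥ x) j), by abel, ?_⟩
    rw [dotProduct_conj_diagonal]
    refine Finset.sum_eq_zero fun i _ => ?_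
    by_cases hi : i ∈ s
    · rw [mulVec_sub, Pi.sub_apply, hUV, hE1 _ ⟨i, hi⟩, ← mul_assoc,
        inv_mul_cancel₀ (hsqrt ⟨i, hi⟩).ne']
      simp
    · rw [hds i hi, zero_mul]

theorem dotProduct_list_sum_mulVec {α : Type} (Y : α → Matrix ι ι ℝ) (x : ι → ℝ) (l : List α) :
    x ⬝ᵥ (l.map Y).sum *ᵥ x = (l.map fun a => x ⬝ᵥ Y a *ᵥ x).sum := by
  induction l with
  | nil => simp
  | cons a l ih => simp [add_mulVec, dotProduct_add, ih]

/-- The matrix Chernoff bound relative to a positive semidefinite matrix `L`. -/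
theorem relative_matrix_chernoff {n : ℕ} {L : Matrix (Fin n) (Fin n) ℝ} (hL : Lᵀ = L)
    (hL0 : ∀ x, 0 ≤ x ⬝ᵥ L *ᵥ x) {α : Type} {p : PMF α} {Y : α → Matrix (Fin n) (Fin n) ℝ}
    (hYs : ∀ a ∈ p.support, (Y a)ᵀ = Y a) (hY0 : ∀ a ∈ p.support, ∀ x, 0 ≤ x ⬝ᵥ Y a *ᵥ x)
    {h : ℝ} (hh : 0 < h) (hY1 : ∀ a ∈ p.support, ∀ x, h * (x ⬝ᵥ Y a *ᵥ x) ≤ x ⬝ᵥ L *ᵥ x)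
    {N : ℕ} (hN : 0 < N)
    (hE : ∀ x, expect p (fun a => ENNReal.ofReal (x ⬝ᵥ Y a *ᵥ x)) =
      ENNReal.ofReal ((x ⬝ᵥ L *ᵥ x) / N)) {ε : ℝ} (hε : 0 < ε) (hε1 : ε < 1) :
    (repeatDraw p N).toOuterMeasure
        {l | ¬ ∀ x, |x ⬝ᵥ (l.map Y).sum *ᵥ x - x ⬝ᵥ L *ᵥ x| ≤ ε * (x ⬝ᵥ L *ᵥ x)} ≤
      ENNReal.ofReal (2 * n * Real.exp (-(ε ^ 2 * h / 4))) := by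
  obtain ⟨s, V, hV, hdec⟩ := exists_whitening hL hL0
  have hN' : (0 : ℝ) < N := by exact_mod_cast hN
  have hform : ∀ (a : α) z, z ⬝ᵥ (h • (Vᵀ * Y a * V)) *ᵥ z =
      h * ((V *ᵥ z) ⬝ᵥ Y a *ᵥ (V *ᵥ z)) := fun a z => by
    rw [smul_mulVec, dotProduct_smul, dotProduct_transpose_mul_mul, smul_eq_mul]
  have hNμ : (N : ℝ) * (h / N) = h := by field_simp
  have hch := matrix_chernoff (p := p) (X := fun a => h • (Vᵀ * Y a * V)) (μ := h / N)
    (fun a ha => by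
      rw [transpose_smul, transpose_mul, transpose_mul, transpose_transpose, hYs a ha,
        Matrix.mul_assoc])
    (fun a ha z => by
      rw [hform]; exact mul_nonneg hh.le (hY0 a ha _))
    (fun a ha z => by
      rw [hform, ← hV]; exact hY1 a ha _)
    (fun z => by
      simp only [hform, ENNReal.ofReal_mul hh.le, expect_const_mul, hE]
      rw [← ENNReal.ofReal_mul hh.le, hV]
      congr 1
      ring)
    (by positivity) N hε hε1
  rw [hNμ] at hch
  refine le_trans (le_trans (measure_mono_of_support ?_) hch) (ENNReal.ofReal_le_ofReal ?_)
  · intro l hl hbad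
    have hl' := (mem_support_repeatDraw hl).2
    obtain ⟨x, hx⟩ := not_forall.1 hbad
    rw [not_le] at hx
    obtain ⟨z, y, rfl, hy⟩ := hdec x
    refine ⟨z, ?_⟩
    have hLx : (V *ᵥ z + y) ⬝ᵥ L *ᵥ (V *ᵥ z + y) = z ⬝ᵥ z := by
      rw [dotProduct_mulVec_add_null hL hL0 hy, hV]
    have hYx : (V *ᵥ z + y) ⬝ᵥ (l.map Y).sum *ᵥ (V *ᵥ z + y) =
        (V *ᵥ z) ⬝ᵥ (l.map Y).sum *ᵥ (V *ᵥ z) := by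
      rw [dotProduct_list_sum_mulVec, dotProduct_list_sum_mulVec]
      congr 1
      refine List.map_congr_left fun a ha => ?_
      -- Since `h Y ≤ L`, a null vector of `L` is null for every possible sample, so the null
      -- component of `x` drops out of both forms.
      have hay : y ⬝ᵥ Y a *ᵥ y = 0 := by
        have h1 := hY1 a (hl' a ha) y
        rw [hy] at h1
        nlinarith [hY0 a (hl' a ha) y]
      exact dotProduct_mulVec_add_null (hYs a (hl' a ha)) (hY0 a (hl' a ha)) hay _
    have hXz : z ⬝ᵥ (l.map fun a => h • (Vᵀ * Y a * V)).sum *ᵥ z =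
        h * ((V *ᵥ z) ⬝ᵥ (l.map Y).sum *ᵥ (V *ᵥ z)) := by
      rw [dotProduct_list_sum_mulVec, dotProduct_list_sum_mulVec, ← List.sum_map_mul_left]
      simp only [hform]
    rw [hLx, hYx] at hx
    rw [hXz, ← mul_sub, abs_mul, abs_of_pos hh]
    calc ε * h * (z ⬝ᵥ z) = h * (ε * (z ⬝ᵥ z)) := by ring
      _ < _ := mul_lt_mul_of_pos_left hx hh
  · have : (Fintype.card s : ℝ) ≤ n := by
      have := s.card_le_univ
      rw [Fintype.card_fin] at this
      rw [Fintype.card_coe]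
      exact_mod_cast this
    gcongr

end RelativeChernoff

/-! ### Dirichlet energy and effective resistance -/

open Matrix

namespace Graph

variable (G : Graph)

/-- The ends of an edge differ, so its two orientations are disjoint cases and the disjunction
splits into a sum. The semiring is left general because the identity is needed over both `ℝ` and
`ENNReal`. -/
theorem sum_pairs {R : Type*} [CommSemiring R] (x : Fin G.m → R) (Φ : Fin G.n → Fin G.n → R) :
    ∑ u, ∑ v, (∑ e, if (G.fst e = u ∧ G.snd e = v) ∨ (G.fst e = v ∧ G.snd e = u) then x e else 0) *
      Φ u v = ∑ e, x e * (Φ (G.fst e) (G.snd e) + Φ (G.snd e) (G.fst e)) := by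
  have hsplit : ∀ e u v, (if (G.fst e = u ∧ G.snd e = v) ∨ (G.fst e = v ∧ G.snd e = u) then x e
      else 0) = (if G.fst e = u then if G.snd e = v then x e else 0 else 0) +
        (if G.snd e = u then if G.fst e = v then x e else 0 else 0) := by
    intro e u v
    have hne := G.ne e
    by_cases h1 : G.fst e = u <;> by_cases h2 : G.snd e = v <;> by_cases h3 : G.fst e = v <;>
      by_cases h4 : G.snd e = u <;> simp_all
  simp only [hsplit, Finset.sum_mul, add_mul, Finset.sum_add_distrib, ite_mul, zero_mul, mul_add]
  congr 1 <;>
  · refine (Finset.sum_congr rfl fun u _ => Finset.sum_comm).trans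
      (Finset.sum_comm.trans (Finset.sum_congr rfl fun e _ => ?_))
    simp

theorem onPairs_symm (x : Fin G.m → ℝ) (u v : Fin G.n) : G.onPairs x u v = G.onPairs x v u := by
  simp only [onPairs, Matrix.of_apply]
  exact Finset.sum_congr rfl fun e _ => if_congr or_comm rfl rfl

theorem sum_onPairs (x : Fin G.m → ℝ) (Φ : Fin G.n → Fin G.n → ℝ) :
    ∑ u, ∑ v, G.onPairs x u v * Φ u v =
      ∑ e, x e * (Φ (G.fst e) (G.snd e) + Φ (G.snd e) (G.fst e)) :=
  G.sum_pairs x Φ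

theorem onPairs_nonneg {x : Fin G.m → ℝ} (hx : ∀ e, 0 ≤ x e) (u v : Fin G.n) :
    0 ≤ G.onPairs x u v := by
  simp only [onPairs, Matrix.of_apply]
  exact Finset.sum_nonneg fun e _ => by split_ifs <;> simp [hx e]

theorem onPairs_fst_snd (x : Fin G.m → ℝ) (e : Fin G.m) :
    G.onPairs x (G.fst e) (G.snd e) = x e := by
  simp only [onPairs, Matrix.of_apply]
  rw [Finset.sum_eq_single e]
  · simp
  · intro e' _ hne
    refine if_neg fun h => hne (G.simple ?_)
    rcases h with ⟨h1, h2⟩ | ⟨h1, h2⟩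
    · simp [h1, h2]
    · simp [h1, h2, Sym2.eq_swap]
  · simp

theorem onPairs_snd_fst (x : Fin G.m → ℝ) (e : Fin G.m) :
    G.onPairs x (G.snd e) (G.fst e) = x e := by
  rw [onPairs_symm, onPairs_fst_snd]

theorem adj_nonneg (u v : Fin G.n) : 0 ≤ G.adj u v := G.onPairs_nonneg (fun e => (G.w_pos e).le) u v

theorem adj_symm (u v : Fin G.n) : G.adj u v = G.adj v u := G.onPairs_symm _ u v

theorem adj_transpose : G.adjᵀ = G.adj := by
  ext u v
  exact G.adj_symm v u

theorem adj_fst_snd (e : Fin G.m) : G.adj (G.fst e) (G.snd e) = G.w e := G.onPairs_fst_snd _ e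

/-- Adjacent vertices are the endpoints of an edge. -/
theorem exists_edge_of_adj {u v : Fin G.n} (h : 0 < G.adj u v) :
    ∃ e, (G.fst e = u ∧ G.snd e = v) ∨ (G.fst e = v ∧ G.snd e = u) := by
  by_contra hcon
  push Not at hcon
  refine h.ne' ?_
  simp only [adj, onPairs, Matrix.of_apply]
  refine Finset.sum_eq_zero fun e _ => if_neg ?_
  have := hcon e
  tauto

theorem deg_nonneg (u : Fin G.n) : 0 ≤ G.deg u := Finset.sum_nonneg fun v _ => G.adj_nonneg u v

theorem adj_le_deg (u v : Fin G.n) : G.adj u v ≤ G.deg u :=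
  Finset.single_le_sum (fun v _ => G.adj_nonneg u v) (Finset.mem_univ v)

/-- The Dirichlet energy of a function on the vertices. -/
def energy (x : Fin G.n → ℝ) : ℝ := ∑ e, G.w e * (x (G.fst e) - x (G.snd e)) ^ 2

theorem energy_nonneg (x : Fin G.n → ℝ) : 0 ≤ G.energy x :=
  Finset.sum_nonneg fun e _ => mul_nonneg (G.w_pos e).le (sq_nonneg _)

theorem dotProduct_adj (x y : Fin G.n → ℝ) :
    x ⬝ᵥ G.adj *ᵥ y = ∑ u, ∑ v, G.adj u v * (x u * y v) := by
  simp only [dotProduct, mulVec, Finset.mul_sum]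
  exact Finset.sum_congr rfl fun u _ => Finset.sum_congr rfl fun v _ => by ring

theorem dotProduct_deg (x y : Fin G.n → ℝ) :
    x ⬝ᵥ diagonal G.deg *ᵥ y = ∑ u, ∑ v, G.adj u v * (x u * y u) := by
  simp only [dotProduct, mulVec_diagonal, deg, Finset.sum_mul, Finset.mul_sum]
  exact Finset.sum_congr rfl fun u _ => Finset.sum_congr rfl fun v _ => by ring

theorem dotProduct_deg_sub_adj (x : Fin G.n → ℝ) :
    x ⬝ᵥ diagonal G.deg *ᵥ x - x ⬝ᵥ G.adj *ᵥ x = G.energy x := by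
  rw [dotProduct_adj, dotProduct_deg, adj, sum_onPairs, sum_onPairs, ← Finset.sum_sub_distrib,
    energy]
  exact Finset.sum_congr rfl fun e _ => by ring

theorem dotProduct_laplacian (x : Fin G.n → ℝ) : x ⬝ᵥ G.laplacian *ᵥ x = G.energy x := by
  rw [← dotProduct_deg_sub_adj, laplacian, lap, sub_mulVec, dotProduct_sub]
  rfl

/-- The voltage between `a` and `b` is bounded by the energy, with the factor `R`. In terms of
effective resistances, `R` is at least the resistance between `a` and `b`. -/
def ResistanceLe (a b : Fin G.n) (R : ℝ) : Prop :=
  ∀ x : Fin G.n → ℝ, (x a - x b) ^ 2 ≤ R * G.energy x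

variable {G}

theorem ResistanceLe.mono {a b : Fin G.n} {R R' : ℝ} (h : G.ResistanceLe a b R) (hR : R ≤ R') :
    G.ResistanceLe a b R' := fun x =>
  (h x).trans (mul_le_mul_of_nonneg_right hR (G.energy_nonneg x))

theorem ResistanceLe.symm {a b : Fin G.n} {R : ℝ} (h : G.ResistanceLe a b R) :
    G.ResistanceLe b a R := fun x => by
  rw [← neg_sub, neg_sq]
  exact h x

variable (G) in
theorem resistanceLe_self (a : Fin G.n) : G.ResistanceLe a a 0 := fun x => by simp

theorem truncate_sq_add_le (a b t : ℝ) :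
    (max a t - max b t) ^ 2 + (min a t - min b t) ^ 2 ≤ (a - b) ^ 2 := by
  rcases le_total a t with ha | ha <;> rcases le_total b t with hb | hb <;>
    simp only [ha, hb, max_eq_left, max_eq_right, min_eq_left, min_eq_right] <;>
    nlinarith [mul_nonneg (sub_nonneg.2 ha) (sub_nonneg.2 hb)]

theorem energy_truncate_le (x : Fin G.n → ℝ) (t : ℝ) :
    G.energy (fun u => max (x u) t) + G.energy (fun u => min (x u) t) ≤ G.energy x := by
  rw [energy, energy, energy, ← Finset.sum_add_distrib]
  refine Finset.sum_le_sum fun e _ => ?_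
  rw [← mul_add]
  exact mul_le_mul_of_nonneg_left (truncate_sq_add_le _ _ _) (G.w_pos e).le

/-- Cauchy-Schwarz in the plane, stated without square roots. -/
theorem add_sq_le_add_mul_add {p q r s e f : ℝ} (hr : 0 ≤ r) (hs : 0 ≤ s) (he : 0 ≤ e)
    (hf : 0 ≤ f) (h1 : p ^ 2 ≤ r * e) (h2 : q ^ 2 ≤ s * f) :
    (p + q) ^ 2 ≤ (r + s) * (e + f) := by
  have h3 : 2 * (p * q) ≤ r * f + s * e := by
    refine le_of_sq_le_sq ?_ (by positivity)
    have h4 := mul_le_mul h1 h2 (sq_nonneg q) (by positivity)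
    nlinarith [sq_nonneg (r * f - s * e)]
  nlinarith

/-- The triangle inequality for effective resistances. -/
theorem ResistanceLe.trans {a b c : Fin G.n} {R S : ℝ} (hR : 0 ≤ R) (hS : 0 ≤ S)
    (hab : G.ResistanceLe a b R) (hbc : G.ResistanceLe b c S) : G.ResistanceLe a c (R + S) := by
  have key : ∀ {a b c : Fin G.n} {R S : ℝ}, 0 ≤ R → 0 ≤ S → G.ResistanceLe a b R →
      G.ResistanceLe b c S → ∀ x : Fin G.n → ℝ, x c ≤ x a →
      (x a - x c) ^ 2 ≤ (R + S) * G.energy x := by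
    intro a b c R S hR hS hab hbc x hca
    have hE := G.energy_nonneg x
    rcases le_total (x b) (x a) with hba | hba
    · rcases le_total (x c) (x b) with hcb | hcb
      -- With `x b` in between, truncating `x` at this level separates the two voltage drops into
      -- functions whose energies add up to at most that of `x`; Cauchy-Schwarz then combines the
      -- two bounds.
      · have h1 := hab fun u => max (x u) (x b)
        have h2 := hbc fun u => min (x u) (x b)
        simp only [max_eq_left hba, max_self] at h1
        simp only [min_eq_left hcb, min_self] at h2
        have h3 := add_sq_le_add_mul_add hR hS (G.energy_nonneg _) (G.energy_nonneg _) h1 h2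
        rw [sub_add_sub_cancel] at h3
        exact h3.trans (mul_le_mul_of_nonneg_left (energy_truncate_le x (x b)) (add_nonneg hR hS))
      -- If `x b` lies below `x c`, truncation at `x c` raises `b` to the level of `c`, and the
      -- bound for `a, b` alone suffices. The last case is symmetric.
      · have h1 := hab fun u => max (x u) (x c)
        simp only [max_eq_left hca, max_eq_right hcb] at h1
        have h2 := energy_truncate_le x (x c)
        have h3 := G.energy_nonneg fun u => min (x u) (x c)
        nlinarith [mul_nonneg hS hE]
    · have h1 := hbc fun u => min (x u) (x a)
      simp only [min_eq_left hca, min_eq_right hba] at h1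
      have h2 := energy_truncate_le x (x a)
      have h3 := G.energy_nonneg fun u => max (x u) (x a)
      nlinarith [mul_nonneg hR hE]
  intro x
  rcases le_total (x c) (x a) with h | h
  · exact key hR hS hab hbc x h
  · have := key hS hR hbc.symm hab.symm x h
    rwa [← neg_sub, neg_sq, add_comm R S]

/-- Cauchy-Schwarz in an eigenbasis of the Laplacian, pairing the inverse eigenvalues in the
resistance with the eigenvalues in the energy. -/
theorem resistanceLe_reff (e : Fin G.m) :
    G.ResistanceLe (G.fst e) (G.snd e) (G.reff (G.fst e) (G.snd e)) := by
  intro x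
  have hM := G.laplacian_isHermitian
  set U := (hM.eigenvectorUnitary : Matrix (Fin G.n) (Fin G.n) ℝ) with hU
  set d := hM.eigenvalues with hd
  set χ : Fin G.n → ℝ := Pi.single (G.fst e) 1 - Pi.single (G.snd e) 1 with hχ
  have hχx : ∀ y : Fin G.n → ℝ, χ ⬝ᵥ y = y (G.fst e) - y (G.snd e) := fun y => by
    simp [hχ, sub_dotProduct]
  have hUU : U * Uᵀ = 1 := by
    have := Unitary.coe_mul_star_self hM.eigenvectorUnitary
    rwa [Unitary.coe_star, star_eq_conjTranspose, conjTranspose_eq_transpose_of_trivial] at this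
  have hUU' : Uᵀ * U = 1 := by
    have := Unitary.coe_star_mul_self hM.eigenvectorUnitary
    rwa [star_eq_conjTranspose, conjTranspose_eq_transpose_of_trivial] at this
  have hspec : G.laplacian = U * diagonal d * Uᵀ := by
    have h := hM.spectral_theorem
    rw [Unitary.conjStarAlgAut_apply, star_eq_conjTranspose,
      conjTranspose_eq_transpose_of_trivial] at h
    simpa [Function.comp_def] using h
  have hreff : G.reff (G.fst e) (G.snd e) = ∑ i, (d i)⁻¹ * (Uᵀ *ᵥ χ) i ^ 2 := by
    rw [← dotProduct_conj_diagonal]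
    simp only [reff, pinv, star_eq_conjTranspose, conjTranspose_eq_transpose_of_trivial]
    rfl
  have henergy : ∀ y, G.energy y = ∑ i, d i * (Uᵀ *ᵥ y) i ^ 2 := fun y => by
    rw [← dotProduct_conj_diagonal, ← hspec, dotProduct_laplacian]
  have hd0 : ∀ i, 0 ≤ d i := fun i => by
    rw [← (conj_diagonal_dotProduct (d := d) hUU' i).1, ← hspec, dotProduct_laplacian]
    exact G.energy_nonneg _
  -- A null eigenvector has zero energy and so takes equal values at the ends of `e`; thus `χ` has
  -- no component along it, and `0⁻¹ = 0` loses nothing. It matters here that the two vertices are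
  -- joined by an edge.
  have hker : ∀ i, d i = 0 → (Uᵀ *ᵥ χ) i = 0 := fun i hi => by
    have h1 : G.energy (Uᵀ i) = 0 := by
      rw [← dotProduct_laplacian, hspec, (conj_diagonal_dotProduct (d := d) hUU' i).1, hi]
    have h2 := (Finset.sum_eq_zero_iff_of_nonneg fun e _ =>
      mul_nonneg (G.w_pos e).le (sq_nonneg _)).1 h1 e (Finset.mem_univ e)
    have h3 : Uᵀ i (G.fst e) - Uᵀ i (G.snd e) = 0 := by
      simpa [(G.w_pos e).ne'] using h2
    rw [← h3, ← hχx, dotProduct_comm]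
    rfl
  have hdot : χ ⬝ᵥ x = ∑ i, (Uᵀ *ᵥ χ) i * (Uᵀ *ᵥ x) i := by
    have h1 : χ ⬝ᵥ x = (Uᵀ *ᵥ χ) ⬝ᵥ (Uᵀ *ᵥ x) := by
      rw [dotProduct_mulVec, ← mulVec_transpose, transpose_transpose, mulVec_mulVec, hUU,
        one_mulVec]
    rw [h1]
    rfl
  rw [← hχx, hdot, hreff, henergy]
  refine Finset.sum_sq_le_sum_mul_sum_of_sq_le_mul _
    (fun i _ => mul_nonneg (inv_nonneg.2 (hd0 i)) (sq_nonneg _))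
    (fun i _ => mul_nonneg (hd0 i) (sq_nonneg _)) fun i _ => ?_
  by_cases hi : d i = 0
  · simp [hi, hker i hi]
  · refine le_of_eq ?_
    field_simp

end Graph

/-! ### Powers of the walk matrix and admissible estimates -/

namespace Graph

variable (G : Graph)

/-- The transition matrix `D⁻¹ A` of the random walk. -/
def transition : Matrix (Fin G.n) (Fin G.n) ℝ := diagonal (fun u => (G.deg u)⁻¹) * G.adj

theorem deg_mul_transition : diagonal G.deg * G.transition = G.adj := by
  ext u v
  rw [transition, diagonal_mul, diagonal_mul]
  by_cases h : G.deg u = 0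
  · have := G.adj_le_deg u v
    rw [h] at this ⊢
    rw [zero_mul, le_antisymm this (G.adj_nonneg u v)]
  · field_simp

/-- Reversibility: `D P = A` is symmetric, so `P` is self-adjoint for the inner product weighted by
the degrees. -/
theorem transition_transpose_pow_mul_deg (k : ℕ) :
    (G.transition ^ k)ᵀ * diagonal G.deg = diagonal G.deg * G.transition ^ k := by
  induction k with
  | zero => simp
  | succ k ih =>
    have h1 : G.transitionᵀ * diagonal G.deg = diagonal G.deg * G.transition := by
      rw [deg_mul_transition, ← G.adj_transpose, ← deg_mul_transition, transpose_mul,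
        diagonal_transpose]
    rw [pow_succ, transpose_mul, mul_assoc, ih, ← mul_assoc, h1, mul_assoc, ← pow_succ', ← pow_succ]

theorem powLaplacian_eq {k : ℕ} (hk : k ≠ 0) :
    G.powLaplacian k = diagonal G.deg - diagonal G.deg * G.transition ^ k := by
  obtain ⟨k, rfl⟩ := Nat.exists_eq_succ_of_ne_zero hk
  rw [Nat.succ_eq_add_one, pow_succ', ← mul_assoc, deg_mul_transition]
  rfl

theorem powLaplacian_transpose {k : ℕ} (hk : k ≠ 0) :
    (G.powLaplacian k)ᵀ = G.powLaplacian k := by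
  rw [powLaplacian_eq G hk, transpose_sub, transpose_mul, diagonal_transpose,
    transition_transpose_pow_mul_deg]

theorem deg_mul_transition_pow_mulVec_one (k : ℕ) :
    (diagonal G.deg * G.transition ^ k) *ᵥ 1 = G.deg := by
  have hA : G.adj *ᵥ 1 = G.deg := by
    ext u
    simp [mulVec, dotProduct, deg]
  have hD : diagonal G.deg *ᵥ 1 = G.deg := by
    ext u
    simp [mulVec_diagonal]
  induction k with
  | zero => rw [pow_zero, mul_one, hD]
  | succ k ih =>
    rw [pow_succ, ← mul_assoc, ← transition_transpose_pow_mul_deg, mul_assoc, deg_mul_transition,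
      ← mulVec_mulVec, hA, ← hD, mulVec_mulVec, transition_transpose_pow_mul_deg, ih, hD]

/-- The function on the double cover that is `x` on side A and `z` on side B. -/
def coverFun (x z : Fin G.n → ℝ) : Fin G.doubleCover.n → ℝ := Fin.addCases x z

/-- A vertex of the double cover: the copy of `u` on side A or B. -/
def coverVertex : Bool → Fin G.n → Fin G.doubleCover.n
  | false, u => Fin.castAdd G.n u
  | true, u => Fin.natAdd G.n u

theorem coverFun_false (x z : Fin G.n → ℝ) (u : Fin G.n) :
    G.coverFun x z (G.coverVertex false u) = x u :=
  Fin.addCases_left u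

theorem coverFun_true (x z : Fin G.n → ℝ) (u : Fin G.n) :
    G.coverFun x z (G.coverVertex true u) = z u :=
  Fin.addCases_right u

/-- The energy of a function on the double cover that is `x` on side A and `z` on side B. -/
theorem energy_doubleCover (x z : Fin G.n → ℝ) :
    G.doubleCover.energy (G.coverFun x z) =
      x ⬝ᵥ diagonal G.deg *ᵥ x + z ⬝ᵥ diagonal G.deg *ᵥ z - 2 * (x ⬝ᵥ G.adj *ᵥ z) := by
  rw [dotProduct_deg, dotProduct_deg, dotProduct_adj, adj, sum_onPairs, sum_onPairs, sum_onPairs]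
  have h : G.doubleCover.energy (G.coverFun x z) =
      ∑ e : Fin (G.m + G.m), G.doubleCover.w e *
        ((Fin.addCases x z : Fin (G.n + G.n) → ℝ) (G.doubleCover.fst e) -
        (Fin.addCases x z : Fin (G.n + G.n) → ℝ) (G.doubleCover.snd e)) ^ 2 := rfl
  rw [h, Fin.sum_univ_add, ← Finset.sum_add_distrib, ← Finset.sum_add_distrib, Finset.mul_sum,
    ← Finset.sum_sub_distrib]
  refine Finset.sum_congr rfl fun e _ => ?_
  simp only [doubleCover, Fin.addCases_left, Fin.addCases_right]
  ring

/-- The inner product weighted by the degrees, applied to iterates of the walk. -/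
theorem dotProduct_transition_pow (x : Fin G.n → ℝ) (i j : ℕ) :
    (G.transition ^ i *ᵥ x) ⬝ᵥ diagonal G.deg *ᵥ (G.transition ^ j *ᵥ x) =
      x ⬝ᵥ (diagonal G.deg * G.transition ^ (i + j)) *ᵥ x := by
  rw [pow_add, ← mul_assoc, ← transition_transpose_pow_mul_deg, mul_assoc, ← mulVec_mulVec,
    ← mulVec_mulVec, dotProduct_mulVec x, ← mulVec_transpose, transpose_transpose]

theorem dotProduct_adj_transition_pow (x : Fin G.n → ℝ) (i j : ℕ) :
    (G.transition ^ i *ᵥ x) ⬝ᵥ G.adj *ᵥ (G.transition ^ j *ᵥ x) =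
      x ⬝ᵥ (diagonal G.deg * G.transition ^ (i + j + 1)) *ᵥ x := by
  rw [← deg_mul_transition, ← mulVec_mulVec, mulVec_mulVec _ G.transition, ← pow_succ',
    dotProduct_transition_pow]
  rfl

/-- With `a_j = xᵀ D P^j x`, the drop `a_{2j} - a_{2j+2}` is the energy on the double cover of the
pair `P^j x`, `P^{j+1} x`. -/
theorem antitone_even_powers (x : Fin G.n → ℝ) :
    Antitone fun j : ℕ => x ⬝ᵥ (diagonal G.deg * G.transition ^ (j + j)) *ᵥ x := by
  refine antitone_nat_of_succ_le fun j => ?_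
  have h := G.doubleCover.energy_nonneg
    (G.coverFun (G.transition ^ j *ᵥ x) (G.transition ^ (j + 1) *ᵥ x))
  rw [energy_doubleCover, dotProduct_transition_pow, dotProduct_transition_pow,
    dotProduct_adj_transition_pow] at h
  rw [show j + (j + 1) + 1 = j + 1 + (j + 1) by ring] at h
  linarith

/-- The difference is the energy of `P^j x` in `G`. -/
theorem odd_power_le_even_power (x : Fin G.n → ℝ) (j : ℕ) :
    x ⬝ᵥ (diagonal G.deg * G.transition ^ (j + j + 1)) *ᵥ x ≤
      x ⬝ᵥ (diagonal G.deg * G.transition ^ (j + j)) *ᵥ x := by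
  have h := G.energy_nonneg (G.transition ^ j *ᵥ x)
  rw [← dotProduct_deg_sub_adj, dotProduct_transition_pow, dotProduct_adj_transition_pow] at h
  linarith

/-- The drop `a_{2j} + a_{2j+1} - a_{2j+2} - a_{2j+3}` is the energy of `P^j x + P^{j+1} x` in `G`.
-/
theorem antitone_even_add_odd_powers (x : Fin G.n → ℝ) :
    Antitone fun j : ℕ => x ⬝ᵥ (diagonal G.deg * G.transition ^ (j + j)) *ᵥ x +
      x ⬝ᵥ (diagonal G.deg * G.transition ^ (j + j + 1)) *ᵥ x := by
  refine antitone_nat_of_succ_le fun j => ?_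
  have h := G.energy_nonneg (G.transition ^ j *ᵥ x + G.transition ^ (j + 1) *ᵥ x)
  rw [← dotProduct_deg_sub_adj, dotProduct_add_mulVec (diagonal_transpose _),
    dotProduct_add_mulVec G.adj_transpose] at h
  simp only [dotProduct_transition_pow, dotProduct_adj_transition_pow] at h
  rw [show j + 1 + (j + 1) = j + j + 1 + 1 by ring, show j + (j + 1) = j + j + 1 by ring] at h
  rw [show j + 1 + (j + 1) = j + j + 1 + 1 by ring]
  linarith

theorem dotProduct_powLaplacian {k : ℕ} (hk : k ≠ 0) (x : Fin G.n → ℝ) :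
    x ⬝ᵥ G.powLaplacian k *ᵥ x =
      x ⬝ᵥ diagonal G.deg *ᵥ x - x ⬝ᵥ (diagonal G.deg * G.transition ^ k) *ᵥ x := by
  rw [powLaplacian_eq G hk, sub_mulVec, dotProduct_sub]

/-- For `k = 2j + 1` one has `2 a_k ≤ a_{2j} + a_{2j+1} ≤ a_0 + a_1`, which rearranges to `a_0 - a_1
≤ 2 (a_0 - a_k)`. -/
theorem energy_le_of_odd {k : ℕ} (hk : Odd k) (x : Fin G.n → ℝ) :
    G.energy x ≤ 2 * (x ⬝ᵥ G.powLaplacian k *ᵥ x) := by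
  rw [dotProduct_powLaplacian G hk.pos.ne']
  obtain ⟨j, rfl⟩ := hk
  have h1 := G.antitone_even_add_odd_powers x (Nat.zero_le j)
  have h2 := G.odd_power_le_even_power x j
  have h3 := G.dotProduct_deg_sub_adj x
  simp only [add_zero, pow_zero, mul_one, zero_add, pow_one, deg_mul_transition] at h1
  rw [two_mul j]
  linarith

/-- The function `P x` on side B makes the energy `a_0 + a_2 - 2 a_2 = a_0 - a_2`, and `a_k ≤ a_2`
because `k` is even and at least `2`. -/
theorem energy_doubleCover_le_of_even {k : ℕ} (hk : Even k) (hk0 : k ≠ 0) (x : Fin G.n → ℝ) :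
    G.doubleCover.energy (G.coverFun x (G.transition *ᵥ x)) ≤
      x ⬝ᵥ G.powLaplacian k *ᵥ x := by
  rw [dotProduct_powLaplacian G hk0, energy_doubleCover]
  obtain ⟨j, rfl⟩ := hk
  have h1 := G.antitone_even_powers x (show 1 ≤ j by omega)
  have h2 := G.dotProduct_transition_pow x 1 1
  have h3 := G.dotProduct_adj_transition_pow x 0 1
  simp only [pow_zero, pow_one, one_mulVec] at h1 h2 h3
  rw [h2, h3]
  simp only [zero_add] at *
  linarith

theorem powLaplacian_nonneg {k : ℕ} (hk : k ≠ 0) (x : Fin G.n → ℝ) :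
    0 ≤ x ⬝ᵥ G.powLaplacian k *ᵥ x := by
  rcases Nat.even_or_odd k with h | h
  · exact (G.doubleCover.energy_nonneg _).trans (G.energy_doubleCover_le_of_even h hk x)
  · have := G.energy_le_of_odd h x
    linarith [G.energy_nonneg x]

/-- The properties of the estimates that the analysis of the sampling uses. -/
structure Admissible (k : ℕ) (r : Fin G.m → ℝ) : Prop where
  one_le_fst : ∀ e, 1 ≤ r e * G.deg (G.fst e)
  one_le_snd : ∀ e, 1 ≤ r e * G.deg (G.snd e)
  dominates : ∀ (u : Fin G.n) (l : List (Fin G.n)), l.length = k →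
    List.IsChain (fun a b => 0 < G.adj a b) (u :: l) → ∀ x : Fin G.n → ℝ,
      (x u - x (l.getLastD u)) ^ 2 ≤
        2 * pathSum (G.onPairs r) (u :: l) * (x ⬝ᵥ G.powLaplacian k *ᵥ x)

variable {G}

theorem Admissible.pos {k : ℕ} {r : Fin G.m → ℝ} (h : G.Admissible k r) (e : Fin G.m) :
    0 < r e := by
  have h1 := h.one_le_fst e
  by_contra hcon
  nlinarith [G.deg_nonneg (G.fst e)]

/-- The edges at one non-isolated vertex `u` suffice: each satisfies `w_e r_e deg u ≥ w_e`, and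
these weights add up to `deg u`. The bound is what makes the rounding of the number of samples
harmless. -/
theorem Admissible.one_le_sum {k : ℕ} {r : Fin G.m → ℝ} (h : G.Admissible k r) (hm : 0 < G.m) :
    1 ≤ ∑ e, G.w e * r e := by
  set u := G.fst ⟨0, hm⟩ with hu
  have hdeg : G.deg u = ∑ e, G.w e * ((if G.fst e = u then 1 else 0) +
      (if G.snd e = u then 1 else 0)) := by
    rw [← G.sum_onPairs G.w fun a _ => if a = u then 1 else 0]
    simp only [mul_ite, mul_one, mul_zero]
    rw [Finset.sum_comm]
    simp [deg, adj]
  have hpos : 0 < G.deg u := by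
    have h1 := h.one_le_fst ⟨0, hm⟩
    refine lt_of_le_of_ne (G.deg_nonneg u) fun h0 => ?_
    rw [← hu, ← h0] at h1
    linarith
  have hle : G.deg u ≤ (∑ e, G.w e * r e) * G.deg u := by
    conv_lhs => rw [hdeg]
    rw [Finset.sum_mul]
    refine Finset.sum_le_sum fun e _ => ?_
    rw [mul_assoc]
    refine mul_le_mul_of_nonneg_left ?_ (G.w_pos e).le
    have hr := (h.pos e).le
    have hne := G.ne e
    by_cases h1 : G.fst e = u
    · have h2 : G.snd e ≠ u := fun h2 => hne (h1.trans h2.symm)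
      have := h.one_le_fst e
      simpa [h1, h2] using this
    · by_cases h2 : G.snd e = u
      · have := h.one_le_snd e
        simpa [h1, h2] using this
      · simp only [h1, h2, if_false, add_zero]
        exact mul_nonneg hr hpos.le
  nlinarith

theorem energy_single_le (u : Fin G.n) : G.energy (Pi.single u 1) ≤ G.deg u := by
  rw [← dotProduct_deg_sub_adj]
  simp [G.adj_nonneg u u]

theorem pathSum_nonneg {V : Type} {ρ : V → V → ℝ} (h : ∀ a b, 0 ≤ ρ a b) :
    ∀ l : List V, 0 ≤ pathSum ρ l
  | [] => le_rfl
  | [_] => le_rfl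
  | u :: v :: l => add_nonneg (h u v) (pathSum_nonneg h (v :: l))

theorem resistanceLe_onPairs {r : Fin G.m → ℝ}
    (hr : ∀ e, G.ResistanceLe (G.fst e) (G.snd e) (r e)) {u v : Fin G.n} (h : 0 < G.adj u v) :
    G.ResistanceLe u v (G.onPairs r u v) := by
  obtain ⟨e, ⟨rfl, rfl⟩ | ⟨rfl, rfl⟩⟩ := G.exists_edge_of_adj h
  · rw [onPairs_fst_snd]
    exact hr e
  · rw [onPairs_snd_fst]
    exact (hr e).symm

theorem resistanceLe_walk {r : Fin G.m → ℝ} (hr0 : ∀ e, 0 ≤ r e)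
    (hr : ∀ e, G.ResistanceLe (G.fst e) (G.snd e) (r e)) (u : Fin G.n) (l : List (Fin G.n))
    (h : List.IsChain (fun a b => 0 < G.adj a b) (u :: l)) :
    G.ResistanceLe u (l.getLastD u) (pathSum (G.onPairs r) (u :: l)) := by
  induction l generalizing u with
  | nil => exact G.resistanceLe_self u
  | cons v l ih =>
    rw [List.isChain_cons_cons] at h
    have := (resistanceLe_onPairs hr h.1).trans (G.onPairs_nonneg hr0 u v)
      (pathSum_nonneg (G.onPairs_nonneg hr0) (v :: l)) (ih v h.2)
    rw [← List.getLastD_cons (a := u)] at this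
    exact this

/-- Indicator functions of the two endpoints, inserted into the resistance bound, give the degree
conditions. Domination along walks is the triangle inequality followed by `energy_le_of_odd`. -/
theorem admissible_of_odd {k : ℕ} (hk : Odd k) {f : ℕ → ℕ → ℝ} {r : Fin G.m → ℝ}
    (h : G.IsGoodEstimate f r) : G.Admissible k r := by
  have hr : ∀ e, G.ResistanceLe (G.fst e) (G.snd e) (r e) := fun e =>
    (resistanceLe_reff e).mono (h.1 e)
  have hpos : ∀ (u : Fin G.n) (r : ℝ), 1 ≤ r * G.energy (Pi.single u 1) → 0 < r := by
    intro u r h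
    by_contra hcon
    nlinarith [G.energy_nonneg (Pi.single u 1)]
  have h1 : ∀ e, 1 ≤ r e * G.energy (Pi.single (G.fst e) 1) := fun e => by
    have := hr e (Pi.single (G.fst e) 1)
    simpa [(G.ne e).symm] using this
  have h2 : ∀ e, 1 ≤ r e * G.energy (Pi.single (G.snd e) 1) := fun e => by
    have := hr e (Pi.single (G.snd e) 1)
    simpa [G.ne e] using this
  have hr0 : ∀ e, 0 ≤ r e := fun e => (hpos _ _ (h1 e)).le
  refine ⟨fun e => (h1 e).trans (mul_le_mul_of_nonneg_left (energy_single_le _) (hr0 e)),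
    fun e => (h2 e).trans (mul_le_mul_of_nonneg_left (energy_single_le _) (hr0 e)),
    fun u l _ hl x => ?_⟩
  have h3 := resistanceLe_walk hr0 hr u l hl x
  have h4 := mul_le_mul_of_nonneg_left (G.energy_le_of_odd hk x)
    (pathSum_nonneg (G.onPairs_nonneg hr0) (u :: l))
  linarith

/-- Exchanging the sides preserves the energy, because `A` is symmetric. This is needed because only
the estimate for one of the two lifts of each edge is used, while a lifted walk may cross either
lift. -/
theorem ResistanceLe.swap {u v : Fin G.n} {s : Bool} {R : ℝ}
    (h : G.doubleCover.ResistanceLe (G.coverVertex s u) (G.coverVertex (!s) v) R) :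
    G.doubleCover.ResistanceLe (G.coverVertex (!s) u) (G.coverVertex s v) R := by
  intro x
  have hx : x = G.coverFun (fun u => x (G.coverVertex false u))
      (fun u => x (G.coverVertex true u)) := by
    refine funext (Fin.addCases (fun u => ?_) fun u => ?_)
    · exact (G.coverFun_false (fun u => x (G.coverVertex false u)) _ u).symm
    · exact (G.coverFun_true _ (fun u => x (G.coverVertex true u)) u).symm
  have hswap : ∀ y z : Fin G.n → ℝ, G.doubleCover.energy (G.coverFun y z) =
      G.doubleCover.energy (G.coverFun z y) := fun y z => by
    have : y ⬝ᵥ G.adj *ᵥ z = z ⬝ᵥ G.adj *ᵥ y := by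
      rw [dotProduct_mulVec, ← mulVec_transpose, adj_transpose, dotProduct_comm]
    rw [energy_doubleCover, energy_doubleCover, this]
    ring
  have h1 := h (G.coverFun (fun u => x (G.coverVertex true u))
    (fun u => x (G.coverVertex false u)))
  rw [hswap, ← hx] at h1
  cases s <;> simpa only [Bool.not_true, Bool.not_false, coverFun_false, coverFun_true] using h1

/-- A walk lifts to the double cover by changing side at every step, so the parity of its length
decides the side where it ends. -/
theorem resistanceLe_cover_walk {r : Fin G.m → ℝ} (hr0 : ∀ e, 0 ≤ r e)
    (hr : ∀ e, G.doubleCover.ResistanceLe (G.coverVertex false (G.fst e))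
      (G.coverVertex true (G.snd e)) (r e)) (s : Bool) (u : Fin G.n) (l : List (Fin G.n))
    (h : List.IsChain (fun a b => 0 < G.adj a b) (u :: l)) :
    G.doubleCover.ResistanceLe (G.coverVertex s u)
      (G.coverVertex (s ^^ decide (Odd l.length)) (l.getLastD u))
      (pathSum (G.onPairs r) (u :: l)) := by
  induction l generalizing u s with
  | nil =>
    rw [List.length_nil, show decide (Odd 0) = false by simp, Bool.xor_false]
    exact G.doubleCover.resistanceLe_self (G.coverVertex s u)
  | cons v l ih =>
    rw [List.isChain_cons_cons] at h
    have hstep : G.doubleCover.ResistanceLe (G.coverVertex s u) (G.coverVertex (!s) v)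
        (G.onPairs r u v) := by
      obtain ⟨e, ⟨rfl, rfl⟩ | ⟨rfl, rfl⟩⟩ := G.exists_edge_of_adj h.1
      · rw [onPairs_fst_snd]
        cases s
        · exact hr e
        · exact ResistanceLe.swap (s := false) (hr e)
      · rw [onPairs_snd_fst]
        cases s
        · exact (ResistanceLe.swap (s := false) (hr e)).symm
        · exact (hr e).symm
    have := hstep.trans (G.onPairs_nonneg hr0 u v)
      (pathSum_nonneg (G.onPairs_nonneg hr0) (v :: l)) (ih (!s) v h.2)
    have hpar : ((!s) ^^ decide (Odd l.length)) = (s ^^ decide (Odd (l.length + 1))) := by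
      by_cases ho : Odd l.length <;> cases s <;> simp [ho, Nat.odd_add_one]
    rw [hpar, ← List.getLastD_cons (a := u)] at this
    exact this

theorem admissible_of_even {k : ℕ} (hk : Even k) (hk0 : k ≠ 0) {f : ℕ → ℕ → ℝ}
    {r : Fin G.doubleCover.m → ℝ} (h : G.doubleCover.IsGoodEstimate f r) :
    G.Admissible k fun e => r (Fin.castAdd G.m e) := by
  have hr : ∀ e, G.doubleCover.ResistanceLe (G.coverVertex false (G.fst e))
      (G.coverVertex true (G.snd e)) (r (Fin.castAdd G.m e)) := fun e => by
    have := (resistanceLe_reff (G := G.doubleCover) (Fin.castAdd G.m e)).mono (h.1 _)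
    simpa [doubleCover, coverVertex] using this
  have h1 : ∀ e, 1 ≤ r (Fin.castAdd G.m e) * G.deg (G.fst e) := fun e => by
    have := hr e (G.coverFun (Pi.single (G.fst e) 1) 0)
    rw [energy_doubleCover, coverFun_false, coverFun_true] at this
    simpa using this
  have h2 : ∀ e, 1 ≤ r (Fin.castAdd G.m e) * G.deg (G.snd e) := fun e => by
    have := hr e (G.coverFun 0 (Pi.single (G.snd e) 1))
    rw [energy_doubleCover, coverFun_false, coverFun_true] at this
    simpa using this
  have hr0 : ∀ e, 0 ≤ r (Fin.castAdd G.m e) := fun e => by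
    by_contra hcon
    nlinarith [h1 e, G.deg_nonneg (G.fst e)]
  refine ⟨h1, h2, fun u l hlen hl x => ?_⟩
  -- For even `k` both ends of the lift lie on side A, where the test function is `x`; side B is
  -- free to carry `P x`.
  have h3 := resistanceLe_cover_walk hr0 hr false u l hl
    (G.coverFun x (G.transition *ᵥ x))
  rw [hlen] at h3
  have hpar : decide (Odd k) = false := by simpa using hk
  have h4 := G.energy_doubleCover_le_of_even hk hk0 x
  have h5 := pathSum_nonneg (G.onPairs_nonneg hr0) (u :: l)
  rw [hpar, Bool.xor_false, coverFun_false, coverFun_false] at h3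
  have h6 := mul_le_mul_of_nonneg_left h4 h5
  have h7 := mul_nonneg h5 (G.powLaplacian_nonneg hk0 x)
  linarith

end Graph

/-! ### Random walks grown from a marked edge -/

theorem expect_comm {α β : Type*} (p : PMF α) (q : PMF β) (g : α → β → ENNReal) :
    expect p (fun a => expect q (g a)) = expect q fun b => expect p fun a => g a b := by
  simp only [expect, ← ENNReal.tsum_mul_left]
  rw [ENNReal.tsum_comm]
  exact tsum_congr fun b => tsum_congr fun a => by ring

theorem draw_apply {α : Type} [Fintype α] (a₀ : α) {x : α → ℝ} (hx : ∀ a, 0 ≤ x a)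
    (hs : 0 < ∑ a, x a) (a : α) :
    draw a₀ x a = ENNReal.ofReal (x a) * (ENNReal.ofReal (∑ a, x a))⁻¹ := by
  have h : ∑' a, ENNReal.ofReal (x a) = ENNReal.ofReal (∑ a, x a) := by
    rw [tsum_fintype, ENNReal.ofReal_sum_of_nonneg fun a _ => hx a]
  rw [draw, dif_pos (by rw [h]; simpa using hs), PMF.normalize_apply, h]

theorem expect_fintype {α : Type*} [Fintype α] (p : PMF α) (g : α → ENNReal) :
    expect p g = ∑ a, p a * g a := tsum_fintype _

theorem expect_uniform {k : ℕ} [NeZero k] (g : Fin k → ENNReal) :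
    expect (PMF.uniformOfFintype (Fin k)) g = (k : ENNReal)⁻¹ * ∑ i, g i := by
  rw [expect_fintype, Finset.mul_sum]
  simp [PMF.uniformOfFintype_apply]

namespace Graph

variable (G : Graph)

theorem draw_adj_apply {u : Fin G.n} (hu : 0 < G.deg u) (v : Fin G.n) :
    draw u (G.adj u) v = ENNReal.ofReal (G.adj u v) * (ENNReal.ofReal (G.deg u))⁻¹ :=
  draw_apply u (G.adj_nonneg u) hu v

/-- The weight of an edge into `u` vanishes if `u` is isolated, so the formula for the law of the
next step holds with no condition on the degree. -/
theorem mul_expect_draw_adj (u v : Fin G.n) (g : Fin G.n → ENNReal) :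
    ENNReal.ofReal (G.adj v u) * expect (draw u (G.adj u)) g =
      ∑ b, ENNReal.ofReal (G.adj v u) * (ENNReal.ofReal (G.deg u))⁻¹ *
        ENNReal.ofReal (G.adj u b) * g b := by
  by_cases h : G.adj v u = 0
  · simp [h]
  · have hd : 0 < G.deg u := by
      refine lt_of_lt_of_le ?_ (G.adj_le_deg u v)
      rw [G.adj_symm]
      exact lt_of_le_of_ne (G.adj_nonneg v u) (Ne.symm h)
    rw [expect_fintype, Finset.mul_sum]
    refine Finset.sum_congr rfl fun b _ => ?_
    rw [G.draw_adj_apply hd]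
    ring

theorem expect_randomWalk_succ (j : ℕ) (u : Fin G.n) (g : List (Fin G.n) → ENNReal) :
    expect (G.randomWalk (j + 1) u) g =
      expect (draw u (G.adj u)) fun v => expect (G.randomWalk j v) fun l => g (v :: l) := by
  simp only [randomWalk, expect_bind, expect_pure]

/-- The sum of `g` over all walks of `i + 1 + j` steps, weighted by the product of the edge weights
divided by the product of the degrees of the interior vertices. -/
def walkTotal (i j : ℕ) (g : List (Fin G.n) → ENNReal) : ENNReal :=
  ∑ a, ∑ b, ENNReal.ofReal (G.adj a b) * expect (G.randomWalk i a) fun l =>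
    expect (G.randomWalk j b) fun r => g (l.reverse ++ a :: b :: r)

/-- The mark moves by one edge: the backward step `a → v` from the edge `ab` and the forward step `a
→ b` from the edge `va` have the same total factor `A_va A_ab / d_a`. -/
theorem walkTotal_succ (i j : ℕ) (g : List (Fin G.n) → ENNReal) :
    G.walkTotal (i + 1) j g = G.walkTotal i (j + 1) g := by
  have hL : ∀ a b, ENNReal.ofReal (G.adj a b) * (expect (G.randomWalk (i + 1) a) fun l =>
      expect (G.randomWalk j b) fun r => g (l.reverse ++ a :: b :: r)) =
      ∑ v, ENNReal.ofReal (G.adj v a) * (ENNReal.ofReal (G.deg a))⁻¹ * ENNReal.ofReal (G.adj a b) *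
        expect (G.randomWalk i v) fun l =>
          expect (G.randomWalk j b) fun r => g (l.reverse ++ v :: a :: b :: r) := by
    intro a b
    rw [expect_randomWalk_succ, G.adj_symm a b, mul_expect_draw_adj]
    refine Finset.sum_congr rfl fun v _ => ?_
    rw [G.adj_symm a v]
    simp only [List.reverse_cons, List.append_assoc, List.singleton_append]
    ring
  have hR : ∀ v a, ENNReal.ofReal (G.adj v a) * (expect (G.randomWalk i v) fun l =>
      expect (G.randomWalk (j + 1) a) fun r => g (l.reverse ++ v :: a :: r)) =
      ∑ b, ENNReal.ofReal (G.adj v a) * (ENNReal.ofReal (G.deg a))⁻¹ * ENNReal.ofReal (G.adj a b) *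
        expect (G.randomWalk i v) fun l =>
          expect (G.randomWalk j b) fun r => g (l.reverse ++ v :: a :: b :: r) := by
    intro v a
    rw [← mul_expect_draw_adj, expect_comm (draw a _)]
    simp only [expect_randomWalk_succ]
  simp only [walkTotal, hL, hR]
  rw [Finset.sum_comm (γ := Fin G.n)]
  rw [Finset.sum_comm]
  conv_rhs => rw [Finset.sum_comm]
  exact Finset.sum_congr rfl fun a _ => Finset.sum_comm

theorem walkTotal_eq (i j : ℕ) (g : List (Fin G.n) → ENNReal) :
    G.walkTotal i j g = G.walkTotal 0 (i + j) g := by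
  induction i generalizing j with
  | zero => rw [zero_add]
  | succ i ih => rw [walkTotal_succ, ih]; congr 1; ring

theorem length_of_mem_support_randomWalk {j : ℕ} {u : Fin G.n} {l : List (Fin G.n)}
    (h : l ∈ (G.randomWalk j u).support) : l.length = j := by
  induction j generalizing u l with
  | zero =>
    rw [randomWalk, PMF.support_pure, Set.mem_singleton_iff] at h
    simp [h]
  | succ j ih =>
    simp only [randomWalk, PMF.mem_support_bind_iff, PMF.support_pure,
      Set.mem_singleton_iff] at h
    obtain ⟨v, -, l', hl', rfl⟩ := h
    simp [ih hl']

theorem transition_pow_nonneg (i : ℕ) (b c : Fin G.n) : 0 ≤ (G.transition ^ i) b c := by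
  induction i generalizing b c with
  | zero =>
    rw [pow_zero, one_apply]
    split_ifs <;> norm_num
  | succ i ih =>
    rw [pow_succ, mul_apply]
    refine Finset.sum_nonneg fun v _ => mul_nonneg (ih b v) ?_
    rw [transition, diagonal_mul]
    exact mul_nonneg (inv_nonneg.2 (G.deg_nonneg v)) (G.adj_nonneg v c)

theorem deg_mul_transition_pow_nonneg (k : ℕ) (a b : Fin G.n) :
    0 ≤ (diagonal G.deg * G.transition ^ k) a b := by
  rw [diagonal_mul]
  exact mul_nonneg (G.deg_nonneg a) (G.transition_pow_nonneg k a b)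

theorem sum_adj_mul_expect_randomWalk (j : ℕ) (a : Fin G.n) (F : Fin G.n → ENNReal) :
    ∑ b, ENNReal.ofReal (G.adj a b) * expect (G.randomWalk j b) (fun r => F (r.getLastD b)) =
      ∑ c, ENNReal.ofReal ((G.adj * G.transition ^ j) a c) * F c := by
  induction j generalizing a with
  | zero => simp [randomWalk, expect_pure]
  | succ j ih =>
    have hnn : ∀ b c, 0 ≤ (G.adj * G.transition ^ j) b c := fun b c => by
      rw [mul_apply]
      exact Finset.sum_nonneg fun v _ =>
        mul_nonneg (G.adj_nonneg b v) (G.transition_pow_nonneg j v c)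
    have hstep : ∀ b, ENNReal.ofReal (G.adj a b) *
        expect (G.randomWalk (j + 1) b) (fun r => F (r.getLastD b)) =
        ∑ c, ENNReal.ofReal (G.adj a b * (G.deg b)⁻¹ * (G.adj * G.transition ^ j) b c) * F c := by
      intro b
      rw [expect_randomWalk_succ, mul_expect_draw_adj]
      simp only [List.getLastD_cons, mul_assoc]
      rw [← Finset.mul_sum, ← Finset.mul_sum, ih b, Finset.mul_sum, Finset.mul_sum]
      refine Finset.sum_congr rfl fun c _ => ?_
      by_cases hb : G.deg b = 0
      · have : G.adj a b = 0 := by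
          refine le_antisymm ?_ (G.adj_nonneg a b)
          rw [← hb, G.adj_symm]
          exact G.adj_le_deg b a
        simp [this]
      · have hb' : 0 < G.deg b := lt_of_le_of_ne (G.deg_nonneg b) (Ne.symm hb)
        rw [← ENNReal.ofReal_inv_of_pos hb', ENNReal.ofReal_mul (G.adj_nonneg a b),
          ENNReal.ofReal_mul (inv_nonneg.2 hb'.le)]
        ring
    simp only [hstep]
    rw [Finset.sum_comm]
    refine Finset.sum_congr rfl fun c _ => ?_
    rw [← Finset.sum_mul, ← ENNReal.ofReal_sum_of_nonneg fun b _ => mul_nonneg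
      (mul_nonneg (G.adj_nonneg a b) (inv_nonneg.2 (G.deg_nonneg b))) (hnn b c)]
    congr 2
    rw [pow_succ', ← mul_assoc, transition, ← mul_assoc, mul_assoc _ G.adj, mul_apply]
    exact Finset.sum_congr rfl fun b _ => by rw [mul_diagonal]

end Graph

/-! ### Path sums and ends of walks -/

section PathSum

variable {V : Type} {ρ : V → V → ℝ}

theorem pathSum_append_cons (l : List V) (a : V) (r : List V) :
    pathSum ρ (l ++ a :: r) = pathSum ρ (l ++ [a]) + pathSum ρ (a :: r) := by
  induction l with
  | nil => simp [pathSum]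
  | cons u l ih =>
    cases l with
    | nil => simp [pathSum]
    | cons v l =>
      simp only [List.cons_append, pathSum] at ih ⊢
      rw [ih, add_assoc]

theorem pathSum_reverse (hρ : ∀ a b, ρ a b = ρ b a) (l : List V) :
    pathSum ρ l.reverse = pathSum ρ l := by
  induction l with
  | nil => rfl
  | cons u l ih =>
    cases l with
    | nil => rfl
    | cons v l =>
      rw [List.reverse_cons, List.reverse_cons, List.append_assoc, List.singleton_append,
        pathSum_append_cons, ← List.reverse_cons, ih]
      simp only [pathSum, hρ v u]
      ring

/-- The value of `ρ` at the `i`-th step of a walk. -/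
def stepAt (ρ : V → V → ℝ) (i : ℕ) (l : List V) : ℝ :=
  match l.drop i with
  | a :: b :: _ => ρ a b
  | _ => 0

theorem stepAt_append {l : List V} {i : ℕ} (hl : l.length = i) (a b : V) (r : List V) :
    stepAt ρ i (l ++ a :: b :: r) = ρ a b := by
  rw [stepAt, List.drop_left' hl]

theorem stepAt_nonneg (h : ∀ a b, 0 ≤ ρ a b) (i : ℕ) (l : List V) : 0 ≤ stepAt ρ i l := by
  unfold stepAt
  split
  · exact h _ _
  · exact le_rfl

theorem sum_stepAt {k : ℕ} {l : List V} (hl : l.length = k + 1) :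
    ∑ i : Fin k, stepAt ρ i l = pathSum ρ l := by
  induction k generalizing l with
  | zero =>
    obtain ⟨u, rfl⟩ := List.length_eq_one_iff.1 hl
    rfl
  | succ k ih =>
    match l, hl with
    | u :: v :: l, hl =>
      rw [Fin.sum_univ_succ]
      have := ih (l := v :: l) (by simpa using hl)
      rw [pathSum, ← this]
      rfl

end PathSum

/-- The difference of the values of `x` at the two ends of a walk. -/
def endDiff {V : Type} (x : V → ℝ) (l : List V) : ℝ := l.head?.elim 0 x - l.getLast?.elim 0 x

theorem endDiff_reverse_sq {V : Type} (x : V → ℝ) (l : List V) :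
    endDiff x l.reverse ^ 2 = endDiff x l ^ 2 := by
  rw [endDiff, endDiff, List.head?_reverse, List.getLast?_reverse]
  ring

theorem endDiff_eq {V : Type} (x : V → ℝ) {l : List V} (hl : l ≠ []) (a b : V) :
    endDiff x l = x (l.headD a) - x (l.getLastD b) := by
  rw [endDiff, List.headD_eq_head?_getD, List.getLastD_eq_getLast?, List.head?_eq_some_head hl,
    List.getLast?_eq_some_getLast hl]
  rfl

theorem endDiff_cons {V : Type} (x : V → ℝ) (u : V) (l : List V) :
    endDiff x (u :: l) = x u - x (l.getLastD u) := by
  rw [endDiff_eq x (List.cons_ne_nil u l) u u, List.getLastD_cons, List.headD_cons]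

/-! ### The mean of one sample -/

namespace Graph

variable (G : Graph)

theorem ofReal_adj (u v : Fin G.n) : ENNReal.ofReal (G.adj u v) =
    ∑ e, if (G.fst e = u ∧ G.snd e = v) ∨ (G.fst e = v ∧ G.snd e = u)
      then ENNReal.ofReal (G.w e) else 0 := by
  simp only [adj, onPairs, Matrix.of_apply]
  rw [ENNReal.ofReal_sum_of_nonneg fun e _ => by split_ifs <;> simp [(G.w_pos e).le]]
  refine Finset.sum_congr rfl fun e _ => ?_
  split_ifs <;> simp

variable {G} {k : ℕ} {r : Fin G.m → ℝ}

/-- The sum over all walks of a function that is symmetric under reversal, weighted by the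
estimates of the steps. -/
theorem two_mul_sum_edges (hr : ∀ e, 0 ≤ r e) {g : List (Fin G.n) → ENNReal}
    (hg : ∀ l, g l.reverse = g l) (hk : k ≠ 0) :
    2 * ∑ e, ENNReal.ofReal (G.w e * r e) * ∑ i : Fin k,
      (expect (G.randomWalk i (G.fst e)) fun left =>
        expect (G.randomWalk (k - 1 - i) (G.snd e)) fun right =>
          g (left.reverse ++ G.fst e :: G.snd e :: right)) =
    G.walkTotal 0 (k - 1) fun l => ENNReal.ofReal (pathSum (G.onPairs r) l) * g l := by
  set Φ : ℕ → Fin G.n → Fin G.n → ENNReal := fun i a b =>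
    expect (G.randomWalk i a) fun left => expect (G.randomWalk (k - 1 - i) b) fun right =>
      g (left.reverse ++ a :: b :: right) with hΦ
  -- Reading the walk backwards exchanges the ends of the marked edge and sends its position `i` to
  -- `k - 1 - i`.
  have hrev : ∀ (i : Fin k) a b, Φ i a b = Φ (Fin.rev i) b a := by
    intro i a b
    simp only [hΦ]
    have h1 : k - 1 - (Fin.rev i : ℕ) = i := by
      rw [Fin.val_rev]; omega
    have h2 : (Fin.rev i : ℕ) = k - 1 - i := by
      rw [Fin.val_rev]; omega
    rw [h1, h2, expect_comm]
    congr 1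
    funext right
    congr 1
    funext left
    rw [← hg]
    simp
  have hpairs : ∀ i : Fin k, ∑ e, ENNReal.ofReal (G.w e * r e) *
      (Φ i (G.fst e) (G.snd e) + Φ i (G.snd e) (G.fst e)) =
      G.walkTotal i (k - 1 - i) fun l => ENNReal.ofReal (stepAt (G.onPairs r) i l) * g l := by
    intro i
    have h := G.sum_pairs (fun e => ENNReal.ofReal (G.w e))
      (fun u v => ENNReal.ofReal (G.onPairs r u v) * Φ i u v)
    simp only [← ofReal_adj, onPairs_fst_snd, onPairs_snd_fst, ← mul_add] at h
    have hL : ∑ e, ENNReal.ofReal (G.w e * r e) *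
        (Φ i (G.fst e) (G.snd e) + Φ i (G.snd e) (G.fst e)) =
        ∑ u, ∑ v, ENNReal.ofReal (G.adj u v) * (ENNReal.ofReal (G.onPairs r u v) * Φ i u v) := by
      rw [h]
      exact Finset.sum_congr rfl fun e _ => by rw [ENNReal.ofReal_mul (G.w_pos e).le, mul_assoc]
    rw [hL, walkTotal]
    refine Finset.sum_congr rfl fun a _ => Finset.sum_congr rfl fun b _ => ?_
    congr 1
    rw [← expect_const_mul]
    refine expect_congr fun left hl => ?_
    rw [← expect_const_mul]
    refine expect_congr fun right _ => ?_
    refine congrArg (fun t => ENNReal.ofReal t * _) (stepAt_append ?_ a b right).symm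
    rw [List.length_reverse, G.length_of_mem_support_randomWalk hl]
  -- An edge is stored in one orientation only; after summation over the positions the other one
  -- contributes the same amount, hence the factor 2.
  have hsum : 2 * ∑ e, ENNReal.ofReal (G.w e * r e) * ∑ i : Fin k, Φ i (G.fst e) (G.snd e) =
      ∑ i : Fin k, ∑ e, ENNReal.ofReal (G.w e * r e) *
      (Φ i (G.fst e) (G.snd e) + Φ i (G.snd e) (G.fst e)) := by
    rw [Finset.sum_comm, Finset.mul_sum]
    refine Finset.sum_congr rfl fun e _ => ?_
    rw [← Finset.mul_sum, Finset.sum_add_distrib, mul_left_comm, two_mul]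
    congr 2
    rw [← Equiv.sum_comp Fin.revPerm]
    exact Finset.sum_congr rfl fun i _ => by rw [Fin.revPerm_apply, hrev, Fin.rev_rev]
  rw [hsum]
  -- Moving the mark to the start turns all positions into sums over the same walks. Only the factor
  -- `stepAt` still depends on `i`, and these factors add up to the path sum.
  have hcomb : ∀ i : Fin k, ∑ e, ENNReal.ofReal (G.w e * r e) *
      (Φ i (G.fst e) (G.snd e) + Φ i (G.snd e) (G.fst e)) =
      G.walkTotal 0 (k - 1) fun l => ENNReal.ofReal (stepAt (G.onPairs r) i l) * g l := by
    intro i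
    rw [hpairs, walkTotal_eq]
    congr 1
    omega
  simp only [hcomb, walkTotal]
  rw [Finset.sum_comm]
  refine Finset.sum_congr rfl fun a _ => ?_
  rw [Finset.sum_comm]
  refine Finset.sum_congr rfl fun b _ => ?_
  rw [← Finset.mul_sum, ← expect_sum]
  congr 1
  refine expect_congr fun left hl => ?_
  rw [← expect_sum]
  refine expect_congr fun right hr' => ?_
  have hnn : ∀ i ∈ Finset.univ, 0 ≤ stepAt (G.onPairs r) ((i : Fin k) : ℕ)
      (left.reverse ++ a :: b :: right) := fun i _ =>
    stepAt_nonneg (G.onPairs_nonneg hr) _ _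
  rw [← Finset.sum_mul, ← ENNReal.ofReal_sum_of_nonneg hnn]
  refine congrArg (fun t => ENNReal.ofReal t * _) (sum_stepAt ?_)
  have h1 := G.length_of_mem_support_randomWalk hl
  have h2 := G.length_of_mem_support_randomWalk hr'
  simp only [List.length_append, List.length_reverse, List.length_cons]
  omega

/-- `D P^k` is symmetric with row sums equal to the degrees, so it is the adjacency matrix, loops
included, of the walk graph. -/
theorem dotProduct_powLaplacian_eq_sum (hk : k ≠ 0) (x : Fin G.n → ℝ) :
    2 * (x ⬝ᵥ G.powLaplacian k *ᵥ x) =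
      ∑ a, ∑ b, (diagonal G.deg * G.transition ^ k) a b * (x a - x b) ^ 2 := by
  set M := diagonal G.deg * G.transition ^ k with hM
  have hsymm : ∀ a b, M a b = M b a := fun a b => by
    have : Mᵀ = M := by
      rw [hM, transpose_mul, diagonal_transpose, transition_transpose_pow_mul_deg]
    exact congrFun (congrFun this b) a
  have hrow : ∀ a, ∑ b, M a b = G.deg a := fun a => by
    have := congrFun (G.deg_mul_transition_pow_mulVec_one k) a
    rw [← this, ← hM, mulVec, dotProduct]
    simp
  have h1 : x ⬝ᵥ diagonal G.deg *ᵥ x = ∑ a, ∑ b, M a b * x a ^ 2 := by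
    simp only [dotProduct, mulVec_diagonal, ← Finset.sum_mul, hrow]
    exact Finset.sum_congr rfl fun a _ => by ring
  have h2 : x ⬝ᵥ M *ᵥ x = ∑ a, ∑ b, M a b * (x a * x b) := by
    simp only [dotProduct, mulVec, Finset.mul_sum]
    exact Finset.sum_congr rfl fun a _ => Finset.sum_congr rfl fun b _ => by ring
  have h3 : ∑ a, ∑ b, M a b * x b ^ 2 = ∑ a, ∑ b, M a b * x a ^ 2 := by
    rw [Finset.sum_comm]
    exact Finset.sum_congr rfl fun a _ => Finset.sum_congr rfl fun b _ => by rw [hsymm]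
  have h4 : ∑ a, ∑ b, M a b * (x a - x b) ^ 2 = ∑ a, ∑ b, M a b * x a ^ 2 +
      ∑ a, ∑ b, M a b * x b ^ 2 - 2 * ∑ a, ∑ b, M a b * (x a * x b) := by
    simp only [Finset.mul_sum, ← Finset.sum_add_distrib, ← Finset.sum_sub_distrib]
    exact Finset.sum_congr rfl fun a _ => Finset.sum_congr rfl fun b _ => by ring
  rw [dotProduct_powLaplacian G hk, h4, h3, h1, h2]
  ring

theorem pathSum_pos_of_mem {ρ : Fin G.n → Fin G.n → ℝ} (h : ∀ a b, 0 ≤ ρ a b) (l : List (Fin G.n))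
    {a b : Fin G.n} (hab : 0 < ρ a b) (r : List (Fin G.n)) :
    0 < pathSum ρ (l ++ a :: b :: r) := by
  rw [pathSum_append_cons, pathSum]
  have h1 := pathSum_nonneg h (l ++ [a])
  have h2 := pathSum_nonneg h (b :: r)
  linarith

/-- The expected contribution of one sample to the quadratic form of the output. -/
theorem expect_sampleEdge (hm : 0 < G.m) [NeZero k] (hr : ∀ e, 0 < r e) {h : ℝ} (hh : 0 < h)
    (x : Fin G.n → ℝ) :
    expect (G.sampleEdge hm k r h) (fun t => ENNReal.ofReal (t.2.2 * (x t.1 - x t.2.1) ^ 2)) =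
      ENNReal.ofReal ((x ⬝ᵥ G.powLaplacian k *ᵥ x) / (h * (k * ∑ e, G.w e * r e))) := by
  have hk : k ≠ 0 := NeZero.ne k
  have hwr : ∀ e, 0 < G.w e * r e := fun e => mul_pos (G.w_pos e) (hr e)
  have htot_pos : 0 < ∑ e, G.w e * r e := Finset.sum_pos (fun e _ => hwr e) ⟨⟨0, hm⟩, Finset.mem_univ _⟩
  set tot := ∑ e, G.w e * r e with htot
  set g : List (Fin G.n) → ENNReal := fun l =>
    ENNReal.ofReal (1 / (h * pathSum (G.onPairs r) l) * endDiff x l ^ 2) with hg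
  have hgrev : ∀ l, g l.reverse = g l := fun l => by
    simp only [hg, endDiff_reverse_sq, pathSum_reverse (G.onPairs_symm r)]
  have hE : expect (G.sampleEdge hm k r h)
      (fun t => ENNReal.ofReal (t.2.2 * (x t.1 - x t.2.1) ^ 2)) =
      (ENNReal.ofReal tot)⁻¹ * (k : ENNReal)⁻¹ * ∑ e, ENNReal.ofReal (G.w e * r e) * ∑ i : Fin k,
      (expect (G.randomWalk i (G.fst e)) fun left =>
        expect (G.randomWalk (k - 1 - i) (G.snd e)) fun right =>
          g (left.reverse ++ G.fst e :: G.snd e :: right)) := by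
    simp only [sampleEdge, expect_bind, expect_pure, expect_uniform]
    rw [expect_fintype, Finset.mul_sum]
    refine Finset.sum_congr rfl fun e _ => ?_
    rw [draw_apply _ (fun e => (hwr e).le) htot_pos]
    have : ∀ left right : List (Fin G.n), g (left.reverse ++ G.fst e :: G.snd e :: right) =
        ENNReal.ofReal (1 / (h * pathSum (G.onPairs r)
          (left.reverse ++ G.fst e :: G.snd e :: right)) *
          (x ((left.reverse ++ G.fst e :: G.snd e :: right).headD (G.fst e)) -
          x ((left.reverse ++ G.fst e :: G.snd e :: right).getLastD (G.snd e))) ^ 2) :=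
      fun left right => by rw [← endDiff_eq x (by simp)]
    simp only [this]
    ring
  -- The path sum cancels against the one in the weight of the sample. The rest depends on the ends
  -- of the walk alone, so the sum over walks collapses to the matrix `D P^k`.
  have hwalk : (G.walkTotal 0 (k - 1) fun l => ENNReal.ofReal (pathSum (G.onPairs r) l) * g l) =
      ENNReal.ofReal (2 * (x ⬝ᵥ G.powLaplacian k *ᵥ x) / h) := by
    have h1 : ∀ a, ∑ b, ENNReal.ofReal (G.adj a b) * (expect (G.randomWalk 0 a) fun l =>
        expect (G.randomWalk (k - 1) b) fun right =>
          ENNReal.ofReal (pathSum (G.onPairs r) (l.reverse ++ a :: b :: right)) *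
          g (l.reverse ++ a :: b :: right)) =
        ∑ b, ENNReal.ofReal ((diagonal G.deg * G.transition ^ k) a b * (x a - x b) ^ 2 / h) := by
      intro a
      have hpow : diagonal G.deg * G.transition ^ k = G.adj * G.transition ^ (k - 1) := by
        conv_lhs => rw [← Nat.succ_pred_eq_of_ne_zero hk, Nat.succ_eq_add_one, pow_succ',
          ← mul_assoc, deg_mul_transition]
        rfl
      have hF := G.sum_adj_mul_expect_randomWalk (k - 1) a
        fun c => ENNReal.ofReal ((x a - x c) ^ 2 / h)
      rw [← hpow] at hF
      have hR : ∑ b, ENNReal.ofReal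
          ((diagonal G.deg * G.transition ^ k) a b * (x a - x b) ^ 2 / h) =
          ∑ b, ENNReal.ofReal ((diagonal G.deg * G.transition ^ k) a b) *
            ENNReal.ofReal ((x a - x b) ^ 2 / h) :=
        Finset.sum_congr rfl fun b _ => by
          rw [mul_div_assoc, ENNReal.ofReal_mul (G.deg_mul_transition_pow_nonneg k a b)]
      rw [hR, ← hF]
      refine Finset.sum_congr rfl fun b _ => ?_
      by_cases hab : G.adj a b = 0
      · simp [hab]
      have hab' : 0 < G.adj a b := lt_of_le_of_ne (G.adj_nonneg a b) (Ne.symm hab)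
      have hρ : 0 < G.onPairs r a b := by
        obtain ⟨e, ⟨rfl, rfl⟩ | ⟨rfl, rfl⟩⟩ := G.exists_edge_of_adj hab'
        · rw [onPairs_fst_snd]; exact hr e
        · rw [onPairs_snd_fst]; exact hr e
      rw [show G.randomWalk 0 a = PMF.pure [] from rfl, expect_pure]
      congr 1
      refine expect_congr fun right _ => ?_
      have hpos := pathSum_pos_of_mem (G.onPairs_nonneg fun e => (hr e).le) [] hρ right
      simp only [List.reverse_nil, List.nil_append] at hpos ⊢
      simp only [hg]
      rw [← ENNReal.ofReal_mul hpos.le, endDiff_cons, List.getLastD_cons]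
      congr 1
      field_simp
    simp only [walkTotal, h1]
    rw [dotProduct_powLaplacian_eq_sum hk, Finset.sum_div, ENNReal.ofReal_sum_of_nonneg]
    · refine Finset.sum_congr rfl fun a _ => ?_
      rw [Finset.sum_div, ENNReal.ofReal_sum_of_nonneg fun b _ => div_nonneg
        (mul_nonneg (G.deg_mul_transition_pow_nonneg k a b) (sq_nonneg _)) hh.le]
    · exact fun a _ => div_nonneg (Finset.sum_nonneg fun b _ =>
        mul_nonneg (G.deg_mul_transition_pow_nonneg k a b) (sq_nonneg _)) hh.le
  have htwo := two_mul_sum_edges (fun e => (hr e).le) hgrev hk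
  rw [hwalk] at htwo
  set T := ∑ e, ENNReal.ofReal (G.w e * r e) * ∑ i : Fin k,
      (expect (G.randomWalk i (G.fst e)) fun left =>
        expect (G.randomWalk (k - 1 - i) (G.snd e)) fun right =>
          g (left.reverse ++ G.fst e :: G.snd e :: right)) with hT
  have hTeq : T = ENNReal.ofReal ((x ⬝ᵥ G.powLaplacian k *ᵥ x) / h) := by
    rw [mul_div_assoc, ENNReal.ofReal_mul (by norm_num), ENNReal.ofReal_ofNat] at htwo
    exact (ENNReal.mul_right_inj (by norm_num) (by norm_num)).1 htwo
  have hk' : (0 : ℝ) < k := by exact_mod_cast Nat.pos_of_ne_zero hk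
  rw [hE, hTeq, ← ENNReal.ofReal_natCast, ← ENNReal.ofReal_inv_of_pos htot_pos,
    ← ENNReal.ofReal_inv_of_pos hk', ← ENNReal.ofReal_mul (by positivity),
    ← ENNReal.ofReal_mul (by positivity)]
  congr 1
  field_simp

end Graph

/-! ### From estimator answers to admissible estimates -/

namespace Graph

variable (G : Graph)

theorem good_estimate {k : ℕ} (hk : k ≠ 0) {f : ℕ → ℕ → ℝ}
    (hf : ∀ n m, f n m ≤ f (2 * n) (2 * m)) {r : Fin (G.estimatorInput k).m → ℝ}
    (h : (G.estimatorInput k).IsGoodEstimate f r) :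
    G.Admissible k (G.pullEstimates k r) ∧
      ∑ e, G.w e * G.pullEstimates k r e ≤ f (2 * G.n) (2 * G.m) := by
  rcases Nat.even_or_odd k with hev | hodd
  -- A variable graph `G'` allows substitution in the type of `r`, which depends on it.
  · have key : ∀ (G' : Graph) (hG' : G' = G.doubleCover) (r : Fin G'.m → ℝ) (hle : G.m ≤ G'.m),
        G'.IsGoodEstimate f r → G.Admissible k (fun e => r (Fin.castLE hle e)) ∧
          ∑ e, G.w e * r (Fin.castLE hle e) ≤ f (2 * G.n) (2 * G.m) := by
      rintro G' rfl r hle h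
      refine ⟨admissible_of_even hev hk h, ?_⟩
      have h2 : ∑ e : Fin (G.m + G.m), G.doubleCover.w e * r e ≤ f (G.n + G.n) (G.m + G.m) := h.2
      -- Half of the edges of the cover are dropped from the sum. Their estimates are nonnegative,
      -- as the indicator of an endpoint shows.
      have h0 : ∀ e, 0 ≤ r e := fun e => by
        have h3 := (resistanceLe_reff e).mono (h.1 e) (Pi.single (G.doubleCover.fst e) 1)
        have h4 := G.doubleCover.energy_nonneg (Pi.single (G.doubleCover.fst e) 1)
        rw [Pi.single_eq_same, Pi.single_eq_of_ne (G.doubleCover.ne e).symm] at h3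
        by_contra hcon
        nlinarith
      rw [Fin.sum_univ_add] at h2
      have h5 : 0 ≤ ∑ e : Fin G.m, G.doubleCover.w (Fin.natAdd G.m e) * r (Fin.natAdd G.m e) :=
        Finset.sum_nonneg fun e _ => mul_nonneg (G.doubleCover.w_pos _).le (h0 _)
      have h6 : ∑ e : Fin G.m, G.w e * r (Fin.castLE hle e) =
          ∑ e : Fin G.m, G.doubleCover.w (Fin.castAdd G.m e) * r (Fin.castAdd G.m e) := by
        refine Finset.sum_congr rfl fun e _ => ?_
        congr 1
        exact (Fin.addCases_left (motive := fun _ => ℝ) e).symm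
      rw [h6, two_mul, two_mul]
      linarith
    exact key _ (if_neg (Nat.not_odd_iff_even.2 hev)) r _ h
  · have key : ∀ (G' : Graph) (hG' : G' = G) (r : Fin G'.m → ℝ) (hle : G.m ≤ G'.m),
        G'.IsGoodEstimate f r → G.Admissible k (fun e => r (Fin.castLE hle e)) ∧
          ∑ e, G.w e * r (Fin.castLE hle e) ≤ f (2 * G.n) (2 * G.m) := by
      rintro G' rfl r hle h
      exact ⟨admissible_of_odd hodd h, h.2.trans (hf _ _)⟩
    exact key _ (if_pos hodd) r _ h

end Graph

/-! ### Laplacians of edge lists -/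

section EdgeLists

variable {n : ℕ}

theorem listAdj_cons (t : Fin n × Fin n × ℝ) (H : List (Fin n × Fin n × ℝ)) :
    listAdj (t :: H) = listAdj [t] + listAdj H := by
  ext u v
  simp [listAdj]

theorem lap_add (A B : Matrix (Fin n) (Fin n) ℝ) : lap (A + B) = lap A + lap B := by
  ext u v
  by_cases h : u = v
  · subst h
    simp [lap, Finset.sum_add_distrib]
    ring
  · simp [lap, h]
    ring

theorem lap_zero : lap (0 : Matrix (Fin n) (Fin n) ℝ) = 0 := by
  ext u v
  by_cases h : u = v <;> simp [lap, h]

theorem listAdj_nil : listAdj ([] : List (Fin n × Fin n × ℝ)) = 0 := by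
  ext u v
  simp [listAdj]

theorem lap_listAdj (H : List (Fin n × Fin n × ℝ)) :
    lap (listAdj H) = (H.map fun t => lap (listAdj [t])).sum := by
  induction H with
  | nil => rw [listAdj_nil, lap_zero, List.map_nil, List.sum_nil]
  | cons t H ih => rw [listAdj_cons, lap_add, ih, List.map_cons, List.sum_cons]

theorem listAdj_transpose (H : List (Fin n × Fin n × ℝ)) : (listAdj H)ᵀ = listAdj H := by
  ext u v
  simp only [listAdj, transpose_apply, of_apply, add_comm]

theorem lap_transpose {A : Matrix (Fin n) (Fin n) ℝ} (hA : Aᵀ = A) : (lap A)ᵀ = lap A := by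
  rw [lap, transpose_sub, diagonal_transpose, hA]

theorem dotProduct_lap_listAdj_singleton (t : Fin n × Fin n × ℝ) (x : Fin n → ℝ) :
    x ⬝ᵥ lap (listAdj [t]) *ᵥ x = t.2.2 * (x t.1 - x t.2.1) ^ 2 := by
  obtain ⟨a, b, w⟩ := t
  have hA : ∀ y : Fin n → Fin n → ℝ, ∑ u, ∑ v, listAdj [(a, b, w)] u v * y u v =
      w * (y a b + y b a) := by
    intro y
    have h1 : ∀ u v, listAdj [(a, b, w)] u v * y u v =
        (if a = u then (if b = v then w * y u v else 0) else 0) +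
        (if a = v then (if b = u then w * y u v else 0) else 0) := by
      intro u v
      simp only [listAdj, of_apply, List.map_cons, List.map_nil, List.sum_cons, List.sum_nil]
      simp only [ite_and, add_zero, add_mul, ite_mul, zero_mul]
    simp only [h1, Finset.sum_add_distrib]
    simp
    ring
  have h1 : x ⬝ᵥ lap (listAdj [(a, b, w)]) *ᵥ x =
      ∑ u, ∑ v, listAdj [(a, b, w)] u v * (x u * x u) -
      ∑ u, ∑ v, listAdj [(a, b, w)] u v * (x u * x v) := by
    rw [lap, sub_mulVec, dotProduct_sub]
    congr 1
    · simp only [dotProduct, mulVec_diagonal, Finset.sum_mul, Finset.mul_sum]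
      exact Finset.sum_congr rfl fun u _ => Finset.sum_congr rfl fun v _ => by ring
    · simp only [dotProduct, mulVec, Finset.mul_sum]
      exact Finset.sum_congr rfl fun u _ => Finset.sum_congr rfl fun v _ => by ring
  rw [h1, hA, hA]
  ring

theorem isSparsifier_of_abs_le {ε : ℝ} {L : Matrix (Fin n) (Fin n) ℝ} (hL : Lᵀ = L)
    {H : List (Fin n × Fin n × ℝ)} (hpos : ∀ e ∈ H, 0 < e.2.2)
    (h : ∀ x, |x ⬝ᵥ lap (listAdj H) *ᵥ x - x ⬝ᵥ L *ᵥ x| ≤ ε * (x ⬝ᵥ L *ᵥ x)) :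
    IsSparsifier ε L H := by
  have hs := lap_transpose (listAdj_transpose H)
  refine ⟨hpos, PosSemidef.of_dotProduct_mulVec_nonneg ?_ fun x => ?_,
    PosSemidef.of_dotProduct_mulVec_nonneg ?_ fun x => ?_⟩
  · rw [IsHermitian, conjTranspose_eq_transpose_of_trivial, transpose_sub, transpose_smul, hs, hL]
  · have := abs_le.1 (h x)
    rw [star_trivial, sub_mulVec, dotProduct_sub, smul_mulVec, dotProduct_smul, smul_eq_mul]
    linarith
  · rw [IsHermitian, conjTranspose_eq_transpose_of_trivial, transpose_sub, transpose_smul, hs, hL]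
  · have := abs_le.1 (h x)
    rw [star_trivial, sub_mulVec, dotProduct_sub, smul_mulVec, dotProduct_smul, smul_eq_mul]
    linarith

end EdgeLists

/-! ### Binary and natural logarithms -/

section Logarithms

theorem log_le_clog {n : ℕ} (hn : 0 < n) : Real.log n ≤ Nat.clog 2 n := by
  have h1 : (n : ℝ) ≤ 2 ^ Nat.clog 2 n := by exact_mod_cast Nat.le_pow_clog (by norm_num) n
  have h2 := Real.log_le_log (by exact_mod_cast hn) h1
  rw [Real.log_pow] at h2
  have h3 : Real.log 2 ≤ 1 := by linarith [Real.log_two_lt_d9]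
  nlinarith [(Nat.cast_nonneg (Nat.clog 2 n) : (0 : ℝ) ≤ _)]

/-- From `2^(clog - 1) < n` and `n ≥ 2` one gets the factor `2 / log 2 < 3`. -/
theorem clog_le_log {n : ℕ} (hn : 2 ≤ n) : (Nat.clog 2 n : ℝ) ≤ 3 * Real.log n := by
  have h1 : 2 ^ (Nat.clog 2 n - 1) < n := Nat.pow_pred_clog_lt_self (by norm_num) (by omega)
  have hc : 0 < Nat.clog 2 n := Nat.clog_pos (by norm_num) hn
  have h2 : (2 : ℝ) ^ (Nat.clog 2 n - 1) ≤ n := by exact_mod_cast h1.le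
  have h3 := Real.log_le_log (by positivity) h2
  rw [Real.log_pow, Nat.cast_sub hc, Nat.cast_one] at h3
  have h4 : Real.log 2 ≤ Real.log n := Real.log_le_log (by norm_num) (by exact_mod_cast hn)
  nlinarith [Real.log_two_gt_d9]

end Logarithms

/-! ### Analysis of the sampling algorithm -/

namespace Graph

variable {G : Graph} {k : ℕ} {r : Fin G.m → ℝ}

theorem two_le_n (hm : 0 < G.m) : 2 ≤ G.n := by
  have h1 := (G.fst ⟨0, hm⟩).2
  have h2 := (G.snd ⟨0, hm⟩).2
  have h3 : (G.fst ⟨0, hm⟩ : ℕ) ≠ G.snd ⟨0, hm⟩ := fun h => G.ne _ (Fin.ext h)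
  omega

theorem deg_pos_fst (e : Fin G.m) : 0 < G.deg (G.fst e) :=
  lt_of_lt_of_le (by rw [adj_fst_snd]; exact G.w_pos e) (G.adj_le_deg _ (G.snd e))

theorem deg_pos_snd (e : Fin G.m) : 0 < G.deg (G.snd e) :=
  lt_of_lt_of_le (by rw [adj_symm, adj_fst_snd]; exact G.w_pos e) (G.adj_le_deg _ (G.fst e))

theorem isChain_of_mem_support_randomWalk {j : ℕ} {u : Fin G.n} (hu : 0 < G.deg u)
    {l : List (Fin G.n)} (h : l ∈ (G.randomWalk j u).support) :
    List.IsChain (fun a b => 0 < G.adj a b) (u :: l) := by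
  induction j generalizing u l with
  | zero =>
    rw [randomWalk, PMF.support_pure, Set.mem_singleton_iff] at h
    simp [h]
  | succ j ih =>
    simp only [randomWalk, PMF.mem_support_bind_iff, PMF.support_pure,
      Set.mem_singleton_iff] at h
    obtain ⟨v, hv, l', hl', rfl⟩ := h
    have hadj : 0 < G.adj u v := by
      rw [PMF.mem_support_iff, G.draw_adj_apply hu] at hv
      by_contra hcon
      exact hv (by rw [ENNReal.ofReal_of_nonpos (not_lt.1 hcon), zero_mul])
    refine List.isChain_cons_cons.2 ⟨hadj, ih ?_ hl'⟩
    exact lt_of_lt_of_le (by rw [adj_symm]; exact hadj) (G.adj_le_deg v u)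

/-- Every possible outcome comes from a genuine walk of `k` steps in `G`, so domination along walks
applies; its factor 2 is why `h / 2` appears instead of `h`. -/
theorem mem_support_sampleEdge (hm : 0 < G.m) [NeZero k] (hr : G.Admissible k r) {h : ℝ}
    (hh : 0 < h) {t : Fin G.n × Fin G.n × ℝ} (ht : t ∈ (G.sampleEdge hm k r h).support) :
    0 < t.2.2 ∧ ∀ x : Fin G.n → ℝ,
      h / 2 * (t.2.2 * (x t.1 - x t.2.1) ^ 2) ≤ x ⬝ᵥ G.powLaplacian k *ᵥ x := by
  simp only [sampleEdge, PMF.mem_support_bind_iff, PMF.support_pure, Set.mem_singleton_iff] at ht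
  obtain ⟨e, -, i, -, left, hleft, right, hright, rfl⟩ := ht
  have hlen1 := G.length_of_mem_support_randomWalk hleft
  have hlen2 := G.length_of_mem_support_randomWalk hright
  have hc1 := isChain_of_mem_support_randomWalk (deg_pos_fst e) hleft
  have hc2 := isChain_of_mem_support_randomWalk (deg_pos_snd e) hright
  set W := left.reverse ++ G.fst e :: G.snd e :: right with hW
  have hchain : List.IsChain (fun a b => 0 < G.adj a b) W := by
    have hrev : List.IsChain (fun a b => 0 < G.adj a b) (G.fst e :: left).reverse := by
      rw [List.isChain_reverse]
      exact hc1.imp fun a b hab => by rw [G.adj_symm]; exact hab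
    have : W = (G.fst e :: left).reverse ++ (G.snd e :: right) := by
      rw [hW, List.reverse_cons, List.append_assoc, List.singleton_append]
    rw [this]
    refine hrev.append hc2 fun a ha b hb => ?_
    simp only [List.getLast?_reverse, List.head?_cons, Option.mem_def, Option.some.injEq] at ha hb
    rw [← ha, ← hb, adj_fst_snd]
    exact G.w_pos e
  have hWlen : W.length = k + 1 := by
    have := i.2
    simp only [hW, List.length_append, List.length_reverse, List.length_cons, hlen1, hlen2]
    omega
  have hpos : 0 < pathSum (G.onPairs r) W :=
    pathSum_pos_of_mem (G.onPairs_nonneg fun e => (hr.pos e).le) _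
      (by rw [onPairs_fst_snd]; exact hr.pos e) _
  refine ⟨by positivity, fun x => ?_⟩
  have hne : W ≠ [] := by simp [hW]
  have hdom : endDiff x W ^ 2 ≤
      2 * pathSum (G.onPairs r) W * (x ⬝ᵥ G.powLaplacian k *ᵥ x) := by
    obtain ⟨u, l, hul⟩ := List.exists_cons_of_ne_nil hne
    rw [hul] at hchain hWlen ⊢
    rw [endDiff_cons]
    exact hr.dominates u l (by simpa using hWlen) hchain x
  rw [← endDiff_eq x hne]
  calc h / 2 * (1 / (h * pathSum (G.onPairs r) W) * endDiff x W ^ 2)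
      = endDiff x W ^ 2 / (2 * pathSum (G.onPairs r) W) := by field_simp
    _ ≤ _ := by
      rw [div_le_iff₀ (by positivity)]
      linarith

theorem powLaplacian_eq_zero (hm : G.m = 0) : G.powLaplacian k = 0 := by
  have hadj : G.adj = 0 := by
    ext u v
    simp only [adj, onPairs, of_apply]
    exact Finset.sum_eq_zero fun e _ => absurd e.2 (by omega)
  have hdeg : G.deg = 0 := by
    ext u
    simp [deg, hadj]
  rw [powLaplacian, hadj, hdeg]
  ext u v
  simp

/-- The number of samples of the algorithm. -/
def numSamples (G : Graph) (C₀ k : ℕ) (ε : ℝ) (r : Fin G.m → ℝ) : ℕ :=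
  ⌈(C₀ * Nat.clog 2 G.n / ε ^ 2) * (k * ∑ e, G.w e * r e)⌉₊

theorem sparsify_eq (C₀ k : ℕ) [NeZero k] (ε : ℝ) (r : Fin G.m → ℝ) (hm : 0 < G.m) :
    G.sparsify C₀ k ε r = repeatDraw (G.sampleEdge hm k r
      (G.numSamples C₀ k ε r / (k * ∑ e, G.w e * r e))) (G.numSamples C₀ k ε r) := by
  rw [sparsify]
  exact dif_pos hm

theorem sparsify_eq_pure (C₀ k : ℕ) [NeZero k] (ε : ℝ) (r : Fin G.m → ℝ) (hm : G.m = 0) :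
    G.sparsify C₀ k ε r = PMF.pure [] := by
  rw [sparsify]
  exact dif_neg (by omega)

/-- The constant is 3 for passing to the natural logarithm times 2 for rounding up, which at most
doubles a number that is at least 1. -/
theorem numSamples_le {C₀ : ℕ} (hC₀ : 0 < C₀) (hk : k ≠ 0) {ε : ℝ} (hε : 0 < ε) (hε1 : ε < 1)
    (hr : G.Admissible k r) (hm : 0 < G.m) :
    (G.numSamples C₀ k ε r : ℝ) ≤
      6 * C₀ * (ε⁻¹ ^ 2 * k * Real.log G.n * ∑ e, G.w e * r e) := by
  have hn := two_le_n hm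
  have hsum := hr.one_le_sum hm
  have hk1 : (1 : ℝ) ≤ k := by exact_mod_cast Nat.one_le_iff_ne_zero.2 hk
  have hC1 : (1 : ℝ) ≤ C₀ := by exact_mod_cast hC₀
  have hc1 : (1 : ℝ) ≤ Nat.clog 2 G.n := by
    exact_mod_cast Nat.clog_pos (by norm_num) hn
  have hε2 : 1 ≤ ε⁻¹ ^ 2 := one_le_pow₀ ((one_le_inv₀ hε).2 hε1.le)
  have hbase : (C₀ * Nat.clog 2 G.n / ε ^ 2) * (k * ∑ e, G.w e * r e) =
      C₀ * (ε⁻¹ ^ 2 * k * Nat.clog 2 G.n * ∑ e, G.w e * r e) := by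
    rw [inv_pow]; field_simp
  have h1 : (1 : ℝ) ≤ C₀ * (ε⁻¹ ^ 2 * k * Nat.clog 2 G.n * ∑ e, G.w e * r e) :=
    one_le_mul_of_one_le_of_one_le hC1 (one_le_mul_of_one_le_of_one_le
      (one_le_mul_of_one_le_of_one_le (one_le_mul_of_one_le_of_one_le hε2 hk1) hc1) hsum)
  have h2 := (Nat.ceil_lt_add_one (zero_le_one.trans h1)).le
  rw [numSamples, hbase]
  refine h2.trans ?_
  have h3 : C₀ * (ε⁻¹ ^ 2 * k * Nat.clog 2 G.n * ∑ e, G.w e * r e) ≤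
      C₀ * (ε⁻¹ ^ 2 * k * (3 * Real.log G.n) * ∑ e, G.w e * r e) := by
    have := clog_le_log hn
    gcongr
  linarith

theorem numSamples_pos {C₀ : ℕ} (hC₀ : 0 < C₀) (hk : k ≠ 0) {ε : ℝ} (hε : 0 < ε)
    (hr : G.Admissible k r) (hm : 0 < G.m) : 0 < G.numSamples C₀ k ε r := by
  have hn := two_le_n hm
  have hsum := hr.one_le_sum hm
  have hk1 : (0 : ℝ) < k := by exact_mod_cast Nat.pos_of_ne_zero hk
  have hC1 : (0 : ℝ) < C₀ := by exact_mod_cast hC₀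
  have hc1 : (0 : ℝ) < Nat.clog 2 G.n := by
    exact_mod_cast Nat.clog_pos (by norm_num) hn
  exact Nat.ceil_pos.2 (by positivity)

/-- The two extra powers of `n` pay for the dimension and for the factor 2 of the two tails. -/
theorem two_mul_n_mul_exp_le {c n : ℕ} (hn : 2 ≤ n) {y : ℝ}
    (hy : (c + 2 : ℕ) * (Nat.clog 2 n : ℝ) ≤ y) :
    ENNReal.ofReal (2 * n * Real.exp (-y)) ≤ ((n : ENNReal) ^ c)⁻¹ := by
  have hn0 : (0 : ℝ) < n := by positivity
  have hn2 : (2 : ℝ) ≤ n := by exact_mod_cast hn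
  have h1 : Real.exp (-y) ≤ ((n : ℝ) ^ (c + 2))⁻¹ := by
    have h2 : (n : ℝ) ^ (c + 2) ≤ Real.exp y := by
      rw [← Real.exp_log hn0, ← Real.exp_nat_mul]
      refine Real.exp_le_exp.2 (le_trans ?_ hy)
      exact mul_le_mul_of_nonneg_left (log_le_clog (by omega)) (Nat.cast_nonneg _)
    rw [Real.exp_neg]
    exact inv_anti₀ (by positivity) h2
  have h3 : 2 * n * Real.exp (-y) ≤ ((n : ℝ) ^ c)⁻¹ := by
    calc 2 * n * Real.exp (-y) ≤ n * n * ((n : ℝ) ^ (c + 2))⁻¹ := by gcongr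
      _ = _ := by
        rw [pow_add]
        field_simp
  refine (ENNReal.ofReal_le_ofReal h3).trans (le_of_eq ?_)
  rw [ENNReal.ofReal_inv_of_pos (by positivity), ENNReal.ofReal_pow hn0.le, ENNReal.ofReal_natCast]

/-- The output of the sampling phase is a sparsifier with high probability. -/
theorem sparsify_failure_le (c : ℕ) [NeZero k] {ε : ℝ} (hε : 0 < ε) (hε1 : ε < 1)
    (hr : G.Admissible k r) :
    (G.sparsify (8 * (c + 2)) k ε r).toOuterMeasure {H | ¬ IsSparsifier ε (G.powLaplacian k) H} ≤
      ((G.n : ENNReal) ^ c)⁻¹ := by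
  have hk : k ≠ 0 := NeZero.ne k
  rcases Nat.eq_zero_or_pos G.m with hm | hm
  · rw [sparsify_eq_pure _ _ _ _ hm, PMF.toOuterMeasure_pure_apply, if_neg]
    · exact zero_le
    · refine not_not.2 (isSparsifier_of_abs_le ?_ (by simp) fun x => ?_)
      · rw [powLaplacian_eq_zero hm, transpose_zero]
      · rw [powLaplacian_eq_zero hm, listAdj_nil, lap_zero]
        simp
  have hn := two_le_n hm
  have hS : 0 < k * ∑ e, G.w e * r e :=
    mul_pos (by exact_mod_cast Nat.pos_of_ne_zero hk) (by linarith [hr.one_le_sum hm])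
  have hN := numSamples_pos (C₀ := 8 * (c + 2)) (by omega) hk hε hr hm
  rw [sparsify_eq _ _ _ _ hm]
  set N := G.numSamples (8 * (c + 2)) k ε r with hNdef
  set S := k * ∑ e, G.w e * r e with hSdef
  have hN' : (0 : ℝ) < N := by exact_mod_cast hN
  have hh : 0 < N / S := div_pos hN' hS
  have hform := fun (t : Fin G.n × Fin G.n × ℝ) x => dotProduct_lap_listAdj_singleton t x
  have hch := relative_matrix_chernoff (G.powLaplacian_transpose hk) (G.powLaplacian_nonneg hk)
    (p := G.sampleEdge hm k r (N / S)) (Y := fun t => lap (listAdj [t]))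
    (fun t _ => lap_transpose (listAdj_transpose _))
    (fun t ht x => by
      rw [hform]
      exact mul_nonneg (mem_support_sampleEdge hm hr hh ht).1.le (sq_nonneg _))
    (half_pos hh)
    (fun t ht x => by
      rw [hform]
      exact (mem_support_sampleEdge hm hr hh ht).2 x)
    hN
    (fun x => by
      simp only [hform]
      rw [expect_sampleEdge hm hr.pos hh, ← hSdef, div_mul_cancel₀ _ hS.ne'])
    hε hε1
  refine le_trans (measure_mono_of_support ?_) (hch.trans ?_)
  · intro H hH hbad hgood
    refine hbad ?_
    refine isSparsifier_of_abs_le (G.powLaplacian_transpose hk) (fun t ht => ?_) fun x => ?_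
    · exact (mem_support_sampleEdge hm hr hh ((mem_support_repeatDraw hH).2 t ht)).1
    · rw [lap_listAdj]
      exact hgood x
  · refine two_mul_n_mul_exp_le hn ?_
    -- Rounding up only raises `N / S`. The Chernoff exponent is `ε² (N / S) / 8`, from `h / 2` and
    -- the `1/4` of the bound, and the 8 in `C₀` compensates for it.
    have hge : ((8 * (c + 2) : ℕ) : ℝ) * Nat.clog 2 G.n / ε ^ 2 ≤ N / S := by
      rw [le_div_iff₀ hS]
      exact Nat.le_ceil _
    rw [div_le_iff₀ (by positivity)] at hge
    push_cast at hge ⊢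
    linarith

theorem length_of_mem_support_sparsify (C₀ : ℕ) [NeZero k] {ε : ℝ} (hm : 0 < G.m)
    {H : List (Fin G.n × Fin G.n × ℝ)} (hH : H ∈ (G.sparsify C₀ k ε r).support) :
    H.length = G.numSamples C₀ k ε r := by
  rw [sparsify_eq _ _ _ _ hm] at hH
  exact (mem_support_repeatDraw hH).1

/-- With admissible estimates, the output is a small sparsifier with high probability. -/
theorem sparsify_bad_le (c : ℕ) [NeZero k] {ε : ℝ} (hε : 0 < ε) (hε1 : ε < 1)
    (hr : G.Admissible k r) {F C : ℝ} (hF : ∑ e, G.w e * r e ≤ F)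
    (hC : 6 * (8 * (c + 2) : ℕ) ≤ C) :
    (G.sparsify (8 * (c + 2)) k ε r).toOuterMeasure {H | ¬ (IsSparsifier ε (G.powLaplacian k) H ∧
      (H.length : ℝ) ≤ C * (ε⁻¹ ^ 2 * k * Real.log G.n * F))} ≤ ((G.n : ENNReal) ^ c)⁻¹ := by
  refine le_trans (measure_mono_of_support fun H hH hbad hgood => hbad ⟨hgood, ?_⟩)
    (sparsify_failure_le c hε hε1 hr)
  have hC0 : 0 ≤ C := le_trans (by positivity) hC
  have hF0 : 0 ≤ F :=
    (Finset.sum_nonneg fun e _ => mul_nonneg (G.w_pos e).le (hr.pos e).le).trans hF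
  have hlog : 0 ≤ Real.log G.n := Real.log_natCast_nonneg _
  rcases Nat.eq_zero_or_pos G.m with hm | hm
  · rw [sparsify_eq_pure _ _ _ _ hm, PMF.support_pure, Set.mem_singleton_iff] at hH
    rw [hH, List.length_nil, Nat.cast_zero]
    positivity
  · rw [length_of_mem_support_sparsify _ hm hH]
    refine (numSamples_le (by omega) (NeZero.ne k) hε hε1 hr hm).trans ?_
    have hF1 := hr.one_le_sum hm
    gcongr

theorem lintegral_sparsify_bad_le (c : ℕ) [NeZero k] {ε : ℝ} (hε : 0 < ε) (hε1 : ε < 1)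
    {C : ℝ} (hC : 6 * (8 * (c + 2) : ℕ) ≤ C) {f : ℕ → ℕ → ℝ}
    (hf : ∀ n m, f n m ≤ f (2 * n) (2 * m)) (μ : Measure (Fin (G.estimatorInput k).m → ℝ))
    [IsProbabilityMeasure μ] {d : ENNReal}
    (hμ : μ {r | ¬ (G.estimatorInput k).IsGoodEstimate f r} ≤ d) :
    ∫⁻ r, (G.sparsify (8 * (c + 2)) k ε (G.pullEstimates k r)).toOuterMeasure
        {H | ¬ (IsSparsifier ε (G.powLaplacian k) H ∧
          (H.length : ℝ) ≤ C * (ε⁻¹ ^ 2 * k * Real.log G.n * f (2 * G.n) (2 * G.m)))} ∂μ ≤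
      d + ((G.n : ENNReal) ^ c)⁻¹ := by
  -- The set of bad answers is not known to be measurable; its measurable hull has the same measure.
  set B := toMeasurable μ {r | ¬ (G.estimatorInput k).IsGoodEstimate f r} with hB
  have hBm : MeasurableSet B := measurableSet_toMeasurable _ _
  calc _ ≤ ∫⁻ r, (B.indicator 1 r + ((G.n : ENNReal) ^ c)⁻¹) ∂μ := by
        refine lintegral_mono fun r => ?_
        by_cases hr : (G.estimatorInput k).IsGoodEstimate f r
        · obtain ⟨h1, h2⟩ := G.good_estimate (NeZero.ne k) hf hr
          exact le_add_left (sparsify_bad_le c hε hε1 h1 h2 hC)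
        · have hrB : r ∈ B := subset_toMeasurable _ _ hr
          rw [Set.indicator_of_mem hrB]
          refine le_add_right ?_
          refine (toOuterMeasure_le_expect (g := fun _ => 1) fun _ _ _ => le_rfl).trans ?_
          rw [expect_const]
          exact le_rfl
    _ = μ B + ((G.n : ENNReal) ^ c)⁻¹ := by
        rw [lintegral_add_left (measurable_one.indicator hBm), lintegral_indicator_one hBm,
          lintegral_const, measure_univ, mul_one]
    _ ≤ _ := by
        rw [hB, measure_toMeasurable]
        gcongr

end Graph

/-! ### Samplers reading a stream of uniform numbers -/

section Streams

/-- The stream that is left after `c` random numbers have been consumed. -/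
def shift (c : ℕ) (ω : ℕ → unitInterval) : ℕ → unitInterval := fun i => ω (c + i)

theorem shift_shift (c d : ℕ) (ω : ℕ → unitInterval) : shift d (shift c ω) = shift (c + d) ω := by
  ext i
  simp [shift, add_assoc]

theorem shift_zero (ω : ℕ → unitInterval) : shift 0 ω = ω := by
  ext i
  simp [shift]

/-- The first `c` entries of one stream, followed by another stream. -/
def glue (c : ℕ) (q : (ℕ → unitInterval) × (ℕ → unitInterval)) : ℕ → unitInterval :=
  fun i => if i < c then q.1 i else q.2 (i - c)

theorem measurable_glue (c : ℕ) : Measurable (glue c) := by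
  refine measurable_pi_lambda _ fun i => ?_
  by_cases h : i < c
  · simp only [glue, h, if_true]
    exact (measurable_pi_apply i).comp measurable_fst
  · simp only [glue, h, if_false]
    exact (measurable_pi_apply (i - c)).comp measurable_snd

theorem shift_glue (c : ℕ) (q : (ℕ → unitInterval) × (ℕ → unitInterval)) :
    shift c (glue c q) = q.2 := by
  ext i
  simp [shift, glue]

instance : IsProbabilityMeasure uniformSeq := by
  unfold uniformSeq
  infer_instance

/-- The preimage of a cylinder is a rectangle of two cylinders, one on the coordinates below `c` and
one on the shifted rest. This supplies the independence of successive stages of a sampler. -/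
theorem map_glue (c : ℕ) : (uniformSeq.prod uniformSeq).map (glue c) = uniformSeq := by
  refine Measure.eq_infinitePi _ fun s t ht => ?_
  have hpre : glue c ⁻¹' Set.pi s t =
      Set.pi ((s.filter (· < c) : Finset ℕ) : Set ℕ) t ×ˢ
      Set.pi (((s.filter (¬ · < c)).image (· - c) : Finset ℕ) : Set ℕ) (fun j => t (j + c)) := by
    ext q
    simp only [Set.mem_preimage, Set.mem_pi, Set.mem_prod, Finset.mem_coe, Finset.mem_filter,
      Finset.mem_image, glue]
    constructor
    · intro h
      refine ⟨fun i hi => by simpa [hi.2] using h i hi.1, ?_⟩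
      rintro j ⟨i, ⟨hi, hic⟩, rfl⟩
      rw [Nat.sub_add_cancel (not_lt.1 hic)]
      simpa [hic] using h i hi
    · rintro ⟨h1, h2⟩ i hi
      by_cases hic : i < c
      · simpa [hic] using h1 i ⟨hi, hic⟩
      · have := h2 (i - c) ⟨i, ⟨hi, hic⟩, rfl⟩
        rw [Nat.sub_add_cancel (not_lt.1 hic)] at this
        simpa [hic] using this
  have hms : ∀ s : Finset ℕ, ∀ t : ℕ → Set unitInterval, (∀ i, MeasurableSet (t i)) →
      uniformSeq (Set.pi s t) = ∏ i ∈ s, volume (t i) := fun s t ht =>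
    Measure.infinitePi_pi _ fun i _ => ht i
  rw [Measure.map_apply (measurable_glue c)
    (MeasurableSet.pi s.countable_toSet fun i _ => ht i), hpre, Measure.prod_prod, hms _ _ ht,
    hms _ _ fun j => ht (j + c), ← Finset.prod_filter_mul_prod_filter_not s (· < c)]
  congr 1
  rw [Finset.prod_image]
  · refine Finset.prod_congr rfl fun i hi => ?_
    rw [Nat.sub_add_cancel (not_lt.1 (Finset.mem_filter.1 hi).2)]
  · intro i hi j hj hij
    have h1 := (Finset.mem_filter.1 hi).2
    have h2 := (Finset.mem_filter.1 hj).2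
    simp only at hij
    omega

/-- The function `F` of a stream of random numbers consumes `c` numbers and has the law `p`. -/
structure Samples {α : Type} (c : ℕ) (F : (ℕ → unitInterval) → α) (p : PMF α) : Prop where
  dep : ∀ ω ω', (∀ i < c, ω i = ω' i) → F ω = F ω'
  finite : (Set.range F).Finite
  meas : ∀ a, MeasurableSet {ω | F ω = a}
  law : ∀ a, uniformSeq {ω | F ω = a} = p a

variable {α β : Type}

theorem samples_pure (a : α) : Samples 0 (fun _ => a) (PMF.pure a) where
  dep _ _ _ := rfl
  finite := (Set.finite_singleton a).subset (by rintro _ ⟨_, rfl⟩; rfl)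
  meas b := by
    by_cases h : a = b <;> simp [h]
  law b := by
    by_cases h : a = b
    · simp [h]
    · simp [h, Ne.symm h]

/-- `F` reads only the first `c` numbers and is thus independent of the shifted stream. Its finite
range makes the event a finite union of rectangles. The second stage has to consume the same number
`d` for every outcome of the first. -/
theorem Samples.bind {c d : ℕ} {F : (ℕ → unitInterval) → α} {p : PMF α}
    {F' : α → (ℕ → unitInterval) → β} {q : α → PMF β} (hF : Samples c F p)
    (hF' : ∀ a, Samples d (F' a) (q a)) :
    Samples (c + d) (fun ω => F' (F ω) (shift c ω)) (p.bind q) := by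
  have hms : Measurable (shift c) := measurable_pi_lambda _ fun i => measurable_pi_apply (c + i)
  have hmeas : ∀ b, MeasurableSet {ω | F' (F ω) (shift c ω) = b} := by
    intro b
    have : {ω | F' (F ω) (shift c ω) = b} =
        ⋃ a ∈ Set.range F, {ω | F ω = a} ∩ shift c ⁻¹' {ω | F' a ω = b} := by
      ext ω
      simp only [Set.mem_iUnion, Set.mem_inter_iff, Set.mem_ofPred_eq, Set.mem_preimage]
      exact ⟨fun h => ⟨F ω, ⟨ω, rfl⟩, rfl, h⟩, fun ⟨a, _, h1, h2⟩ => by rw [h1]; exact h2⟩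
    rw [this]
    exact hF.finite.measurableSet_biUnion fun a _ => (hF.meas a).inter (hms ((hF' a).meas b))
  refine ⟨fun ω ω' h => ?_, ?_, hmeas, fun b => ?_⟩
  · rw [hF.dep ω ω' fun i hi => h i (by omega)]
    exact (hF' _).dep _ _ fun i hi => h (c + i) (by omega)
  · refine (hF.finite.biUnion fun a _ => (hF' a).finite).subset ?_
    rintro _ ⟨ω, rfl⟩
    exact Set.mem_biUnion ⟨ω, rfl⟩ ⟨_, rfl⟩
  · have hset : glue c ⁻¹' {ω | F' (F ω) (shift c ω) = b} =
        ⋃ a ∈ hF.finite.toFinset, {ω | F ω = a} ×ˢ {ω | F' a ω = b} := by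
      ext q
      have hglue : F (glue c q) = F q.1 := hF.dep _ _ fun i hi => by simp [glue, hi]
      simp only [Set.mem_preimage, Set.mem_ofPred_eq, shift_glue, hglue, Set.mem_iUnion,
        Set.mem_prod, Set.Finite.mem_toFinset]
      exact ⟨fun h => ⟨F q.1, ⟨q.1, rfl⟩, rfl, h⟩, fun ⟨a, _, h1, h2⟩ => by rw [h1]; exact h2⟩
    conv_lhs => rw [← map_glue c]
    rw [Measure.map_apply (measurable_glue c) (hmeas b), hset, measure_biUnion_finset]
    · rw [PMF.bind_apply, tsum_eq_sum (s := hF.finite.toFinset)]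
      · refine Finset.sum_congr rfl fun a _ => ?_
        rw [Measure.prod_prod, hF.law, (hF' a).law]
      · intro a ha
        have : {ω | F ω = a} = ∅ := by
          ext ω
          simp only [Set.mem_ofPred_eq, Set.mem_empty_iff_false, iff_false]
          rintro rfl
          exact ha (by simp)
        rw [← hF.law, this, measure_empty, zero_mul]
    · intro a _ a' _ hne
      refine Set.disjoint_left.2 ?_
      rintro q ⟨h1, -⟩ ⟨h2, -⟩
      exact hne (h1.symm.trans h2)
    · exact fun a _ => (hF.meas a).prod ((hF' a).meas b)

theorem Samples.map {c : ℕ} {F : (ℕ → unitInterval) → α} {p : PMF α} (hF : Samples c F p)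
    (g : α → β) : Samples c (fun ω => g (F ω)) (p.bind fun a => PMF.pure (g a)) :=
  hF.bind (d := 0) fun a => samples_pure (g a)

/-- `N` consecutive runs of a sampler. -/
def repeatSample (c : ℕ) (F : (ℕ → unitInterval) → α) : ℕ → (ℕ → unitInterval) → List α
  | 0, _ => []
  | N + 1, ω => F ω :: repeatSample c F N (shift c ω)

theorem Samples.repeat {c : ℕ} {F : (ℕ → unitInterval) → α} {p : PMF α} (hF : Samples c F p)
    (N : ℕ) : Samples (N * c) (repeatSample c F N) (repeatDraw p N) := by
  induction N with
  | zero =>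
    rw [Nat.zero_mul]
    exact samples_pure []
  | succ N ih =>
    have := hF.bind fun a => ih.map fun l => a :: l
    rw [Nat.succ_mul, add_comm]
    exact this

theorem repeatSample_length (c : ℕ) (F : (ℕ → unitInterval) → α) (N : ℕ) (ω : ℕ → unitInterval) :
    (repeatSample c F N ω).length = N := by
  induction N generalizing ω with
  | zero => rfl
  | succ N ih => simp [repeatSample, ih]

theorem repeatSample_getElem (c : ℕ) (F : (ℕ → unitInterval) → α) (N : ℕ) (ω : ℕ → unitInterval)
    (j : ℕ) (hj : j < (repeatSample c F N ω).length) :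
    (repeatSample c F N ω)[j] = F (shift (j * c) ω) := by
  induction N generalizing ω j with
  | zero => simp [repeatSample] at hj
  | succ N ih =>
    cases j with
    | zero => simp [repeatSample, shift_zero]
    | succ j =>
      simp only [repeatSample, List.getElem_cons_succ]
      rw [ih, shift_shift]
      congr 2
      ring

end Streams

/-! ### Inversion of discrete distribution functions -/

section Pick

/-- The index `j < len` of the interval `[pre j, pre (j + 1))` that contains `x`. -/
def pick (len : ℕ) (pre : ℕ → ℝ) (x : ℝ) : ℕ :=
  Nat.findGreatest (fun j => pre j ≤ x) (len - 1)

theorem pick_lt {len : ℕ} (hlen : 0 < len) (pre : ℕ → ℝ) (x : ℝ) : pick len pre x < len := by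
  have := Nat.findGreatest_le (P := fun j => pre j ≤ x) (len - 1)
  rw [pick]
  omega

theorem pick_eq_iff {len : ℕ} (hlen : 0 < len) {pre : ℕ → ℝ}
    (hmono : ∀ i j, i ≤ j → j < len → pre i ≤ pre j) {x : ℝ} (hx : pre 0 ≤ x) {j : ℕ} :
    pick len pre x = j ↔ j < len ∧ pre j ≤ x ∧ (j + 1 < len → x < pre (j + 1)) := by
  rw [pick, Nat.findGreatest_eq_iff]
  constructor
  · rintro ⟨h1, h2, h3⟩
    refine ⟨by omega, ?_, fun h => not_le.1 (h3 (Nat.lt_succ_self j) (by omega))⟩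
    by_cases hj : j = 0
    · rwa [hj]
    · exact h2 hj
  · rintro ⟨h1, h2, h3⟩
    refine ⟨by omega, fun _ => h2, fun i hi hil => not_le.2 ?_⟩
    exact (h3 (by omega)).trans_le (hmono _ _ hi (by omega))

theorem volume_preimage_pick {len : ℕ} {y : ℕ → ℝ} (hy : ∀ i < len, 0 < y i) {j : ℕ}
    (hj : j < len) :
    MeasurableSet {u : unitInterval | pick len (fun j => ∑ i ∈ Finset.range j, y i)
      (u * ∑ i ∈ Finset.range len, y i) = j} ∧
    volume {u : unitInterval | pick len (fun j => ∑ i ∈ Finset.range j, y i)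
      (u * ∑ i ∈ Finset.range len, y i) = j} =
      ENNReal.ofReal (y j) * (ENNReal.ofReal (∑ i ∈ Finset.range len, y i))⁻¹ := by
  set pre : ℕ → ℝ := fun j => ∑ i ∈ Finset.range j, y i with hpre
  set tot := ∑ i ∈ Finset.range len, y i with htot
  have hlen : 0 < len := by omega
  have htot0 : 0 < tot := Finset.sum_pos (fun i hi => hy i (Finset.mem_range.1 hi))
    ⟨0, Finset.mem_range.2 hlen⟩
  have hmono : ∀ i j, i ≤ j → j ≤ len → pre i ≤ pre j := fun i j hij hjl =>
    Finset.sum_le_sum_of_subset_of_nonneg (Finset.range_mono hij)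
      fun l hl _ => (hy l (by have := Finset.mem_range.1 hl; omega)).le
  have hsucc : pre (j + 1) = pre j + y j := Finset.sum_range_succ _ _
  have hpre0 : pre 0 = 0 := Finset.sum_range_zero _
  have hpt : ∀ i ≤ len, pre i / tot ∈ unitInterval := fun i hi =>
    ⟨div_nonneg (by rw [← hpre0]; exact hmono 0 i (Nat.zero_le i) hi) htot0.le,
      (div_le_one htot0).2 (hmono i len hi le_rfl)⟩
  have hiff : ∀ u : unitInterval, pick len pre (u * tot) = j ↔
      pre j / tot ≤ u ∧ (j + 1 < len → (u : ℝ) < pre (j + 1) / tot) := by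
    intro u
    rw [pick_eq_iff hlen (fun i j hij hjl => hmono i j hij hjl.le)
      (by rw [hpre0]; exact mul_nonneg u.2.1 htot0.le), div_le_iff₀ htot0, lt_div_iff₀ htot0]
    simp [hj]
  have hval : ENNReal.ofReal (y j) * (ENNReal.ofReal tot)⁻¹ =
      ENNReal.ofReal (pre (j + 1) / tot - pre j / tot) := by
    rw [← ENNReal.ofReal_inv_of_pos htot0, ← ENNReal.ofReal_mul (hy j hj).le, hsucc]
    congr 1
    field_simp
    ring
  rw [hval]
  by_cases hj1 : j + 1 < len
  · have hset : {u : unitInterval | pick len pre (u * tot) = j} =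
        Set.Ico ⟨pre j / tot, hpt j hj.le⟩ ⟨pre (j + 1) / tot, hpt (j + 1) hj⟩ := by
      ext u
      rw [Set.mem_ofPred_eq, hiff]
      simp [hj1, ← Subtype.coe_le_coe, ← Subtype.coe_lt_coe]
    rw [hset]
    exact ⟨measurableSet_Ico, unitInterval.volume_Ico _ _⟩
  -- The last index takes the interval closed at 1, so the outcome `u = 1` is covered too.
  · have hlast : pre (j + 1) = tot := by
      have : j + 1 = len := by omega
      rw [this]
    have hset : {u : unitInterval | pick len pre (u * tot) = j} =
        Set.Ici ⟨pre j / tot, hpt j hj.le⟩ := by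
      ext u
      rw [Set.mem_ofPred_eq, hiff]
      simp [hj1, ← Subtype.coe_le_coe]
    rw [hset, hlast, div_self htot0.ne']
    exact ⟨measurableSet_Ici, unitInterval.volume_Ici _⟩

/-- Sampling an index from one random number and the prefix sums of the weights. -/
theorem samples_pick {len : ℕ} (hlen : 0 < len) {y : ℕ → ℝ} (hy : ∀ i < len, 0 < y i)
    (a₀ : Fin len) :
    Samples 1 (fun ω => (⟨pick len (fun j => ∑ i ∈ Finset.range j, y i)
      (ω 0 * ∑ i ∈ Finset.range len, y i), pick_lt hlen _ _⟩ : Fin len))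
      (draw a₀ fun i : Fin len => y i) := by
  have heval : ∀ j : Fin len, {ω : ℕ → unitInterval | (⟨pick len
      (fun j => ∑ i ∈ Finset.range j, y i) (ω 0 * ∑ i ∈ Finset.range len, y i),
      pick_lt hlen _ _⟩ : Fin len) = j} = (fun ω => ω 0) ⁻¹' {u : unitInterval | pick len
      (fun j => ∑ i ∈ Finset.range j, y i) (u * ∑ i ∈ Finset.range len, y i) = j} := by
    intro j
    ext ω
    simp [Fin.ext_iff]
  refine ⟨fun ω ω' h => by simp only [h 0 one_pos], Set.toFinite _, fun j => ?_, fun j => ?_⟩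
  · rw [heval]
    exact measurable_pi_apply 0 (volume_preimage_pick hy j.2).1
  · have hmp : MeasurePreserving (fun ω : ℕ → unitInterval => ω 0) uniformSeq volume :=
      measurePreserving_eval_infinitePi _ 0
    have hpos : 0 < ∑ i : Fin len, y i :=
      Finset.sum_pos (fun i _ => hy i i.2) ⟨⟨0, hlen⟩, Finset.mem_univ _⟩
    rw [heval, hmp.measure_preimage (volume_preimage_pick hy j.2).1.nullMeasurableSet,
      (volume_preimage_pick hy j.2).2, draw_apply _ (fun i : Fin len => (hy i i.2).le) hpos,
      Finset.sum_range]

theorem draw_one {k : ℕ} [NeZero k] (a₀ : Fin k) :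
    draw a₀ (fun _ => (1 : ℝ)) = PMF.uniformOfFintype (Fin k) := by
  have hk : (0 : ℝ) < k := by exact_mod_cast Nat.pos_of_ne_zero (NeZero.ne k)
  ext i
  rw [draw_apply _ (fun _ => zero_le_one) (by simpa using hk)]
  simp

end Pick

/-! ### Adjacency rows and the sampler as a function of the stream -/

theorem sum_range_getD (l : List ℝ) (j : ℕ) :
    ∑ i ∈ Finset.range j, l.getD i 0 = (l.take j).sum := by
  induction j with
  | zero => simp
  | succ j ih =>
    rw [Finset.sum_range_succ, ih, List.take_add_one, List.sum_append, List.getD_eq_getElem?_getD]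
    cases l[j]? <;> simp

namespace Graph

variable (G : Graph)

/-- The pair of the other endpoint and the number of edge `e`, if `u` is an endpoint of `e`. -/
def rowEntry (e : Fin G.m) (u : Fin G.n) : List (Fin G.n × Fin G.m) :=
  if G.fst e = u then [(G.snd e, e)] else if G.snd e = u then [(G.fst e, e)] else []

/-- The neighbours of `u` along the first `T` edges, with the numbers of these edges. -/
def row (u : Fin G.n) : ℕ → List (Fin G.n × Fin G.m)
  | 0 => []
  | T + 1 => row u T ++ if h : T < G.m then G.rowEntry ⟨T, h⟩ u else []

theorem row_succ (u : Fin G.n) {T : ℕ} (hT : T < G.m) :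
    G.row u (T + 1) = G.row u T ++ G.rowEntry ⟨T, hT⟩ u := by
  rw [row, dif_pos hT]

theorem mem_rowEntry {e : Fin G.m} {u : Fin G.n} {x : Fin G.n × Fin G.m}
    (h : x ∈ G.rowEntry e u) : (G.fst x.2 = u ∧ G.snd x.2 = x.1) ∨
      (G.fst x.2 = x.1 ∧ G.snd x.2 = u) := by
  unfold rowEntry at h
  split_ifs at h with h1 h2
  · rw [List.mem_singleton] at h
    subst h
    exact Or.inl ⟨h1, rfl⟩
  · rw [List.mem_singleton] at h
    subst h
    exact Or.inr ⟨rfl, h2⟩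
  · simp at h

theorem mem_row {u : Fin G.n} {T : ℕ} {x : Fin G.n × Fin G.m}
    (h : x ∈ G.row u T) : (G.fst x.2 = u ∧ G.snd x.2 = x.1) ∨
      (G.fst x.2 = x.1 ∧ G.snd x.2 = u) := by
  induction T with
  | zero => simp [row] at h
  | succ T ih =>
    rw [row, List.mem_append] at h
    rcases h with h | h
    · exact ih h
    · split_ifs at h
      · exact G.mem_rowEntry h
      · simp at h

theorem length_row_le (u : Fin G.n) (T : ℕ) : (G.row u T).length ≤ T := by
  induction T with
  | zero => simp [row]
  | succ T ih =>
    rw [row, List.length_append]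
    have : (if h : T < G.m then G.rowEntry ⟨T, h⟩ u else []).length ≤ 1 := by
      unfold rowEntry
      split_ifs <;> simp
    omega

theorem sum_row_eq (x : Fin G.m → ℝ) (u v : Fin G.n) :
    ((G.row u G.m).map fun p => if p.1 = v then x p.2 else 0).sum = G.onPairs x u v := by
  have key : ∀ T ≤ G.m, ((G.row u T).map fun p => if p.1 = v then x p.2 else 0).sum =
      ∑ e : Fin G.m, if (e : ℕ) < T then (if (G.fst e = u ∧ G.snd e = v) ∨
        (G.fst e = v ∧ G.snd e = u) then x e else 0) else 0 := by
    intro T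
    induction T with
    | zero => simp [row]
    | succ T ih =>
      intro hT
      rw [G.row_succ u (by omega), List.map_append, List.sum_append, ih (by omega)]
      have hsplit : ∀ (F : Fin G.m → ℝ), ∑ e : Fin G.m, (if (e : ℕ) < T + 1 then F e else 0) =
          (∑ e : Fin G.m, if (e : ℕ) < T then F e else 0) + F ⟨T, by omega⟩ := by
        intro F
        rw [← Finset.sum_erase_add _ _ (Finset.mem_univ (⟨T, by omega⟩ : Fin G.m)),
          ← Finset.sum_erase_add _ (fun e : Fin G.m => if (e : ℕ) < T then F e else 0)
            (Finset.mem_univ (⟨T, by omega⟩ : Fin G.m))]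
        simp only [lt_add_iff_pos_right, zero_lt_one, if_true, lt_irrefl, if_false, add_zero]
        congr 1
        refine Finset.sum_congr rfl fun e he => ?_
        have : (e : ℕ) ≠ T := fun h => (Finset.mem_erase.1 he).1 (Fin.ext h)
        exact if_congr (by omega) rfl rfl
      rw [hsplit]
      congr 1
      have hne := G.ne ⟨T, by omega⟩
      unfold rowEntry
      by_cases h1 : G.fst ⟨T, by omega⟩ = u
      · have h2 : G.snd ⟨T, by omega⟩ ≠ u := fun h => hne (h1.trans h.symm)
        simp [h1, h2]
      · by_cases h2 : G.snd ⟨T, by omega⟩ = u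
        · simp [h1, h2]
        · simp [h1, h2]
  rw [key G.m le_rfl]
  simp [onPairs]

theorem sum_row_weights (u : Fin G.n) :
    ((G.row u G.m).map fun p => G.w p.2).sum = G.deg u := by
  have : ∀ l : List (Fin G.n × Fin G.m), (l.map fun p => G.w p.2).sum =
      ∑ v, (l.map fun p => if p.1 = v then G.w p.2 else 0).sum := by
    intro l
    induction l with
    | nil => simp
    | cons a l ih => simp [ih, Finset.sum_add_distrib]
  rw [this]
  exact Finset.sum_congr rfl fun v _ => G.sum_row_eq G.w u v

theorem row_ne_nil {u : Fin G.n} (hu : 0 < G.deg u) : G.row u G.m ≠ [] := by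
  intro h
  rw [← G.sum_row_weights, h] at hu
  simp at hu

/-- The prefix sums of the weights of the edges at `u`. -/
def rowPrefix (u : Fin G.n) (j : ℕ) : ℝ := (((G.row u G.m).take j).map fun p => G.w p.2).sum

theorem rowPrefix_eq (u : Fin G.n) (j : ℕ) : G.rowPrefix u j =
    ∑ i ∈ Finset.range j, ((G.row u G.m).map fun p => G.w p.2).getD i 0 := by
  rw [sum_range_getD, rowPrefix, List.map_take]

theorem rowPrefix_zero (u : Fin G.n) : G.rowPrefix u 0 = 0 := by simp [rowPrefix]

theorem rowPrefix_length (u : Fin G.n) : G.rowPrefix u (G.row u G.m).length = G.deg u := by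
  rw [rowPrefix, List.take_length, sum_row_weights]

theorem getD_map_row_pos (u : Fin G.n) {i : ℕ} (hi : i < (G.row u G.m).length) :
    0 < ((G.row u G.m).map fun p => G.w p.2).getD i 0 := by
  rw [List.getD_eq_getElem _ _ (by simpa using hi), List.getElem_map]
  exact G.w_pos _

theorem rowPrefix_mono (u : Fin G.n) (i j : ℕ) (hij : i ≤ j) (hj : j < (G.row u G.m).length) :
    G.rowPrefix u i ≤ G.rowPrefix u j := by
  rw [rowPrefix_eq, rowPrefix_eq]
  exact Finset.sum_le_sum_of_subset_of_nonneg (Finset.range_mono hij) fun l hl _ =>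
    (G.getD_map_row_pos u (by have := Finset.mem_range.1 hl; omega)).le

/-- The position in the row of `u` of the next edge of the random walk. -/
def stepIndex (u : Fin G.n) (ω : ℕ → unitInterval) : ℕ :=
  pick (G.row u G.m).length (G.rowPrefix u) (ω 0 * G.deg u)

/-- One step of the random walk, computed from one random number. -/
def step (u : Fin G.n) (ω : ℕ → unitInterval) : Fin G.n :=
  ((G.row u G.m)[G.stepIndex u ω]?).elim u Prod.fst

theorem stepIndex_lt {u : Fin G.n} (hu : 0 < G.deg u) (ω : ℕ → unitInterval) :
    G.stepIndex u ω < (G.row u G.m).length :=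
  pick_lt (List.length_pos_of_ne_nil (G.row_ne_nil hu)) _ _

theorem step_eq {u : Fin G.n} (hu : 0 < G.deg u) (ω : ℕ → unitInterval) :
    G.step u ω = ((G.row u G.m)[G.stepIndex u ω]'(G.stepIndex_lt hu ω)).1 := by
  rw [step, List.getElem?_eq_getElem (G.stepIndex_lt hu ω)]
  rfl

/-- Inversion along the row of `u`, followed by passing from row positions to neighbours. -/
theorem samples_step (u : Fin G.n) : Samples 1 (G.step u) (draw u (G.adj u)) := by
  rcases (G.deg_nonneg u).lt_or_eq with hu | hu
  · have hlen := List.length_pos_of_ne_nil (G.row_ne_nil hu)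
    have hs := (samples_pick hlen (y := fun i => ((G.row u G.m).map fun p => G.w p.2).getD i 0)
      (fun i hi => G.getD_map_row_pos u hi) ⟨0, hlen⟩).map
      fun j => ((G.row u G.m)[j]).1
    have htot : ∑ i ∈ Finset.range (G.row u G.m).length,
        ((G.row u G.m).map fun p => G.w p.2).getD i 0 = G.deg u := by
      rw [← rowPrefix_eq, rowPrefix_length]
    convert hs using 1
    · funext ω
      have hidx : G.stepIndex u ω = pick (G.row u G.m).length (fun j => ∑ i ∈ Finset.range j,
          ((G.row u G.m).map fun p => G.w p.2).getD i 0) (ω 0 *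
          ∑ i ∈ Finset.range (G.row u G.m).length,
            ((G.row u G.m).map fun p => G.w p.2).getD i 0) := by
        rw [stepIndex, htot, show G.rowPrefix u = _ from funext (G.rowPrefix_eq u)]
      rw [G.step_eq hu]
      simp only [hidx]
      rfl
    · have htot' : ∑ i : Fin (G.row u G.m).length,
          ((G.row u G.m).map fun p => G.w p.2).getD i 0 = G.deg u := by
        rw [← htot, Finset.sum_range]
      have hpos : ∀ i : Fin (G.row u G.m).length,
          0 ≤ ((G.row u G.m).map fun p => G.w p.2).getD i 0 :=
        fun i => (G.getD_map_row_pos u i.2).le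
      ext v
      rw [G.draw_adj_apply hu, PMF.bind_apply, tsum_fintype]
      have hadj : G.adj u v = ∑ i : Fin (G.row u G.m).length,
          if ((G.row u G.m)[i]).1 = v then
            ((G.row u G.m).map fun p => G.w p.2).getD i 0 else 0 := by
        rw [adj, ← sum_row_eq, ← Fin.sum_univ_fun_getElem]
        refine Finset.sum_congr rfl fun i _ => ?_
        rw [List.getD_eq_getElem _ _ (by simp), List.getElem_map]
        rfl
      rw [hadj, ENNReal.ofReal_sum_of_nonneg fun i _ => by split_ifs; exacts [hpos i, le_rfl],
        Finset.sum_mul]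
      refine Finset.sum_congr rfl fun i _ => ?_
      rw [draw_apply _ hpos (by rw [htot']; exact hu), htot', PMF.pure_apply]
      by_cases h : ((G.row u G.m)[i]).1 = v
      · rw [if_pos h, if_pos h.symm, mul_one]
      · rw [if_neg h, if_neg (Ne.symm h), ENNReal.ofReal_zero, zero_mul, mul_zero]
  -- At an isolated vertex both `draw` and `step` fall back to `u`; one number still counts as
  -- consumed, to keep the count fixed.
  · have hadj : G.adj u = fun _ => 0 := funext fun v =>
      le_antisymm ((G.adj_le_deg u v).trans hu.ge) (G.adj_nonneg u v)
    have hrow : G.row u G.m = [] := by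
      by_contra h
      have hlen := List.length_pos_of_ne_nil h
      have h1 := G.rowPrefix_length u
      rw [rowPrefix_eq, ← hu] at h1
      exact (Finset.sum_pos (fun i hi => G.getD_map_row_pos u (Finset.mem_range.1 hi))
        ⟨0, Finset.mem_range.2 hlen⟩).ne' h1
    have hd : draw u (G.adj u) = PMF.pure u := by
      rw [hadj, draw, dif_neg (by simp)]
    have hst : G.step u = fun _ => u := by
      funext ω
      simp [step, hrow]
    rw [hd, hst]
    exact ⟨fun _ _ _ => rfl, (samples_pure u).finite, (samples_pure u).meas, (samples_pure u).law⟩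

theorem step_adj {u : Fin G.n} (hu : 0 < G.deg u) (ω : ℕ → unitInterval) :
    (G.fst ((G.row u G.m)[G.stepIndex u ω]'(G.stepIndex_lt hu ω)).2 = u ∧
      G.snd ((G.row u G.m)[G.stepIndex u ω]'(G.stepIndex_lt hu ω)).2 = G.step u ω) ∨
    (G.fst ((G.row u G.m)[G.stepIndex u ω]'(G.stepIndex_lt hu ω)).2 = G.step u ω ∧
      G.snd ((G.row u G.m)[G.stepIndex u ω]'(G.stepIndex_lt hu ω)).2 = u) := by
  rw [G.step_eq hu]
  exact G.mem_row (List.getElem_mem _)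

theorem deg_step_pos {u : Fin G.n} (hu : 0 < G.deg u) (ω : ℕ → unitInterval) :
    0 < G.deg (G.step u ω) := by
  rcases G.step_adj hu ω with ⟨-, h⟩ | ⟨h, -⟩
  · rw [← h]
    exact G.deg_pos_snd _
  · rw [← h]
    exact G.deg_pos_fst _

theorem onPairs_step (x : Fin G.m → ℝ) {u : Fin G.n} (hu : 0 < G.deg u)
    (ω : ℕ → unitInterval) : G.onPairs x u (G.step u ω) =
      x ((G.row u G.m)[G.stepIndex u ω]'(G.stepIndex_lt hu ω)).2 := by
  rcases G.step_adj hu ω with ⟨h1, h2⟩ | ⟨h1, h2⟩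
  · have := G.onPairs_fst_snd x ((G.row u G.m)[G.stepIndex u ω]'(G.stepIndex_lt hu ω)).2
    rwa [h1, h2] at this
  · have := G.onPairs_snd_fst x ((G.row u G.m)[G.stepIndex u ω]'(G.stepIndex_lt hu ω)).2
    rwa [h1, h2] at this

/-- The vertices visited in `j` steps of the random walk, computed from `j` random numbers. -/
def walk : ℕ → Fin G.n → (ℕ → unitInterval) → List (Fin G.n)
  | 0, _, _ => []
  | j + 1, u, ω => G.step u ω :: walk j (G.step u ω) (shift 1 ω)

theorem samples_walk (j : ℕ) (u : Fin G.n) : Samples j (G.walk j u) (G.randomWalk j u) := by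
  induction j generalizing u with
  | zero => exact samples_pure []
  | succ j ih =>
    have := (G.samples_step u).bind fun v => (ih v).map fun l => v :: l
    rw [add_comm] at this
    exact this

/-- The prefix sums of the sampling weights of the edges. -/
def edgePrefix (r : Fin G.m → ℝ) (j : ℕ) : ℝ :=
  ∑ i ∈ Finset.range j, if h : i < G.m then G.w ⟨i, h⟩ * r ⟨i, h⟩ else 0

theorem edgePrefix_m (r : Fin G.m → ℝ) : G.edgePrefix r G.m = ∑ e, G.w e * r e := by
  rw [edgePrefix, Finset.sum_range]
  exact Finset.sum_congr rfl fun e _ => by rw [dif_pos e.2]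

theorem edgePrefix_succ (r : Fin G.m → ℝ) {j : ℕ} (hj : j < G.m) :
    G.edgePrefix r (j + 1) = G.edgePrefix r j + G.w ⟨j, hj⟩ * r ⟨j, hj⟩ := by
  rw [edgePrefix, Finset.sum_range_succ, dif_pos hj, edgePrefix]

theorem edgePrefix_mono {r : Fin G.m → ℝ} (hr : ∀ e, 0 < r e) (i j : ℕ) (hij : i ≤ j) :
    G.edgePrefix r i ≤ G.edgePrefix r j :=
  Finset.sum_le_sum_of_subset_of_nonneg (Finset.range_mono hij) fun l _ _ => by
    split_ifs
    exacts [(mul_pos (G.w_pos _) (hr _)).le, le_rfl]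

/-- The number of the sampled edge. -/
def edgeIndex (r : Fin G.m → ℝ) (ω : ℕ → unitInterval) : ℕ :=
  pick G.m (G.edgePrefix r) (ω 0 * ∑ e, G.w e * r e)

/-- The sampled position of the edge in the walk. -/
def positionIndex (k : ℕ) (ω : ℕ → unitInterval) : ℕ := pick k (fun j => j) (ω 0 * k)

theorem samples_edgeIndex (hm : 0 < G.m) {r : Fin G.m → ℝ} (hr : ∀ e, 0 < r e) :
    Samples 1 (fun ω => (⟨G.edgeIndex r ω, pick_lt hm _ _⟩ : Fin G.m))
      (draw (⟨0, hm⟩ : Fin G.m) fun e => G.w e * r e) := by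
  have := samples_pick hm (y := fun i => if h : i < G.m then G.w ⟨i, h⟩ * r ⟨i, h⟩ else 0)
    (fun i hi => by rw [dif_pos hi]; exact mul_pos (G.w_pos _) (hr _)) ⟨0, hm⟩
  have h2 := G.edgePrefix_m r
  rw [edgePrefix] at h2
  rw [h2] at this
  simp only [Fin.is_lt, dite_true, Fin.eta] at this
  exact this

theorem samples_positionIndex {k : ℕ} [NeZero k] :
    Samples 1 (fun ω => (⟨positionIndex k ω, pick_lt (Nat.pos_of_ne_zero (NeZero.ne k)) _ _⟩ :
      Fin k)) (PMF.uniformOfFintype (Fin k)) := by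
  have hk := Nat.pos_of_ne_zero (NeZero.ne k)
  have := samples_pick hk (y := fun _ => 1) (fun i hi => one_pos) ⟨0, hk⟩
  simp only [Finset.sum_const, Finset.card_range, nsmul_eq_mul, mul_one] at this
  rw [draw_one] at this
  exact this

/-- The sample for edge `e` at position `i`, computed from the random numbers for the walks. -/
def walkSample (k : ℕ) (r : Fin G.m → ℝ) (h : ℝ) (e : Fin G.m) (i : ℕ) (ω : ℕ → unitInterval) :
    Fin G.n × Fin G.n × ℝ :=
  ((G.walk i (G.fst e) ω).getLastD (G.fst e),
    (G.walk (k - 1 - i) (G.snd e) (shift i ω)).getLastD (G.snd e),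
    1 / (h * (r e + pathSum (G.onPairs r) (G.fst e :: G.walk i (G.fst e) ω) +
      pathSum (G.onPairs r) (G.snd e :: G.walk (k - 1 - i) (G.snd e) (shift i ω)))))

/-- One sample, computed from `k + 1` random numbers. -/
def sample (hm : 0 < G.m) (k : ℕ) (r : Fin G.m → ℝ) (h : ℝ) (ω : ℕ → unitInterval) :
    Fin G.n × Fin G.n × ℝ :=
  G.walkSample k r h ⟨G.edgeIndex r ω, pick_lt hm _ _⟩ (positionIndex k (shift 1 ω)) (shift 2 ω)

/-- The right-hand side is the form in which a machine obtains the sample: two walks run outwards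
from the edge, and only their ends and the accumulated estimates are kept. -/
theorem sample_value (r : Fin G.m → ℝ) (h : ℝ) (e : Fin G.m) (left right : List (Fin G.n)) :
    ((left.reverse ++ G.fst e :: G.snd e :: right).headD (G.fst e),
      (left.reverse ++ G.fst e :: G.snd e :: right).getLastD (G.snd e),
      1 / (h * pathSum (G.onPairs r) (left.reverse ++ G.fst e :: G.snd e :: right))) =
    (left.getLastD (G.fst e), right.getLastD (G.snd e),
      1 / (h * (r e + pathSum (G.onPairs r) (G.fst e :: left) +
        pathSum (G.onPairs r) (G.snd e :: right)))) := by
  refine Prod.ext ?_ (Prod.ext ?_ ?_)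
  · rcases List.eq_nil_or_concat left with rfl | ⟨l, a, rfl⟩ <;> simp
  · rcases List.eq_nil_or_concat right with rfl | ⟨l, a, rfl⟩
    · simp
    · have : left.reverse ++ G.fst e :: G.snd e :: l.concat a =
          (left.reverse ++ G.fst e :: G.snd e :: l) ++ [a] := by simp
      simp only [this, List.getLastD_concat]
      rw [List.concat_eq_append, List.getLastD_concat]
  · have h1 := pathSum_append_cons (ρ := G.onPairs r) left.reverse (G.fst e) (G.snd e :: right)
    have h2 := pathSum_reverse (ρ := G.onPairs r) (G.onPairs_symm r) (G.fst e :: left)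
    rw [List.reverse_cons] at h2
    have h3 : pathSum (G.onPairs r) (G.fst e :: G.snd e :: right) =
      G.onPairs r (G.fst e) (G.snd e) + pathSum (G.onPairs r) (G.snd e :: right) := rfl
    simp only
    rw [h1, h2, h3, G.onPairs_fst_snd]
    congr 2
    ring

/-- One number for the edge, one for the position, and `k - 1` for the two walks together, whatever
the position. -/
theorem samples_sample (hm : 0 < G.m) {k : ℕ} [NeZero k] {r : Fin G.m → ℝ} (hr : ∀ e, 0 < r e)
    (h : ℝ) : Samples (k + 1) (G.sample hm k r h) (G.sampleEdge hm k r h) := by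
  have hw : ∀ (e : Fin G.m) (i : Fin k), Samples (k - 1) (G.walkSample k r h e i)
      ((G.randomWalk i (G.fst e)).bind fun left =>
        (G.randomWalk (k - 1 - i) (G.snd e)).bind fun right =>
        let walk := left.reverse ++ G.fst e :: G.snd e :: right
        PMF.pure (walk.headD (G.fst e), walk.getLastD (G.snd e),
          1 / (h * pathSum (G.onPairs r) walk))) := by
    intro e i
    have := (G.samples_walk i (G.fst e)).bind fun left =>
      (G.samples_walk (k - 1 - i) (G.snd e)).map fun right =>
        (left.getLastD (G.fst e), right.getLastD (G.snd e),
          1 / (h * (r e + pathSum (G.onPairs r) (G.fst e :: left) +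
            pathSum (G.onPairs r) (G.snd e :: right))))
    rw [show (i : ℕ) + (k - 1 - i) = k - 1 by omega] at this
    simp only [G.sample_value]
    exact this
  have := (G.samples_edgeIndex hm hr).bind fun e =>
    (samples_positionIndex (k := k)).bind fun i => hw e i
  have hk := Nat.pos_of_ne_zero (NeZero.ne k)
  rw [show 1 + (1 + (k - 1)) = k + 1 by omega] at this
  simp only [shift_shift] at this
  exact this

end Graph

/-! ### Determinism, frame rule and timed triples for programs -/

section Execution

variable {ans : (G : Graph) → Fin G.m → ℝ} {ω : ℕ → unitInterval}

/-- The memory determines the graph handed to the estimator; this is the one point of `Exec` where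
determinism is not immediate. -/
theorem State.Stores.unique {s : State} {N M a b w : ℕ} {G G' : Graph}
    (h : s.Stores N M a b w G) (h' : s.Stores N M a b w G') : G = G' := by
  obtain ⟨n, m, f, g, x, _, _, _⟩ := G
  obtain ⟨n', m', f', g', x', _, _, _⟩ := G'
  obtain ⟨h1, h2, h3⟩ := h
  obtain ⟨h1', h2', h3'⟩ := h'
  dsimp only at h1 h2 h3 h1' h2' h3'
  obtain rfl : n = n' := h1.symm.trans h1'
  obtain rfl : m = m' := h2.symm.trans h2'
  obtain rfl : f = f' := funext fun e => Fin.ext ((h3 e).1.symm.trans (h3' e).1)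
  obtain rfl : g = g' := funext fun e => Fin.ext ((h3 e).2.1.symm.trans (h3' e).2.1)
  obtain rfl : x = x' := funext fun e => (h3 e).2.2.symm.trans (h3' e).2.2
  rfl

/-- The final state of a program is determined by the initial state and the random numbers. -/
theorem Exec.unique {p : Program} {s s₁ s₂ : State} {t₁ t₂ : ℕ} {Q₁ Q₂ : List Graph}
    (h₁ : Exec ans ω p s t₁ Q₁ s₁) (h₂ : Exec ans ω p s t₂ Q₂ s₂) : s₁ = s₂ := by
  induction h₁ generalizing t₂ Q₂ s₂ with
  | skip | setNat | setReal | storeNat | storeReal | rand => cases h₂; rfl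
  | call N M a b w r s G hG =>
    cases h₂ with
    | call _ _ _ _ _ _ _ G' hG' => rw [hG.unique hG']
  | seq _ _ ih ih' =>
    cases h₂ with
    | seq h h' =>
      obtain rfl := ih h
      exact ih' h'
  | ite_true hb _ ih =>
    cases h₂ with
    | ite_true _ h => exact ih h
    | ite_false hb' _ => exact absurd hb hb'
  | ite_false hb _ ih =>
    cases h₂ with
    | ite_true hb' _ => exact absurd hb' hb
    | ite_false _ h => exact ih h
  | loop_true hb _ _ ih ih' =>
    cases h₂ with
    | loop_true _ h h' =>
      obtain rfl := ih h
      exact ih' h'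
    | loop_false hb' => exact absurd hb hb'
  | loop_false hb =>
    cases h₂ with
    | loop_true hb' _ _ => exact absurd hb' hb
    | loop_false _ => rfl

theorem State.Outputs.unique {s : State} {n : ℕ} {H H' : List (Fin n × Fin n × ℝ)}
    (h : s.Outputs H) (h' : s.Outputs H') : H = H' := by
  have hl : H.length = H'.length := h.1.symm.trans h'.1
  refine List.ext_getElem hl fun i hi hi' => ?_
  obtain ⟨h1, h2, h3⟩ := h.2 ⟨i, hi⟩
  obtain ⟨h1', h2', h4⟩ := h'.2 ⟨i, hi'⟩
  exact Prod.ext (Fin.ext (h1.symm.trans h1')) (Prod.ext (Fin.ext (h2.symm.trans h2'))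
    (h3.symm.trans h4))

/-- The parts of a state that a command may change. -/
inductive Cell
  | natReg (x : ℕ)
  | realReg (x : ℕ)
  | natArr (a : ℕ)
  | realArr (a : ℕ)
  | pos
  deriving DecidableEq

/-- The parts of the state that a program may change. -/
def Program.writes : Program → List Cell
  | skip => []
  | setNat x _ => [.natReg x]
  | setReal x _ => [.realReg x]
  | storeNat a _ _ => [.natArr a]
  | storeReal a _ _ => [.realArr a]
  | rand x => [.realReg x, .pos]
  | call _ _ _ _ _ r => [.realArr r]
  | seq p q => p.writes ++ q.writes
  | ite _ p q => p.writes ++ q.writes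
  | loop _ p => p.writes

/-- Two states agree, except possibly in the listed parts. -/
structure Agree (W : List Cell) (s s' : State) : Prop where
  natReg : ∀ x, .natReg x ∉ W → s'.natReg x = s.natReg x
  realReg : ∀ x, .realReg x ∉ W → s'.realReg x = s.realReg x
  natArr : ∀ a, .natArr a ∉ W → s'.natArr a = s.natArr a
  realArr : ∀ a, .realArr a ∉ W → s'.realArr a = s.realArr a
  pos : .pos ∉ W → s'.pos = s.pos

theorem Agree.refl (W : List Cell) (s : State) : Agree W s s :=
  ⟨fun _ _ => rfl, fun _ _ => rfl, fun _ _ => rfl, fun _ _ => rfl, fun _ => rfl⟩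

theorem Agree.trans {W : List Cell} {s s' s'' : State} (h : Agree W s s') (h' : Agree W s' s'') :
    Agree W s s'' :=
  ⟨fun x hx => (h'.natReg x hx).trans (h.natReg x hx),
    fun x hx => (h'.realReg x hx).trans (h.realReg x hx),
    fun x hx => (h'.natArr x hx).trans (h.natArr x hx),
    fun x hx => (h'.realArr x hx).trans (h.realArr x hx), fun hx => (h'.pos hx).trans (h.pos hx)⟩

theorem Agree.mono {W W' : List Cell} {s s' : State} (h : Agree W s s') (hW : W ⊆ W') :
    Agree W' s s' :=
  ⟨fun x hx => h.natReg x fun h => hx (hW h), fun x hx => h.realReg x fun h => hx (hW h),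
    fun x hx => h.natArr x fun h => hx (hW h), fun x hx => h.realArr x fun h => hx (hW h),
    fun hx => h.pos fun h => hx (hW h)⟩

/-- The frame rule: for a concrete program, membership in `writes` is decidable, so preserved data
carry over by `decide`. -/
theorem Exec.agree {p : Program} {s s' : State} {t : ℕ} {Q : List Graph}
    (h : Exec ans ω p s t Q s') : Agree p.writes s s' := by
  induction h with
  | skip s => exact Agree.refl _ s
  | setNat | setReal | storeNat | storeReal | rand | call =>
    constructor <;> intros <;> simp_all [Program.writes]
  | seq _ _ ih ih' =>
    exact (ih.mono (List.subset_append_left _ _)).trans (ih'.mono (List.subset_append_right _ _))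
  | ite_true _ _ ih => exact ih.mono (List.subset_append_left _ _)
  | ite_false _ _ ih => exact ih.mono (List.subset_append_right _ _)
  | loop_true _ _ _ ih ih' => exact ih.trans ih'
  | loop_false _ => exact Agree.refl _ _

/-- Started in `s`, the program `p` halts within `t` steps, calls the estimator on the graphs `Q`,
and reaches a state with the property `Post`. -/
def Runs (ans : (G : Graph) → Fin G.m → ℝ) (ω : ℕ → unitInterval) (p : Program) (s : State)
    (t : ℕ) (Q : List Graph) (Post : State → Prop) : Prop :=
  ∃ t' ≤ t, ∃ s', Exec ans ω p s t' Q s' ∧ Post s'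

variable {p q : Program} {s : State} {t t' : ℕ} {Q Q' : List Graph} {Post Mid : State → Prop}

theorem Runs.of_le (h : Runs ans ω p s t Q Post) (ht : t ≤ t') : Runs ans ω p s t' Q Post := by
  obtain ⟨t₁, h1, s', h2⟩ := h
  exact ⟨t₁, h1.trans ht, s', h2⟩

theorem Runs.imp (h : Runs ans ω p s t Q Mid) (hP : ∀ s', Mid s' → Agree p.writes s s' → Post s') :
    Runs ans ω p s t Q Post := by
  obtain ⟨t₁, h1, s', h2, h3⟩ := h
  exact ⟨t₁, h1, s', h2, hP s' h3 h2.agree⟩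

theorem Runs.seq (h : Runs ans ω p s t Q Mid)
    (h' : ∀ s', Mid s' → Agree p.writes s s' → Runs ans ω q s' t' Q' Post) :
    Runs ans ω (.seq p q) s (t + t') (Q ++ Q') Post := by
  obtain ⟨t₁, h1, s', h2, h3⟩ := h
  obtain ⟨t₂, ht₂, s₂, he₂, hP⟩ := h' s' h3 h2.agree
  exact ⟨t₁ + t₂, add_le_add h1 ht₂, s₂, h2.seq he₂, hP⟩

/-- Assignment to an integer register. -/
def State.putNat (s : State) (x v : ℕ) : State :=
  { s with natReg := Function.update s.natReg x v }

/-- Assignment to a real register. -/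
def State.putReal (s : State) (x : ℕ) (v : ℝ) : State :=
  { s with realReg := Function.update s.realReg x v }

/-- Assignment to an entry of an integer array. -/
def State.putNatArr (s : State) (a i v : ℕ) : State :=
  { s with natArr := Function.update s.natArr a (Function.update (s.natArr a) i v) }

/-- Assignment to an entry of a real array. -/
def State.putRealArr (s : State) (a i : ℕ) (v : ℝ) : State :=
  { s with realArr := Function.update s.realArr a (Function.update (s.realArr a) i v) }

/-- Consumption of one random number. -/
def State.advance (s : State) : State := { s with pos := s.pos + 1 }

section Projections

variable (s : State) (x a i n : ℕ) (v : ℝ)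

@[simp] theorem State.putNat_natReg :
    (s.putNat x n).natReg = Function.update s.natReg x n := rfl

@[simp] theorem State.putNat_realReg :
    (s.putNat x n).realReg = s.realReg := rfl

@[simp] theorem State.putNat_natArr :
    (s.putNat x n).natArr = s.natArr := rfl

@[simp] theorem State.putNat_realArr :
    (s.putNat x n).realArr = s.realArr := rfl

@[simp] theorem State.putNat_pos :
    (s.putNat x n).pos = s.pos := rfl

@[simp] theorem State.putReal_natReg :
    (s.putReal x v).natReg = s.natReg := rfl

@[simp] theorem State.putReal_realReg :
    (s.putReal x v).realReg = Function.update s.realReg x v := rfl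

@[simp] theorem State.putReal_natArr :
    (s.putReal x v).natArr = s.natArr := rfl

@[simp] theorem State.putReal_realArr :
    (s.putReal x v).realArr = s.realArr := rfl

@[simp] theorem State.putReal_pos :
    (s.putReal x v).pos = s.pos := rfl

@[simp] theorem State.putNatArr_natReg :
    (s.putNatArr a i n).natReg = s.natReg := rfl

@[simp] theorem State.putNatArr_realReg :
    (s.putNatArr a i n).realReg = s.realReg := rfl

@[simp] theorem State.putNatArr_natArr :
    (s.putNatArr a i n).natArr = Function.update s.natArr a (Function.update (s.natArr a) i n) := rfl

@[simp] theorem State.putNatArr_realArr :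
    (s.putNatArr a i n).realArr = s.realArr := rfl

@[simp] theorem State.putNatArr_pos :
    (s.putNatArr a i n).pos = s.pos := rfl

@[simp] theorem State.putRealArr_natReg :
    (s.putRealArr a i v).natReg = s.natReg := rfl

@[simp] theorem State.putRealArr_realReg :
    (s.putRealArr a i v).realReg = s.realReg := rfl

@[simp] theorem State.putRealArr_natArr :
    (s.putRealArr a i v).natArr = s.natArr := rfl

@[simp] theorem State.putRealArr_realArr :
    (s.putRealArr a i v).realArr = Function.update s.realArr a (Function.update (s.realArr a) i v) := rfl

@[simp] theorem State.putRealArr_pos :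
    (s.putRealArr a i v).pos = s.pos := rfl

@[simp] theorem State.advance_natReg :
    (s.advance).natReg = s.natReg := rfl

@[simp] theorem State.advance_realReg :
    (s.advance).realReg = s.realReg := rfl

@[simp] theorem State.advance_natArr :
    (s.advance).natArr = s.natArr := rfl

@[simp] theorem State.advance_realArr :
    (s.advance).realArr = s.realArr := rfl

@[simp] theorem State.advance_pos :
    (s.advance).pos = s.pos + 1 := rfl

end Projections

theorem Runs.setNat {x : ℕ} {i : NatExp} (h : Post (s.putNat x (i.eval s))) :
    Runs ans ω (.setNat x i) s 1 [] Post :=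
  ⟨1, le_rfl, _, .setNat x i s, h⟩

theorem Runs.setReal {x : ℕ} {y : RealExp} (h : Post (s.putReal x (y.eval s))) :
    Runs ans ω (.setReal x y) s 1 [] Post :=
  ⟨1, le_rfl, _, .setReal x y s, h⟩

theorem Runs.storeNat {a : ℕ} {i j : NatExp} (h : Post (s.putNatArr a (i.eval s) (j.eval s))) :
    Runs ans ω (.storeNat a i j) s 1 [] Post :=
  ⟨1, le_rfl, _, .storeNat a i j s, h⟩

theorem Runs.call {N M a b w r : ℕ} {G : Graph} (hG : s.Stores N M a b w G)
    (h : Post { s with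
      realArr := Function.update s.realArr r
        (fun i => if h : i < G.m then ans G ⟨i, h⟩ else s.realArr r i) }) :
    Runs ans ω (.call N M a b w r) s 1 [G] Post :=
  ⟨1, le_rfl, _, .call N M a b w r s G hG, h⟩

theorem Runs.setNat_seq {x : ℕ} {i : NatExp}
    (h : Runs ans ω q (s.putNat x (i.eval s)) t Q Post) :
    Runs ans ω (.seq (.setNat x i) q) s (1 + t) Q Post := by
  obtain ⟨t₁, h1, s', h2, h3⟩ := h
  exact ⟨1 + t₁, by omega, s', (Exec.setNat x i s).seq h2, h3⟩

theorem Runs.setReal_seq {x : ℕ} {y : RealExp}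
    (h : Runs ans ω q (s.putReal x (y.eval s)) t Q Post) :
    Runs ans ω (.seq (.setReal x y) q) s (1 + t) Q Post := by
  obtain ⟨t₁, h1, s', h2, h3⟩ := h
  exact ⟨1 + t₁, by omega, s', (Exec.setReal x y s).seq h2, h3⟩

theorem Runs.storeNat_seq {a : ℕ} {i j : NatExp}
    (h : Runs ans ω q (s.putNatArr a (i.eval s) (j.eval s)) t Q Post) :
    Runs ans ω (.seq (.storeNat a i j) q) s (1 + t) Q Post := by
  obtain ⟨t₁, h1, s', h2, h3⟩ := h
  exact ⟨1 + t₁, by omega, s', (Exec.storeNat a i j s).seq h2, h3⟩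

theorem Runs.storeReal_seq {a : ℕ} {i : NatExp} {y : RealExp}
    (h : Runs ans ω q (s.putRealArr a (i.eval s) (y.eval s)) t Q Post) :
    Runs ans ω (.seq (.storeReal a i y) q) s (1 + t) Q Post := by
  obtain ⟨t₁, h1, s', h2, h3⟩ := h
  exact ⟨1 + t₁, by omega, s', (Exec.storeReal a i y s).seq h2, h3⟩

theorem Runs.rand_seq {x : ℕ}
    (h : Runs ans ω q ((s.putReal x (ω s.pos)).advance) t Q Post) :
    Runs ans ω (.seq (.rand x) q) s (1 + t) Q Post := by
  obtain ⟨t₁, h1, s', h2, h3⟩ := h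
  exact ⟨1 + t₁, by omega, s', (Exec.rand x s).seq h2, h3⟩

theorem Runs.ite {b : Test} (h : b.Holds s → Runs ans ω p s t Q Post)
    (h' : ¬ b.Holds s → Runs ans ω q s t Q Post) : Runs ans ω (.ite b p q) s (1 + t) Q Post := by
  by_cases hb : b.Holds s
  · obtain ⟨t₁, h1, s', h2, h3⟩ := h hb
    exact ⟨1 + t₁, by omega, s', .ite_true hb h2, h3⟩
  · obtain ⟨t₁, h1, s', h2, h3⟩ := h' hb
    exact ⟨1 + t₁, by omega, s', .ite_false hb h2, h3⟩

/-- A loop that halts after at most `j` rounds, because each round leads from the invariant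
`I (j + 1)` to `I j`. -/
theorem Runs.loop {b : Test} (I : ℕ → State → Prop) (j : ℕ)
    (hI : ∀ j s', Agree p.writes s s' → I j s' → (¬ b.Holds s' ∧ Post s') ∨
      (b.Holds s' ∧ ∃ j', j = j' + 1 ∧ Runs ans ω p s' t [] (I j'))) (h : I j s) :
    Runs ans ω (.loop b p) s (j * (t + 1) + 1) [] Post := by
  have key : ∀ j s', Agree p.writes s s' → I j s' →
      Runs ans ω (.loop b p) s' (j * (t + 1) + 1) [] Post := by
    intro j
    induction j with
    | zero =>
      intro s' ha hs
      rcases hI 0 s' ha hs with ⟨hb, hP⟩ | ⟨-, j', hj', -⟩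
      · exact ⟨1, by omega, s', .loop_false hb, hP⟩
      · omega
    | succ j ih =>
      intro s' ha hs
      rcases hI (j + 1) s' ha hs with ⟨hb, hP⟩ | ⟨hb, j', hj', t₁, ht₁, s₁, he, hs₁⟩
      · exact ⟨1, by omega, s', .loop_false hb, hP⟩
      · obtain rfl : j = j' := by omega
        obtain ⟨t₂, ht₂, s₂, he₂, hP⟩ := ih s₁ (ha.trans he.agree) hs₁
        refine ⟨1 + t₁ + t₂, ?_, s₂, .loop_true hb he he₂, hP⟩
        have : (j + 1) * (t + 1) = j * (t + 1) + (t + 1) := by ring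
        omega
  exact key j s (Agree.refl _ _) h

end Execution

/-! ### The program

Integer registers: `0` number of vertices, then of output edges; `1` number of edges; `2` length `k`
of the walks; `3` loop counter; `4`, `5` size of the double cover; `6` offset of a row; `7`, `8` computation
of `⌈log₂ n⌉`; `9` number of samples; `10` samples drawn so far; `11`, `12`, `13`, `21` binary search;
`14`, `15` sampled edge and its position; `16` remaining steps; `17` current vertex; `18` end of the
first half of the walk.

Real registers: `0` error `ε`; `1` total sampling weight; `2` lower bound for the number of samples;
`3` overhead `h`; `4` random number; `5` sum of the estimates along the walk.

Integer arrays: `0`, `1` endpoints of the edges, then of the output edges; `2`, `3` endpoints in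
the double cover; `4`, `5` offset and length of the row of a vertex; `6` neighbours, row by row;
`7`, `8` endpoints of the edges.

Real arrays: `0` weights of the edges, then of the output edges; `1` weights in the double cover; `2`
estimates; `3` prefix sums of the sampling weights; `4`, `5` estimates and prefix sums of the weights,
row by row; `6` degrees. -/

namespace Program

/-- Binary search for the position of real register `4` in the stretch of real array `a` that
starts at integer register `21`. -/
def search (a : ℕ) : Program :=
  .loop (.natLt (.add (.reg 11) (.const 1)) (.reg 12)) <|
    .seq (.setNat 13 (.half (.add (.reg 11) (.reg 12)))) <|
    .ite (.realLt (.reg 4) (.arr a (.add (.reg 21) (.reg 13))))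
      (.setNat 12 (.reg 13)) (.setNat 11 (.reg 13))

/-- One step of the random walk. -/
def walkStep : Program :=
  .seq (.rand 4) <|
  .seq (.setReal 4 (.mul (.reg 4) (.arr 6 (.reg 17)))) <|
  .seq (.setNat 21 (.arr 4 (.reg 17))) <|
  .seq (.setNat 11 (.const 0)) <|
  .seq (.setNat 12 (.arr 5 (.reg 17))) <|
  .seq (search 5) <|
  .seq (.setReal 5 (.add (.reg 5) (.arr 4 (.add (.reg 21) (.reg 11))))) <|
  .seq (.setNat 17 (.arr 6 (.add (.reg 21) (.reg 11)))) <|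
  .setNat 16 (.sub (.reg 16) (.const 1))

/-- The random walk with the number of steps in integer register `16`. -/
def randomWalk : Program := .loop (.natLt (.const 0) (.reg 16)) walkStep

/-- Draw the edge of a sample. -/
def drawEdge : Program :=
  .seq (.rand 4) <|
  .seq (.setReal 4 (.mul (.reg 4) (.reg 1))) <|
  .seq (.setNat 21 (.const 0)) <|
  .seq (.setNat 11 (.const 0)) <|
  .seq (.setNat 12 (.reg 1)) <|
  .seq (search 3) <|
  .setNat 14 (.reg 11)

/-- Draw the position of the edge in the walk. -/
def drawPosition : Program :=
  .seq (.rand 4) <|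
  .seq (.setReal 4 (.mul (.reg 4) (.ofNat (.reg 2)))) <|
  .seq (.setNat 15 (.const 0)) <|
  .loop (.and (.natLt (.add (.reg 15) (.const 1)) (.reg 2))
      (.not (.realLt (.reg 4) (.ofNat (.add (.reg 15) (.const 1)))))) <|
    .setNat 15 (.add (.reg 15) (.const 1))

/-- Complete the edge to a walk. -/
def drawWalks : Program :=
  .seq (.setReal 5 (.arr 2 (.reg 14))) <|
  .seq (.setNat 17 (.arr 7 (.reg 14))) <|
  .seq (.setNat 16 (.reg 15)) <|
  .seq randomWalk <|
  .seq (.setNat 18 (.reg 17)) <|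
  .seq (.setNat 17 (.arr 8 (.reg 14))) <|
  .seq (.setNat 16 (.sub (.sub (.reg 2) (.const 1)) (.reg 15))) <|
  randomWalk

/-- Append the sampled edge to the output. -/
def emit : Program :=
  .seq (.storeNat 0 (.reg 10) (.reg 18)) <|
  .seq (.storeNat 1 (.reg 10) (.reg 17)) <|
  .seq (.storeReal 0 (.reg 10) (.div (.ofNat (.const 1)) (.mul (.reg 3) (.reg 5)))) <|
  .setNat 10 (.add (.reg 10) (.const 1))

/-- One sample. -/
def drawSample : Program := .seq drawEdge <| .seq drawPosition <| .seq drawWalks emit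

/-- The sampling phase. -/
def drawSamples : Program :=
  .seq (.setNat 10 (.const 0)) <|
  .seq (.loop (.natLt (.reg 10) (.reg 9)) drawSample) <|
  .setNat 0 (.reg 9)

end Program

/-! ### Correctness and cost of one sample -/

section Sampling

variable {ans : (G : Graph) → Fin G.m → ℝ} {ω : ℕ → unitInterval}

/-- Bisection with the invariant `pre lo ≤ x < pre hi`, where the upper bound is claimed only for
`hi < len`, and a gap of at most `2^j`. A gap of one identifies `lo` as the picked index. -/
theorem runs_search {a len d : ℕ} (hlen : 0 < len) {pre : ℕ → ℝ}
    (hmono : ∀ i j, i ≤ j → j < len → pre i ≤ pre j) {x : ℝ} (hx : pre 0 ≤ x) (hd : len ≤ 2 ^ d)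
    {s : State} (hpre : ∀ j < len, s.realArr a (s.natReg 21 + j) = pre j)
    (h4 : s.realReg 4 = x) (h11 : s.natReg 11 = 0) (h12 : s.natReg 12 = len) :
    Runs ans ω (.search a) s (d * 4 + 1) [] fun s' => s'.natReg 11 = pick len pre x := by
  refine Runs.loop (t := 3) (fun j s' => s'.natReg 11 < s'.natReg 12 ∧ s'.natReg 12 ≤ len ∧
    s'.natReg 12 ≤ s'.natReg 11 + 2 ^ j ∧ pre (s'.natReg 11) ≤ x ∧
    (s'.natReg 12 < len → x < pre (s'.natReg 12))) d ?_ ?_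
  · rintro j s' ha ⟨h1, h2, h3, h5, h6⟩
    have e4 : s'.realReg 4 = x := (ha.realReg 4 (by simp [Program.writes])).trans h4
    have e21 : s'.natReg 21 = s.natReg 21 := ha.natReg 21 (by simp [Program.writes])
    have ea : s'.realArr a = s.realArr a := ha.realArr a (by simp [Program.writes])
    by_cases hb : s'.natReg 11 + 1 < s'.natReg 12
    · right
      refine ⟨hb, ?_⟩
      obtain _ | j := j
      · simp only [pow_zero] at h3
        omega
      refine ⟨j, rfl, ?_⟩
      rw [pow_succ] at h3
      have hmid : (s'.natReg 11 + s'.natReg 12) / 2 < len := by omega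
      refine Runs.setNat_seq (Runs.ite (fun hlt => Runs.setNat ?_) (fun hlt => Runs.setNat ?_))
      · simp [Test.Holds, RealExp.eval, NatExp.eval, e4, e21, ea, hpre _ hmid] at hlt
        simp [NatExp.eval]
        exact ⟨by omega, by omega, by omega, h5, fun _ => hlt⟩
      · simp [Test.Holds, RealExp.eval, NatExp.eval, e4, e21, ea, hpre _ hmid] at hlt
        simp [NatExp.eval]
        exact ⟨by omega, by omega, by omega, hlt, h6⟩
    · left
      refine ⟨hb, ?_⟩
      symm
      rw [pick_eq_iff hlen hmono hx]
      have : s'.natReg 12 = s'.natReg 11 + 1 := by omega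
      rw [this] at h2 h6
      exact ⟨by omega, h5, h6⟩
  · rw [h11, h12]
    exact ⟨hlen, le_rfl, by omega, hx, fun h => absurd h (lt_irrefl _)⟩

namespace Graph

/-- The tables that the sampling phase uses. -/
structure Tables (G : Graph) (k : ℕ) (r : Fin G.m → ℝ) (h : ℝ) (s : State) : Prop where
  edges : s.natReg 1 = G.m
  length : s.natReg 2 = k
  total : s.realReg 1 = ∑ e, G.w e * r e
  overhead : s.realReg 3 = h
  fst : ∀ e : Fin G.m, s.natArr 7 e = G.fst e
  snd : ∀ e : Fin G.m, s.natArr 8 e = G.snd e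
  estimate : ∀ e : Fin G.m, s.realArr 2 e = r e
  edgePrefix : ∀ e : Fin G.m, s.realArr 3 e = G.edgePrefix r e
  rowLength : ∀ u : Fin G.n, s.natArr 5 u = (G.row u G.m).length
  degree : ∀ u : Fin G.n, s.realArr 6 u = G.deg u
  neighbour : ∀ (u : Fin G.n) (j : ℕ) (hj : j < (G.row u G.m).length),
    s.natArr 6 (s.natArr 4 u + j) = ((G.row u G.m)[j]).1
  rowEstimate : ∀ (u : Fin G.n) (j : ℕ) (hj : j < (G.row u G.m).length),
    s.realArr 4 (s.natArr 4 u + j) = r ((G.row u G.m)[j]).2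
  rowPrefix : ∀ (u : Fin G.n), ∀ j < (G.row u G.m).length,
    s.realArr 5 (s.natArr 4 u + j) = G.rowPrefix u j

variable {G : Graph} {k : ℕ} {r : Fin G.m → ℝ} {h : ℝ} {s s' : State}

theorem Tables.of_agree (hs : G.Tables k r h s) {W : List Cell} (ha : Agree W s s')
    (hW : ∀ c ∈ [Cell.natReg 1, .natReg 2, .realReg 1, .realReg 3, .natArr 4, .natArr 5,
      .natArr 6, .natArr 7, .natArr 8, .realArr 2, .realArr 3, .realArr 4, .realArr 5,
      .realArr 6], c ∉ W) : G.Tables k r h s' := by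
  simp only [List.forall_mem_cons, List.not_mem_nil, false_imp_iff, implies_true, and_true] at hW
  obtain ⟨h1, h2, h3, h4, h5, h6, h7, h8, h9, h10, h11, h12, h13, h14⟩ := hW
  constructor
  · rw [ha.natReg _ h1, hs.edges]
  · rw [ha.natReg _ h2, hs.length]
  · rw [ha.realReg _ h3, hs.total]
  · rw [ha.realReg _ h4, hs.overhead]
  · rw [ha.natArr _ h8]; exact hs.fst
  · rw [ha.natArr _ h9]; exact hs.snd
  · rw [ha.realArr _ h10]; exact hs.estimate
  · rw [ha.realArr _ h11]; exact hs.edgePrefix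
  · rw [ha.natArr _ h6]; exact hs.rowLength
  · rw [ha.realArr _ h14]; exact hs.degree
  · rw [ha.natArr _ h5, ha.natArr _ h7]; exact hs.neighbour
  · rw [ha.natArr _ h5, ha.realArr _ h12]; exact hs.rowEstimate
  · rw [ha.natArr _ h5, ha.realArr _ h13]; exact hs.rowPrefix

theorem runs_walkStep {d : ℕ} (hd : G.m ≤ 2 ^ d) (hs : G.Tables k r h s) {u : Fin G.n}
    (hu : 0 < G.deg u) (h17 : s.natReg 17 = u) :
    Runs ans ω .walkStep s (d * 4 + 9) [] fun s' =>
      s'.natReg 17 = G.step u (shift s.pos ω) ∧ s'.natReg 16 = s.natReg 16 - 1 ∧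
      s'.realReg 5 = s.realReg 5 + G.onPairs r u (G.step u (shift s.pos ω)) ∧
      s'.pos = s.pos + 1 := by
  have hlen := List.length_pos_of_ne_nil (G.row_ne_nil hu)
  have hx : G.rowPrefix u 0 ≤ (shift s.pos ω 0 : ℝ) * G.deg u := by
    rw [rowPrefix_zero]
    exact mul_nonneg (shift s.pos ω 0).2.1 hu.le
  refine Runs.of_le (Runs.rand_seq <| Runs.setReal_seq <| Runs.setNat_seq <| Runs.setNat_seq <|
    Runs.setNat_seq <| Runs.seq (runs_search (d := d) hlen (G.rowPrefix_mono u) hx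
      ((G.length_row_le u G.m).trans hd) ?_ ?_ ?_ ?_) fun s₁ h₁ ha =>
    Runs.setReal_seq <| Runs.setNat_seq <| Runs.setNat ?_) (by omega)
  · intro j hj
    simpa [NatExp.eval, h17] using hs.rowPrefix u j hj
  · simp [RealExp.eval, NatExp.eval, h17, hs.degree, shift]
  · simp [NatExp.eval]
  · simpa [NatExp.eval, h17] using hs.rowLength u
  · have hi := G.stepIndex_lt hu (shift s.pos ω)
    change s₁.natReg 11 = G.stepIndex u (shift s.pos ω) at h₁
    have e16 := ha.natReg 16 (by decide)
    have e21 := ha.natReg 21 (by decide)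
    have e5 := ha.realReg 5 (by decide)
    have a4 := ha.realArr 4 (by decide)
    have a6 := ha.natArr 6 (by decide)
    have ep := ha.pos (by decide)
    simp [NatExp.eval, RealExp.eval, h17] at e16 e21 e5 a4 a6 ep
    simp [NatExp.eval, RealExp.eval, e16, e21, e5, a4, a6, ep, h₁, hs.neighbour u _ hi,
      hs.rowEstimate u _ hi, G.step_eq hu]
    rw [← G.onPairs_step r hu, G.step_eq hu]

theorem runs_randomWalk {d : ℕ} (hd : G.m ≤ 2 ^ d) (hs : G.Tables k r h s) {u : Fin G.n}
    (hu : 0 < G.deg u) (h17 : s.natReg 17 = u) {j : ℕ} (h16 : s.natReg 16 = j) :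
    Runs ans ω .randomWalk s (j * (d * 4 + 10) + 1) [] fun s' =>
      s'.natReg 17 = (G.walk j u (shift s.pos ω)).getLastD u ∧
      s'.realReg 5 = s.realReg 5 + pathSum (G.onPairs r) (u :: G.walk j u (shift s.pos ω)) ∧
      s'.pos = s.pos + j := by
  -- The invariant compares the remaining walk with the whole one: the end vertex and the
  -- accumulated plus remaining path sum stay constant, so the visited vertices need not be
  -- recorded.
  refine Runs.loop (fun i s' => ∃ v, 0 < G.deg v ∧ s'.natReg 17 = v ∧ s'.natReg 16 = i ∧
    (G.walk i v (shift s'.pos ω)).getLastD v = (G.walk j u (shift s.pos ω)).getLastD u ∧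
    s'.realReg 5 + pathSum (G.onPairs r) (v :: G.walk i v (shift s'.pos ω)) =
      s.realReg 5 + pathSum (G.onPairs r) (u :: G.walk j u (shift s.pos ω)) ∧
    s'.pos + i = s.pos + j) j ?_ ⟨u, hu, h17, h16, rfl, rfl, rfl⟩
  rintro i s' ha ⟨v, hv, h1, h2, h3, h4, h5⟩
  have hs' := hs.of_agree ha (by decide)
  obtain _ | i := i
  · left
    refine ⟨by simp [Test.Holds, NatExp.eval, h2], ?_, ?_, h5⟩
    · rw [h1, ← h3]
      rfl
    · rw [← h4]
      simp [walk, pathSum]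
  · right
    refine ⟨by simp [Test.Holds, NatExp.eval, h2], i, rfl, ?_⟩
    refine (runs_walkStep hd hs' hv h1).imp ?_
    rintro s₁ ⟨h6, h7, h8, h9⟩ -
    have hw : G.walk (i + 1) v (shift s'.pos ω) = G.step v (shift s'.pos ω) ::
        G.walk i (G.step v (shift s'.pos ω)) (shift (s'.pos + 1) ω) := by
      rw [walk, shift_shift]
    refine ⟨_, G.deg_step_pos hv _, h6, by omega, ?_, ?_, by omega⟩
    · rw [← h3, hw, h9, List.getLastD_cons]
    · rw [← h4, hw, h8, h9, add_assoc]
      rfl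

theorem runs_drawEdge {d : ℕ} (hd : G.m ≤ 2 ^ d) (hs : G.Tables k r h s) (hm : 0 < G.m)
    (hr : ∀ e, 0 < r e) :
    Runs ans ω .drawEdge s (d * 4 + 7) [] fun s' =>
      s'.natReg 14 = G.edgeIndex r (shift s.pos ω) ∧ s'.pos = s.pos + 1 := by
  have hx : G.edgePrefix r 0 ≤ (shift s.pos ω 0 : ℝ) * ∑ e, G.w e * r e := by
    refine mul_nonneg (shift s.pos ω 0).2.1 ?_
    exact Finset.sum_nonneg fun e _ => (mul_pos (G.w_pos e) (hr e)).le
  refine Runs.of_le (Runs.rand_seq <| Runs.setReal_seq <| Runs.setNat_seq <| Runs.setNat_seq <|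
    Runs.setNat_seq <| Runs.seq (runs_search (d := d) hm
      (fun i j hij _ => G.edgePrefix_mono hr i j hij) hx hd ?_ ?_ ?_ ?_) fun s₁ h₁ ha =>
    Runs.setNat ?_) (by omega)
  · intro j hj
    simpa [NatExp.eval] using hs.edgePrefix ⟨j, hj⟩
  · simp [RealExp.eval, hs.total, shift]
  · simp [NatExp.eval]
  · simpa [NatExp.eval] using hs.edges
  · have ep := ha.pos (by decide)
    simp at ep
    simp [NatExp.eval, h₁, ep, edgeIndex]

/-- The prefix sums of a uniform position are the integers themselves, so no table is needed. A
linear search is affordable, since the budget of a sample is at least linear in `k`. -/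
theorem runs_drawPosition (hk : 0 < k) (h2 : s.natReg 2 = k) :
    Runs ans ω .drawPosition s (2 * k + 4) [] fun s' =>
      s'.natReg 15 = positionIndex k (shift s.pos ω) ∧ s'.pos = s.pos + 1 := by
  have hx : ((0 : ℕ) : ℝ) ≤ ω s.pos * k := by
    rw [Nat.cast_zero]
    exact mul_nonneg (ω s.pos).2.1 (Nat.cast_nonneg k)
  refine Runs.of_le (Runs.rand_seq <| Runs.setReal_seq <| Runs.setNat_seq <| Runs.loop (t := 1)
    (fun j s' => s'.natReg 15 + j + 1 = k ∧ (s'.natReg 15 : ℝ) ≤ ω s.pos * k) (k - 1) ?_ ?_)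
    (by omega)
  · rintro j s' ha ⟨h3, h4⟩
    have e2 := ha.natReg 2 (by decide)
    have e4 := ha.realReg 4 (by decide)
    have ep := ha.pos (by decide)
    simp [RealExp.eval, NatExp.eval, h2] at e2 e4 ep
    by_cases hb : s'.natReg 15 + 1 < k ∧ ¬ (ω s.pos * k : ℝ) < s'.natReg 15 + 1
    · right
      refine ⟨by simpa [Test.Holds, RealExp.eval, NatExp.eval, e2, e4] using hb, j - 1, by omega,
        Runs.setNat ?_⟩
      simp [NatExp.eval]
      exact ⟨by omega, not_lt.1 hb.2⟩
    · left
      refine ⟨by simpa [Test.Holds, RealExp.eval, NatExp.eval, e2, e4] using hb, ?_, ep⟩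
      symm
      rw [positionIndex, pick_eq_iff hk (fun i j hij _ => by exact_mod_cast hij)
        (by simpa [shift] using hx)]
      refine ⟨by omega, by simpa [shift] using h4, fun h5 => ?_⟩
      push Not at hb
      simpa [shift] using hb h5
  · simp [NatExp.eval]
    exact ⟨by omega, mul_nonneg (ω s.pos).2.1 (Nat.cast_nonneg k)⟩

theorem runs_drawWalks {d : ℕ} (hd : G.m ≤ 2 ^ d) (hs : G.Tables k r h s) {e : Fin G.m} {i : ℕ}
    (hi : i < k) (h14 : s.natReg 14 = e) (h15 : s.natReg 15 = i) :
    Runs ans ω .drawWalks s (k * (d * 4 + 10) + 8) [] fun s' =>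
      s'.natReg 18 = (G.walkSample k r h e i (shift s.pos ω)).1 ∧
      s'.natReg 17 = (G.walkSample k r h e i (shift s.pos ω)).2.1 ∧
      1 / (h * s'.realReg 5) = (G.walkSample k r h e i (shift s.pos ω)).2.2 ∧
      s'.pos = s.pos + (k - 1) := by
  have hs₁ : ∀ v x y, G.Tables k r h (((s.putReal 5 v).putNat 17 x).putNat 16 y) := fun v x y =>
    ⟨hs.edges, hs.length, hs.total, hs.overhead, hs.fst, hs.snd, hs.estimate, hs.edgePrefix,
      hs.rowLength, hs.degree, hs.neighbour, hs.rowEstimate, hs.rowPrefix⟩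
  have htime : i * (d * 4 + 10) + (k - 1 - i) * (d * 4 + 10) = (k - 1) * (d * 4 + 10) := by
    rw [← Nat.add_mul]
    congr 1
    omega
  have htime' : (k - 1) * (d * 4 + 10) ≤ k * (d * 4 + 10) := Nat.mul_le_mul_right _ (by omega)
  refine Runs.of_le (Runs.setReal_seq <| Runs.setNat_seq <| Runs.setNat_seq <|
    Runs.seq (runs_randomWalk (j := i) hd (hs₁ _ _ _) (G.deg_pos_fst e) ?_ ?_)
    fun s₁ h₁ ha₁ => Runs.setNat_seq <| Runs.setNat_seq <| Runs.setNat_seq <|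
    (runs_randomWalk (j := k - 1 - i) (u := G.snd e) (k := k) (r := r) (h := h) hd ?_
      (G.deg_pos_snd e) ?_ ?_).imp ?_) (by omega)
  · simp [NatExp.eval, h14, hs.fst]
  · simp [NatExp.eval, h15]
  · have hs₂ := (hs₁ _ _ _).of_agree ha₁ (by decide)
    exact ⟨hs₂.edges, hs₂.length, hs₂.total, hs₂.overhead, hs₂.fst, hs₂.snd, hs₂.estimate,
      hs₂.edgePrefix, hs₂.rowLength, hs₂.degree, hs₂.neighbour, hs₂.rowEstimate, hs₂.rowPrefix⟩
  · have hs₂ := (hs₁ _ _ _).of_agree ha₁ (by decide)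
    have e14 := ha₁.natReg 14 (by decide)
    simp [h14] at e14
    simp [NatExp.eval, e14, hs₂.snd]
  · have hs₂ := (hs₁ _ _ _).of_agree ha₁ (by decide)
    have e15 := ha₁.natReg 15 (by decide)
    simp [h15] at e15
    simp [NatExp.eval, e15, hs₂.length]
  · obtain ⟨h6, h7, h8⟩ := h₁
    rintro s₂ ⟨h9, h10, h11⟩ ha₂
    have e18 := ha₂.natReg 18 (by decide)
    simp [NatExp.eval, RealExp.eval, h14, hs.estimate] at e18 h6 h7 h8 h9 h10 h11
    rw [h8] at h9 h10 h11
    have hsh : shift (s.pos + i) ω = shift i (shift s.pos ω) := (shift_shift _ _ _).symm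
    rw [hsh] at h9 h10
    refine ⟨e18.trans (h6.trans ?_), h9.trans ?_, ?_, by omega⟩
    · simp [walkSample]
    · simp [walkSample]
    · rw [h10, h7, walkSample]

theorem runs_drawSample {d : ℕ} (hd : G.m ≤ 2 ^ d) (hs : G.Tables k r h s) (hm : 0 < G.m)
    (hk : 0 < k) (hr : ∀ e, 0 < r e) :
    Runs ans ω .drawSample s (k * (d * 8 + 35)) [] fun s' =>
      s'.natArr 0 = Function.update (s.natArr 0) (s.natReg 10)
        (G.sample hm k r h (shift s.pos ω)).1 ∧
      s'.natArr 1 = Function.update (s.natArr 1) (s.natReg 10)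
        (G.sample hm k r h (shift s.pos ω)).2.1 ∧
      s'.realArr 0 = Function.update (s.realArr 0) (s.natReg 10)
        (G.sample hm k r h (shift s.pos ω)).2.2 ∧
      s'.natReg 10 = s.natReg 10 + 1 ∧ s'.pos = s.pos + (k + 1) := by
  have htime : (d * 4 + 7) + ((2 * k + 4) + ((k * (d * 4 + 10) + 8) + 4)) ≤ k * (d * 8 + 35) := by
    nlinarith [Nat.zero_le d]
  refine Runs.of_le (Runs.seq (runs_drawEdge hd hs hm hr) fun s₁ h₁ ha₁ => ?_) htime
  have hs₁ := hs.of_agree ha₁ (by decide)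
  refine Runs.seq (runs_drawPosition hk hs₁.length) fun s₂ h₂ ha₂ => ?_
  have hs₂ := hs₁.of_agree ha₂ (by decide)
  refine Runs.seq (runs_drawWalks (e := ⟨_, pick_lt hm _ _⟩) hd hs₂ (pick_lt hk _ _)
    ((ha₂.natReg 14 (by decide)).trans h₁.1) h₂.1) fun s₃ h₃ ha₃ => ?_
  have hs₃ := hs₂.of_agree ha₃ (by decide)
  rw [h₂.2, h₁.2, add_assoc] at h₃
  have e10 : s₃.natReg 10 = s.natReg 10 := (ha₃.natReg 10 (by decide)).trans
    ((ha₂.natReg 10 (by decide)).trans (ha₁.natReg 10 (by decide)))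
  have a0 : s₃.natArr 0 = s.natArr 0 := (ha₃.natArr 0 (by decide)).trans
    ((ha₂.natArr 0 (by decide)).trans (ha₁.natArr 0 (by decide)))
  have a1 : s₃.natArr 1 = s.natArr 1 := (ha₃.natArr 1 (by decide)).trans
    ((ha₂.natArr 1 (by decide)).trans (ha₁.natArr 1 (by decide)))
  have b0 : s₃.realArr 0 = s.realArr 0 := (ha₃.realArr 0 (by decide)).trans
    ((ha₂.realArr 0 (by decide)).trans (ha₁.realArr 0 (by decide)))
  obtain ⟨h3, h4, h5, h6⟩ := h₃
  refine Runs.storeNat_seq <| Runs.storeNat_seq <| Runs.storeReal_seq <| Runs.setNat ?_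
  rw [← shift_shift] at h3 h4 h5
  simp only [NatExp.eval, RealExp.eval, State.putNat_natReg, State.putNat_natArr,
    State.putNat_realArr, State.putNat_pos, State.putNatArr_natReg, State.putNatArr_natArr,
    State.putNatArr_realArr, State.putNatArr_realReg, State.putNatArr_pos,
    State.putRealArr_natReg, State.putRealArr_natArr,
    State.putRealArr_realArr, State.putRealArr_pos, e10, a0, b0, h3, h4, hs₃.overhead,
    Nat.cast_one, h5, h6]
  refine ⟨?_, ?_, ?_, ?_, by omega⟩
  · simp only [sample, shift_shift]
    simp
    rfl
  · simp only [sample, shift_shift]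
    simp [a1]
    rfl
  · simp only [sample, shift_shift]
    simp
    rfl
  · simp

end Graph

end Sampling

/-! ### Estimator call, logarithm and number of samples -/

namespace Program

/-- Build the double cover. -/
def buildCover : Program :=
  .seq (.setNat 4 (.add (.reg 0) (.reg 0))) <|
  .seq (.setNat 5 (.add (.reg 1) (.reg 1))) <|
  .seq (.setNat 3 (.const 0)) <|
  .loop (.natLt (.reg 3) (.reg 1)) <|
    .seq (.storeNat 2 (.reg 3) (.arr 0 (.reg 3))) <|
    .seq (.storeNat 3 (.reg 3) (.add (.reg 0) (.arr 1 (.reg 3)))) <|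
    .seq (.storeReal 1 (.reg 3) (.arr 0 (.reg 3))) <|
    .seq (.storeNat 2 (.add (.reg 1) (.reg 3)) (.arr 1 (.reg 3))) <|
    .seq (.storeNat 3 (.add (.reg 1) (.reg 3)) (.add (.reg 0) (.arr 0 (.reg 3)))) <|
    .seq (.storeReal 1 (.add (.reg 1) (.reg 3)) (.arr 0 (.reg 3))) <|
    .setNat 3 (.add (.reg 3) (.const 1))

/-- Call the estimator, on the graph itself if `k` is odd and on the double cover if `k` is even. -/
def callEstimator : Program :=
  .ite (.natLt (.const 0) (.sub (.reg 2) (.add (.half (.reg 2)) (.half (.reg 2)))))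
    (.call 0 1 0 1 0 2) (.seq buildCover (.call 4 5 2 3 1 2))

/-- Compute `⌈log₂ n⌉`. -/
def computeLog : Program :=
  .seq (.setNat 7 (.const 0)) <|
  .seq (.setNat 8 (.const 1)) <|
  .loop (.natLt (.reg 8) (.reg 0)) <|
    .seq (.setNat 8 (.add (.reg 8) (.reg 8))) <|
    .setNat 7 (.add (.reg 7) (.const 1))

/-- Compute the number of samples and the overhead. -/
def computeOverhead (C₀ : ℕ) : Program :=
  .seq computeLog <|
  .seq (.setReal 2 (.mul (.div (.mul (.ofNat (.const C₀)) (.ofNat (.reg 7)))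
    (.mul (.reg 0) (.reg 0))) (.mul (.ofNat (.reg 2)) (.reg 1)))) <|
  .seq (.setNat 9 (.const 0)) <|
  .seq (.loop (.realLt (.ofNat (.reg 9)) (.reg 2)) (.setNat 9 (.add (.reg 9) (.const 1)))) <|
  .setReal 3 (.div (.ofNat (.reg 9)) (.mul (.ofNat (.reg 2)) (.reg 1)))

end Program

/-! ### Correctness and cost of the phases -/

section Phases

variable {ans : (G : Graph) → Fin G.m → ℝ} {ω : ℕ → unitInterval}

namespace Graph

variable {G : Graph} {k : ℕ} {r : Fin G.m → ℝ} {h : ℝ} {s s' : State}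

/-- Each sample consumes exactly `k + 1` numbers, so sample `i` starts at position `i (k + 1)` of
the stream, as in `repeatSample`. -/
theorem runs_drawSamples {d N : ℕ} (hd : G.m ≤ 2 ^ d) (hs : G.Tables k r h s) (hm : 0 < G.m)
    (hk : 0 < k) (hr : ∀ e, 0 < r e) (h9 : s.natReg 9 = N) (hpos : s.pos = 0) :
    Runs ans ω .drawSamples s (N * (k * (d * 8 + 35) + 1) + 3) [] fun s' =>
      s'.Outputs (repeatSample (k + 1) (G.sample hm k r h) N ω) := by
  refine Runs.of_le (Runs.setNat_seq <| Runs.seq (Mid := fun s' =>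
    ∀ i < N, s'.natArr 0 i = (G.sample hm k r h (shift (i * (k + 1)) ω)).1 ∧
      s'.natArr 1 i = (G.sample hm k r h (shift (i * (k + 1)) ω)).2.1 ∧
      s'.realArr 0 i = (G.sample hm k r h (shift (i * (k + 1)) ω)).2.2)
    (Runs.loop (t := k * (d * 8 + 35)) (fun j s' => s'.natReg 10 + j = N ∧
      s'.pos = s'.natReg 10 * (k + 1) ∧
      ∀ i < s'.natReg 10, s'.natArr 0 i = (G.sample hm k r h (shift (i * (k + 1)) ω)).1 ∧
      s'.natArr 1 i = (G.sample hm k r h (shift (i * (k + 1)) ω)).2.1 ∧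
      s'.realArr 0 i = (G.sample hm k r h (shift (i * (k + 1)) ω)).2.2) N ?_ ?_)
    fun s₁ h₁ ha => Runs.setNat ?_) (by omega)
  · rintro j s' ha ⟨h1, h2, h3⟩
    have hs' : G.Tables k r h s' := Tables.of_agree (s := s.putNat 10 0)
      ⟨hs.edges, hs.length, hs.total, hs.overhead, hs.fst, hs.snd, hs.estimate, hs.edgePrefix,
      hs.rowLength, hs.degree, hs.neighbour, hs.rowEstimate, hs.rowPrefix⟩ ha (by decide)
    have e9 := ha.natReg 9 (by decide)
    simp [h9] at e9
    obtain _ | j := j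
    · left
      refine ⟨by simp [Test.Holds, NatExp.eval, e9]; omega, ?_⟩
      rw [add_zero] at h1
      rwa [h1] at h3
    · right
      refine ⟨by simp [Test.Holds, NatExp.eval, e9]; omega, j, rfl, ?_⟩
      refine (runs_drawSample hd hs' hm hk hr).imp ?_
      rintro s₁ ⟨h4, h5, h6, h7, h8⟩ -
      refine ⟨by omega, by rw [h8, h7, h2]; ring, fun i hi => ?_⟩
      rw [h7] at hi
      rw [h4, h5, h6, h2]
      by_cases hi' : i = s'.natReg 10
      · subst hi'
        simp
      · rw [Function.update_of_ne hi', Function.update_of_ne hi', Function.update_of_ne hi']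
        exact h3 i (by omega)
  · simp [NatExp.eval, hpos]
  · have e9 := ha.natReg 9 (by decide)
    simp [h9] at e9
    refine ⟨by simp [NatExp.eval, e9, repeatSample_length], fun i => ?_⟩
    have hi : (i : ℕ) < N := i.2.trans_eq (repeatSample_length _ _ _ _)
    rw [List.get_eq_getElem, repeatSample_getElem]
    exact h₁ i hi

theorem runs_drawSamples_zero (h9 : s.natReg 9 = 0) :
    Runs ans ω .drawSamples s 3 [] fun s' =>
      s'.Outputs ([] : List (Fin G.n × Fin G.n × ℝ)) := by
  refine Runs.of_le (Runs.setNat_seq <| Runs.seq (Mid := fun s' => s'.natReg 9 = 0)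
    (Runs.loop (t := 0) (fun _ s' => s'.natReg 9 = 0) 0
    (fun j s' _ h => Or.inl ⟨by simp [Test.Holds, NatExp.eval, h], h⟩) (by simpa using h9))
    fun s₁ h₁ _ => Runs.setNat ?_) (by omega)
  exact ⟨by simp [NatExp.eval, h₁], fun i => i.elim0⟩

/-- The counter follows repeated doubling. The number of rounds is bounded crudely by `n`, which the
linear part of the running time absorbs. -/
theorem runs_computeLog {n : ℕ} (h0 : s.natReg 0 = n) :
    Runs ans ω .computeLog s (3 * n + 3) [] fun s' => s'.natReg 7 = Nat.clog 2 n := by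
  have hlog : Nat.clog 2 n ≤ n := Nat.clog_le_of_le_pow (Nat.lt_two_pow_self).le
  refine Runs.of_le (Runs.setNat_seq <| Runs.setNat_seq <| Runs.loop (t := 2) (fun j s' =>
    s'.natReg 7 + j = Nat.clog 2 n ∧ s'.natReg 8 = 2 ^ s'.natReg 7) (Nat.clog 2 n) ?_ ?_)
    (by omega)
  · rintro j s' ha ⟨h1, h2⟩
    have e0 := ha.natReg 0 (by decide)
    simp [h0] at e0
    obtain _ | j := j
    · left
      refine ⟨?_, h1⟩
      simp only [Test.Holds, NatExp.eval, e0, h2, not_lt]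
      exact (Nat.clog_le_iff_le_pow (by norm_num)).1 h1.ge
    · right
      refine ⟨?_, j, rfl, Runs.setNat_seq <| Runs.setNat ?_⟩
      · simp only [Test.Holds, NatExp.eval, e0, h2]
        by_contra hcon
        have := (Nat.clog_le_iff_le_pow (by norm_num)).2 (not_lt.1 hcon)
        omega
      · simp [NatExp.eval, h2, pow_succ]
        omega
  · simp [NatExp.eval]

/-- The ceiling of a real is found by counting up until the counter is no longer below it; this is
no more expensive than drawing that many samples. -/
theorem runs_computeOverhead {C₀ : ℕ} {ε : ℝ} (h0 : s.natReg 0 = G.n) (h2 : s.natReg 2 = k)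
    (hε : s.realReg 0 = ε) (htot : s.realReg 1 = ∑ e, G.w e * r e) :
    Runs ans ω (.computeOverhead C₀) s (3 * G.n + 2 * G.numSamples C₀ k ε r + 7) [] fun s' =>
      s'.natReg 9 = G.numSamples C₀ k ε r ∧
      s'.realReg 3 = G.numSamples C₀ k ε r / (k * ∑ e, G.w e * r e) := by
  refine Runs.of_le (Runs.seq (runs_computeLog h0) fun s₁ h₁ ha => Runs.setReal_seq <|
    Runs.setNat_seq <| Runs.seq (Mid := fun s' => s'.natReg 9 = G.numSamples C₀ k ε r)
    (Runs.loop (t := 1) (fun j s' => s'.natReg 9 + j = G.numSamples C₀ k ε r)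
      (G.numSamples C₀ k ε r) ?_ ?_) fun s₂ h₂ ha₂ => Runs.setReal ?_) (by omega)
  · intro j s' ha' h3
    have e2 := ha'.realReg 2 (by decide)
    have f0 := ha.realReg 0 (by decide)
    have f1 := ha.realReg 1 (by decide)
    have g2 := ha.natReg 2 (by decide)
    have hB : s'.realReg 2 = (C₀ * Nat.clog 2 G.n / ε ^ 2) * (k * ∑ e, G.w e * r e) := by
      rw [e2]
      simp [NatExp.eval, RealExp.eval, h₁, f0, f1, g2, h2, hε, htot, pow_two]
    have hiff : (s'.natReg 9 : ℝ) < s'.realReg 2 ↔ s'.natReg 9 < G.numSamples C₀ k ε r := by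
      rw [hB, numSamples, Nat.lt_ceil]
    obtain _ | j := j
    · left
      refine ⟨?_, h3⟩
      simp only [Test.Holds, NatExp.eval, RealExp.eval]
      rw [hiff]
      omega
    · right
      refine ⟨?_, j, rfl, Runs.setNat ?_⟩
      · simp only [Test.Holds, NatExp.eval, RealExp.eval]
        rw [hiff]
        omega
      · simp [NatExp.eval]
        omega
  · simp [NatExp.eval]
  · have f1 := ha.realReg 1 (by decide)
    have g2 := ha.natReg 2 (by decide)
    have f1' := ha₂.realReg 1 (by decide)
    have g2' := ha₂.natReg 2 (by decide)
    simp [f1, g2, htot, h2] at f1' g2'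
    simp [NatExp.eval, RealExp.eval, h₂, f1', g2']

theorem runs_buildCover (hS : s.Stores 0 1 0 1 0 G) :
    Runs ans ω .buildCover s (8 * G.m + 4) [] fun s' => s'.Stores 4 5 2 3 1 G.doubleCover := by
  obtain ⟨hn, hm, he⟩ := hS
  refine Runs.of_le (Runs.setNat_seq <| Runs.setNat_seq <| Runs.setNat_seq <|
    Runs.loop (t := 7) (fun j s' => s'.natReg 3 + j = G.m ∧ ∀ e : Fin G.m, (e : ℕ) < s'.natReg 3 →
      s'.natArr 2 e = G.fst e ∧ s'.natArr 3 e = G.n + G.snd e ∧ s'.realArr 1 e = G.w e ∧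
      s'.natArr 2 (G.m + e) = G.snd e ∧ s'.natArr 3 (G.m + e) = G.n + G.fst e ∧
      s'.realArr 1 (G.m + e) = G.w e) G.m ?_ ?_) (by omega)
  · rintro j s' ha ⟨h1, h2⟩
    have e0 := ha.natReg 0 (by decide)
    have e1 := ha.natReg 1 (by decide)
    have e4 := ha.natReg 4 (by decide)
    have e5 := ha.natReg 5 (by decide)
    have a0 := ha.natArr 0 (by decide)
    have a1 := ha.natArr 1 (by decide)
    have b0 := ha.realArr 0 (by decide)
    simp [NatExp.eval, hn, hm] at e0 e1 e4 e5 a0 a1 b0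
    obtain _ | j := j
    · left
      refine ⟨by simp [Test.Holds, NatExp.eval, e1]; omega, e4, e5, fun e => ?_⟩
      induction e using Fin.addCases with
      | left e =>
        obtain ⟨h3, h4, h5, -⟩ := h2 e (by have := e.2; omega)
        simp only [doubleCover, Fin.addCases_left, Fin.val_natAdd, Fin.val_castAdd]
        exact ⟨h3, h4, h5⟩
      | right e =>
        obtain ⟨-, -, -, h3, h4, h5⟩ := h2 e (by have := e.2; omega)
        simp only [doubleCover, Fin.addCases_right, Fin.val_natAdd, Fin.val_castAdd]
        exact ⟨h3, h4, h5⟩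
    · right
      refine ⟨by simp [Test.Holds, NatExp.eval, e1]; omega, j, rfl, ?_⟩
      refine Runs.of_le (Runs.storeNat_seq <| Runs.storeNat_seq <| Runs.storeReal_seq <|
        Runs.storeNat_seq <| Runs.storeNat_seq <| Runs.storeReal_seq <| Runs.setNat ?_)
        (by omega)
      refine ⟨by simp [NatExp.eval]; omega, fun e hlt => ?_⟩
      simp [NatExp.eval] at hlt
      have hT : s'.natReg 3 < G.m := by omega
      obtain ⟨h3, h4, h5⟩ := he ⟨s'.natReg 3, hT⟩
      by_cases hcase : (e : ℕ) = s'.natReg 3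
      · obtain rfl : e = ⟨s'.natReg 3, hT⟩ := Fin.ext hcase
        have hne : s'.natReg 3 ≠ G.m + s'.natReg 3 := by omega
        dsimp only at h3 h4 h5
        simp [NatExp.eval, RealExp.eval, e0, e1, a0, a1, b0, h3, h4, h5,
          Function.update_of_ne hne]
      · have hlt' : (e : ℕ) < s'.natReg 3 := by omega
        have hne : (e : ℕ) ≠ G.m + s'.natReg 3 := by omega
        have hne' : G.m + (e : ℕ) ≠ s'.natReg 3 := by omega
        simp [NatExp.eval, RealExp.eval, e1, hcase, hne, hne', h2 e hlt']
  · simp [NatExp.eval]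

theorem pullEstimates_eq {G' : Graph} (hG : G.estimatorInput k = G') (hm : G.m ≤ G'.m)
    (e : Fin G.m) : G.pullEstimates k (ans (G.estimatorInput k)) e =
      ans G' ⟨e, e.2.trans_le hm⟩ := by
  subst hG
  rfl

theorem runs_callEstimator (hS : s.Stores 0 1 0 1 0 G) (h2 : s.natReg 2 = k) :
    Runs ans ω .callEstimator s (8 * G.m + 6) [G.estimatorInput k] fun s' => ∀ e : Fin G.m,
      s'.realArr 2 e = G.pullEstimates k (ans (G.estimatorInput k)) e := by
  -- Parity is read off from `k - 2 ⌊k/2⌋`, using only halving, addition and subtraction.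
  have htest : Test.Holds s (.natLt (.const 0)
      (.sub (.reg 2) (.add (.half (.reg 2)) (.half (.reg 2))))) ↔ Odd k := by
    simp only [Test.Holds, NatExp.eval, h2, Nat.odd_iff]
    omega
  refine Runs.of_le (Runs.ite (t := 8 * G.m + 5) (fun hb => ?_) fun hb => ?_) (by omega)
  · rw [htest] at hb
    have hG : G.estimatorInput k = G := if_pos hb
    simp only [pullEstimates_eq hG le_rfl]
    rw [hG]
    refine Runs.of_le (Runs.call hS fun e => ?_) (by omega)
    simp
  · rw [htest] at hb
    have hG : G.estimatorInput k = G.doubleCover := if_neg hb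
    simp only [pullEstimates_eq hG (Nat.le_add_right _ _)]
    rw [hG]
    refine Runs.of_le (Runs.seq (runs_buildCover hS) fun s₁ h₁ _ => Runs.call h₁ fun e => ?_)
      (by omega)
    have : (e : ℕ) < G.doubleCover.m := e.2.trans_le (Nat.le_add_right _ _)
    simp [this]

end Graph

end Phases

/-! ### Programs that build the tables -/

namespace Program

/-- Reserve a stretch of `m` entries for the row of each vertex. -/
def initRows : Program :=
  .seq (.setNat 3 (.const 0)) <|
  .seq (.setNat 6 (.const 0)) <|
  .loop (.natLt (.reg 3) (.reg 0)) <|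
    .seq (.storeNat 4 (.reg 3) (.reg 6)) <|
    .seq (.setNat 6 (.add (.reg 6) (.reg 1))) <|
    .setNat 3 (.add (.reg 3) (.const 1))

/-- Append the current edge to the row of the vertex in register `17`, with the neighbour in
register `18`. -/
def appendRow : Program :=
  .seq (.setNat 21 (.add (.arr 4 (.reg 17)) (.arr 5 (.reg 17)))) <|
  .seq (.storeNat 6 (.reg 21) (.reg 18)) <|
  .seq (.storeReal 4 (.reg 21) (.arr 2 (.reg 3))) <|
  .seq (.storeReal 5 (.reg 21) (.arr 6 (.reg 17))) <|
  .seq (.storeReal 6 (.reg 17) (.add (.arr 6 (.reg 17)) (.arr 0 (.reg 3)))) <|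
  .storeNat 5 (.reg 17) (.add (.arr 5 (.reg 17)) (.const 1))

/-- Copy the current edge and extend the prefix sums. -/
def recordEdge : Program :=
  .seq (.storeNat 7 (.reg 3) (.arr 0 (.reg 3))) <|
  .seq (.storeNat 8 (.reg 3) (.arr 1 (.reg 3))) <|
  .seq (.storeReal 3 (.reg 3) (.reg 1)) <|
  .setReal 1 (.add (.reg 1) (.mul (.arr 0 (.reg 3)) (.arr 2 (.reg 3))))

/-- Fill the tables. -/
def scanEdges : Program :=
  .seq (.setReal 1 (.ofNat (.const 0))) <|
  .seq (.setNat 3 (.const 0)) <|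
  .loop (.natLt (.reg 3) (.reg 1)) <|
    .seq recordEdge <|
    .seq (.setNat 17 (.arr 0 (.reg 3))) <|
    .seq (.setNat 18 (.arr 1 (.reg 3))) <|
    .seq appendRow <|
    .seq (.setNat 17 (.arr 1 (.reg 3))) <|
    .seq (.setNat 18 (.arr 0 (.reg 3))) <|
    .seq appendRow <|
    .setNat 3 (.add (.reg 3) (.const 1))

end Program

/-! ### Correctness of the tables -/

section TableConstruction

variable {ans : (G : Graph) → Fin G.m → ℝ} {ω : ℕ → unitInterval}

namespace Graph

variable {G : Graph} {k : ℕ} {r : Fin G.m → ℝ} {h : ℝ} {s s' : State}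

/-- The rows `R` are stored in stretches of length `m`. -/
structure RowsAt (G : Graph) (r : Fin G.m → ℝ) (R : Fin G.n → List (Fin G.n × Fin G.m))
    (s : State) : Prop where
  offset : ∀ u : Fin G.n, s.natArr 4 u = u * G.m
  rowLength : ∀ u : Fin G.n, s.natArr 5 u = (R u).length
  degree : ∀ u : Fin G.n, s.realArr 6 u = ((R u).map fun p => G.w p.2).sum
  neighbour : ∀ (u : Fin G.n) (j : ℕ) (hj : j < (R u).length),
    s.natArr 6 (u * G.m + j) = ((R u)[j]).1
  rowEstimate : ∀ (u : Fin G.n) (j : ℕ) (hj : j < (R u).length),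
    s.realArr 4 (u * G.m + j) = r ((R u)[j]).2
  rowPrefix : ∀ (u : Fin G.n), ∀ j < (R u).length,
    s.realArr 5 (u * G.m + j) = (((R u).take j).map fun p => G.w p.2).sum

theorem RowsAt.of_agree {R : Fin G.n → List (Fin G.n × Fin G.m)} (hs : G.RowsAt r R s)
    {W : List Cell} (ha : Agree W s s')
    (hW : ∀ c ∈ [Cell.natArr 4, .natArr 5, .natArr 6, .realArr 4, .realArr 5, .realArr 6],
      c ∉ W) : G.RowsAt r R s' := by
  simp only [List.forall_mem_cons, List.not_mem_nil, false_imp_iff, implies_true, and_true] at hW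
  obtain ⟨h1, h2, h3, h4, h5, h6⟩ := hW
  constructor
  · rw [ha.natArr _ h1]; exact hs.offset
  · rw [ha.natArr _ h2]; exact hs.rowLength
  · rw [ha.realArr _ h6]; exact hs.degree
  · rw [ha.natArr _ h3]; exact hs.neighbour
  · rw [ha.realArr _ h4]; exact hs.rowEstimate
  · rw [ha.realArr _ h5]; exact hs.rowPrefix

/-- Stretches of length `m` reserved for different vertices are disjoint, so writing into one row
leaves the others intact. -/
theorem mul_add_injOn {m u v i j : ℕ} (hi : i < m) (hj : j < m) (h : u * m + i = v * m + j) :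
    u = v ∧ i = j := by
  have huv : u = v := by
    have h1 := congrArg (· / m) h
    simp only [mul_comm _ m, Nat.mul_add_div (by omega : 0 < m),
      Nat.div_eq_of_lt hi, Nat.div_eq_of_lt hj, add_zero] at h1
    exact h1
  subst huv
  exact ⟨rfl, by omega⟩

/-- The running degree of `v`, taken before the new weight is added, is exactly the prefix sum that
belongs to the new entry. -/
theorem runs_appendRow {R : Fin G.n → List (Fin G.n × Fin G.m)} (hs : G.RowsAt r R s)
    (hR : ∀ u, (R u).length ≤ G.m) {v x : Fin G.n} {e : Fin G.m} (hv : (R v).length < G.m)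
    (h17 : s.natReg 17 = v) (h18 : s.natReg 18 = x) (h3 : s.natReg 3 = e)
    (hr : s.realArr 2 e = r e) (hw : s.realArr 0 e = G.w e) :
    Runs ans ω .appendRow s 6 [] (G.RowsAt r (Function.update R v (R v ++ [(x, e)]))) := by
  refine Runs.of_le (Runs.setNat_seq <| Runs.storeNat_seq <| Runs.storeReal_seq <|
    Runs.storeReal_seq <| Runs.storeReal_seq <| Runs.storeNat ?_) (by omega)
  have hval : ∀ u : Fin G.n, u ≠ v → (u : ℕ) ≠ v := fun u hu h => hu (Fin.ext h)
  have hidx : ∀ (u : Fin G.n) (j : ℕ), j < (R u).length →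
      (u : ℕ) * G.m + j ≠ v * G.m + (R v).length := by
    intro u j hj heq
    obtain ⟨h1, h2⟩ := mul_add_injOn (hj.trans_le (hR u)) hv heq
    obtain rfl : u = v := Fin.ext h1
    omega
  constructor
  · intro u
    simp [hs.offset]
  · intro u
    by_cases hu : u = v
    · subst hu
      simp [NatExp.eval, h17, hs.rowLength]
    · simp [NatExp.eval, h17, hu, hval u hu, hs.rowLength]
  · intro u
    by_cases hu : u = v
    · subst hu
      simp [NatExp.eval, RealExp.eval, h17, h3, hw, hs.degree]
    · simp [NatExp.eval, RealExp.eval, h17, h3, hu, hval u hu, hs.degree]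
  · intro u j hj
    by_cases hu : u = v
    · subst hu
      simp only [Function.update_self, List.length_append, List.length_singleton] at hj ⊢
      rcases Nat.lt_succ_iff_lt_or_eq.1 hj with hj | rfl
      · simp [NatExp.eval, h17, hs.offset, hs.rowLength, hj.ne, hj,
          hs.neighbour u j hj]
      · simp [NatExp.eval, h17, h18, hs.offset, hs.rowLength]
    · simp only [Function.update_of_ne hu] at hj ⊢
      simp [NatExp.eval, h17, hs.offset, hs.rowLength, hidx u j hj, hs.neighbour u j hj]
  · intro u j hj
    by_cases hu : u = v
    · subst hu
      simp only [Function.update_self, List.length_append, List.length_singleton] at hj ⊢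
      rcases Nat.lt_succ_iff_lt_or_eq.1 hj with hj | rfl
      · simp [NatExp.eval, RealExp.eval, h17, hs.offset, hs.rowLength, hj.ne, hj,
          hs.rowEstimate u j hj]
      · simp [NatExp.eval, RealExp.eval, h17, h3, hr, hs.offset, hs.rowLength]
    · simp only [Function.update_of_ne hu] at hj ⊢
      simp [NatExp.eval, RealExp.eval, h17, hs.offset, hs.rowLength, hidx u j hj,
        hs.rowEstimate u j hj]
  · intro u j hj
    by_cases hu : u = v
    · subst hu
      simp only [Function.update_self, List.length_append, List.length_singleton] at hj ⊢
      rcases Nat.lt_succ_iff_lt_or_eq.1 hj with hj | rfl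
      · rw [List.take_append_of_le_length hj.le]
        simp [NatExp.eval, RealExp.eval, h17, hs.offset, hs.rowLength, hj.ne,
          hs.rowPrefix u j hj]
      · rw [List.take_append_of_le_length le_rfl, List.take_length]
        simp [NatExp.eval, RealExp.eval, h17, hs.offset, hs.rowLength, hs.degree]
    · simp only [Function.update_of_ne hu] at hj ⊢
      simp [NatExp.eval, RealExp.eval, h17, hs.offset, hs.rowLength, hidx u j hj,
        hs.rowPrefix u j hj]

/-- Only the offsets are written, by repeated addition. Lengths and degrees are already zero, so the
cost is `O(n)` although `n m` entries are reserved. -/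
theorem runs_initRows (h0 : s.natReg 0 = G.n) (h1 : s.natReg 1 = G.m)
    (h5 : s.natArr 5 = fun _ => 0) (h6 : s.realArr 6 = fun _ => 0) :
    Runs ans ω .initRows s (4 * G.n + 3) [] (G.RowsAt r fun _ => []) := by
  refine Runs.of_le (Runs.setNat_seq <| Runs.setNat_seq <| Runs.loop (t := 3)
    (fun j s' => s'.natReg 3 + j = G.n ∧ s'.natReg 6 = s'.natReg 3 * G.m ∧
      ∀ u < s'.natReg 3, s'.natArr 4 u = u * G.m) G.n ?_ ?_) (by omega)
  · rintro j s' ha ⟨h2, h3, h4⟩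
    have e0 := ha.natReg 0 (by decide)
    have e1 := ha.natReg 1 (by decide)
    have a5 := ha.natArr 5 (by decide)
    have a6 := ha.realArr 6 (by decide)
    simp [h0, h1, h5, h6] at e0 e1 a5 a6
    obtain _ | j := j
    · left
      refine ⟨by simp [Test.Holds, NatExp.eval, e0]; omega, ?_⟩
      exact ⟨fun u => h4 u (by omega), fun u => by simp [a5], fun u => by simp [a6],
        fun u j hj => by simp at hj, fun u j hj => by simp at hj, fun u j hj => by simp at hj⟩
    · right
      refine ⟨by simp [Test.Holds, NatExp.eval, e0]; omega, j, rfl,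
        Runs.storeNat_seq <| Runs.setNat_seq <| Runs.setNat ⟨?_, ?_, fun u hu => ?_⟩⟩
      · simp [NatExp.eval]
        omega
      · simp [NatExp.eval, h3, e1]
        ring
      · simp [NatExp.eval] at hu
        by_cases hu' : u = s'.natReg 3
        · simp [NatExp.eval, hu', h3]
        · simp [NatExp.eval, hu', h4 u (by omega)]
  · simp [NatExp.eval]

/-- The tables for the first `T` edges. -/
structure Scanned (G : Graph) (r : Fin G.m → ℝ) (T : ℕ) (s : State) : Prop where
  rows : G.RowsAt r (fun u => G.row u T) s
  total : s.realReg 1 = G.edgePrefix r T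
  fst : ∀ e : Fin G.m, (e : ℕ) < T → s.natArr 7 e = G.fst e
  snd : ∀ e : Fin G.m, (e : ℕ) < T → s.natArr 8 e = G.snd e
  edgePrefix : ∀ e : Fin G.m, (e : ℕ) < T → s.realArr 3 e = G.edgePrefix r e

theorem runs_recordEdge (hS : s.Stores 0 1 0 1 0 G) (hr : ∀ e : Fin G.m, s.realArr 2 e = r e)
    {T : ℕ} (hT : T < G.m) (h3 : s.natReg 3 = T) (hs : G.Scanned r T s) :
    Runs ans ω .recordEdge s 4 [] fun s' => s'.realReg 1 = G.edgePrefix r (T + 1) ∧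
      (∀ e : Fin G.m, (e : ℕ) < T + 1 → s'.natArr 7 e = G.fst e) ∧
      (∀ e : Fin G.m, (e : ℕ) < T + 1 → s'.natArr 8 e = G.snd e) ∧
      (∀ e : Fin G.m, (e : ℕ) < T + 1 → s'.realArr 3 e = G.edgePrefix r e) := by
  refine Runs.of_le (Runs.storeNat_seq <| Runs.storeNat_seq <| Runs.storeReal_seq <|
    Runs.setReal ?_) (by omega)
  obtain ⟨e1, e2, e3⟩ := hS.2.2 ⟨T, hT⟩
  have e4 := hr ⟨T, hT⟩
  dsimp only at e1 e2 e3 e4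
  refine ⟨?_, fun e he => ?_, fun e he => ?_, fun e he => ?_⟩
  · simp [NatExp.eval, RealExp.eval, h3, hs.total, e3, e4, G.edgePrefix_succ r hT]
  · by_cases hcase : (e : ℕ) = T
    · obtain rfl : e = ⟨T, hT⟩ := Fin.ext hcase
      simp [NatExp.eval, h3, e1]
    · simp [NatExp.eval, h3, hcase, hs.fst e (by omega)]
  · by_cases hcase : (e : ℕ) = T
    · obtain rfl : e = ⟨T, hT⟩ := Fin.ext hcase
      simp [NatExp.eval, h3, e2]
    · simp [NatExp.eval, h3, hcase, hs.snd e (by omega)]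
  · by_cases hcase : (e : ℕ) = T
    · obtain rfl : e = ⟨T, hT⟩ := Fin.ext hcase
      simp [NatExp.eval, RealExp.eval, h3, hs.total]
    · simp [NatExp.eval, RealExp.eval, h3, hcase, hs.edgePrefix e (by omega)]

/-- The two appends for edge `T` touch different rows, since its ends differ, and together they
account for the whole passage from `T` to `T + 1`. -/
theorem row_update {T : ℕ} (hT : T < G.m) :
    Function.update (Function.update (fun u => G.row u T) (G.fst ⟨T, hT⟩)
        (G.row (G.fst ⟨T, hT⟩) T ++ [(G.snd ⟨T, hT⟩, ⟨T, hT⟩)])) (G.snd ⟨T, hT⟩)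
        (Function.update (fun u => G.row u T) (G.fst ⟨T, hT⟩)
          (G.row (G.fst ⟨T, hT⟩) T ++ [(G.snd ⟨T, hT⟩, ⟨T, hT⟩)]) (G.snd ⟨T, hT⟩) ++
          [(G.fst ⟨T, hT⟩, ⟨T, hT⟩)]) = fun u => G.row u (T + 1) := by
  have hne := G.ne ⟨T, hT⟩
  funext u
  rw [G.row_succ u hT, rowEntry]
  by_cases h2 : u = G.snd ⟨T, hT⟩
  · subst h2
    rw [Function.update_self, Function.update_of_ne hne.symm, if_neg hne, if_pos rfl]
  · rw [Function.update_of_ne h2]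
    by_cases h1 : u = G.fst ⟨T, hT⟩
    · subst h1
      rw [Function.update_self, if_pos rfl]
    · rw [Function.update_of_ne h1, if_neg (Ne.symm h1), if_neg (Ne.symm h2), List.append_nil]

theorem State.Stores.of_agree {W : List Cell} (hS : s.Stores 0 1 0 1 0 G) (ha : Agree W s s')
    (hW : ∀ c ∈ [Cell.natReg 0, .natReg 1, .natArr 0, .natArr 1, .realArr 0], c ∉ W) :
    s'.Stores 0 1 0 1 0 G := by
  simp only [List.forall_mem_cons, List.not_mem_nil, false_imp_iff, implies_true, and_true] at hW
  obtain ⟨h1, h2, h3, h4, h5⟩ := hW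
  refine ⟨(ha.natReg _ h1).trans hS.1, (ha.natReg _ h2).trans hS.2.1, ?_⟩
  rw [ha.natArr _ h3, ha.natArr _ h4, ha.realArr _ h5]
  exact hS.2.2

theorem runs_scanEdges (hS : s.Stores 0 1 0 1 0 G) (hr : ∀ e : Fin G.m, s.realArr 2 e = r e)
    (hs : G.RowsAt r (fun _ => []) s) :
    Runs ans ω .scanEdges s (22 * G.m + 3) [] (G.Scanned r G.m) := by
  refine Runs.of_le (Runs.setReal_seq <| Runs.setNat_seq <| Runs.loop (t := 21)
    (fun j s' => s'.natReg 3 + j = G.m ∧ G.Scanned r (s'.natReg 3) s') G.m ?_ ?_) (by omega)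
  · rintro j s' ha ⟨h1, h2⟩
    have hS' : s'.Stores 0 1 0 1 0 G := State.Stores.of_agree
      (s := (s.putReal 1 _).putNat 3 _) hS ha (by decide)
    have hr' : ∀ e : Fin G.m, s'.realArr 2 e = r e := by
      rw [ha.realArr 2 (by decide)]
      exact hr
    obtain _ | j := j
    · left
      rw [add_zero] at h1
      refine ⟨by simp [Test.Holds, NatExp.eval, hS'.2.1, h1], ?_⟩
      rwa [h1] at h2
    · right
      refine ⟨by simp [Test.Holds, NatExp.eval, hS'.2.1]; omega, j, rfl, ?_⟩
      obtain ⟨T, hT3⟩ : ∃ T, T = s'.natReg 3 := ⟨_, rfl⟩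
      rw [← hT3] at h1 h2
      have hT : T < G.m := by omega
      have hlen : ∀ u, (G.row u T).length < G.m := fun u => (G.length_row_le u T).trans_lt hT
      refine Runs.of_le (t := 4 + (1 + (1 + (6 + (1 + (1 + (6 + 1))))))) ?_ (by omega)
      refine Runs.seq (runs_recordEdge hS' hr' hT hT3.symm h2) fun s₁ h₁ ha₁ => ?_
      have hS₁ := State.Stores.of_agree hS' ha₁ (by decide)
      have a2 : s₁.realArr 2 = s'.realArr 2 := ha₁.realArr 2 (by decide)
      have e3 : s₁.natReg 3 = T := (ha₁.natReg 3 (by decide)).trans hT3.symm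
      have hR₁ := h2.rows.of_agree ha₁ (by decide)
      obtain ⟨f1, f2, f3⟩ := hS₁.2.2 ⟨T, hT⟩
      dsimp only at f1 f2 f3
      refine Runs.setNat_seq <| Runs.setNat_seq <| Runs.seq (runs_appendRow
        (R := fun u => G.row u T) (r := r) (v := G.fst ⟨T, hT⟩) (x := G.snd ⟨T, hT⟩)
        (e := ⟨T, hT⟩) (by exact ⟨hR₁.1, hR₁.2, hR₁.3, hR₁.4, hR₁.5, hR₁.6⟩)
        (fun u => (hlen u).le) (hlen _)
        (by simp [NatExp.eval, e3, f1]) (by simp [NatExp.eval, e3, f2]) (by simp [e3])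
        (by simpa [a2] using hr' ⟨T, hT⟩) (by simpa using f3)) fun s₂ h₂ ha₂ => ?_
      have e3' : s₂.natReg 3 = T := (ha₂.natReg 3 (by decide)).trans (by simp [e3])
      have b0 : s₂.natArr 0 = s₁.natArr 0 := (ha₂.natArr 0 (by decide)).trans (by simp)
      have b1 : s₂.natArr 1 = s₁.natArr 1 := (ha₂.natArr 1 (by decide)).trans (by simp)
      have b2 : s₂.realArr 0 = s₁.realArr 0 := (ha₂.realArr 0 (by decide)).trans (by simp)
      have b3 : s₂.realArr 2 = s'.realArr 2 := (ha₂.realArr 2 (by decide)).trans (by simp [a2])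
      refine Runs.setNat_seq <| Runs.setNat_seq <| Runs.seq (runs_appendRow
        (R := Function.update (fun u => G.row u T) (G.fst ⟨T, hT⟩)
          (G.row (G.fst ⟨T, hT⟩) T ++ [(G.snd ⟨T, hT⟩, ⟨T, hT⟩)]))
        (r := r) (v := G.snd ⟨T, hT⟩) (x := G.fst ⟨T, hT⟩)
        (e := ⟨T, hT⟩) (by exact ⟨h₂.1, h₂.2, h₂.3, h₂.4, h₂.5, h₂.6⟩) ?_ ?_
        (by simp [NatExp.eval, e3', b1, f2]) (by simp [NatExp.eval, e3', b0, f1]) (by simp [e3'])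
        (by simpa [b3] using hr' ⟨T, hT⟩) (by simpa [b2] using f3)) fun s₃ h₃ ha₃ =>
          Runs.setNat ?_
      · intro u
        by_cases hu : u = G.fst ⟨T, hT⟩
        · subst hu
          rw [Function.update_self, List.length_append]
          exact hlen _
        · rw [Function.update_of_ne hu]
          exact (hlen u).le
      -- The first append went to the other endpoint, so this row still has a free entry.
      · rw [Function.update_of_ne (G.ne ⟨T, hT⟩).symm]
        exact hlen _
      · rw [G.row_update hT] at h₃
        have e3'' : s₃.natReg 3 = T := (ha₃.natReg 3 (by decide)).trans (by simp [e3'])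
        have c1 : s₃.realReg 1 = s₁.realReg 1 := (ha₃.realReg 1 (by decide)).trans
          ((ha₂.realReg 1 (by decide)).trans (by simp))
        have c7 : s₃.natArr 7 = s₁.natArr 7 := (ha₃.natArr 7 (by decide)).trans
          ((ha₂.natArr 7 (by decide)).trans (by simp))
        have c8 : s₃.natArr 8 = s₁.natArr 8 := (ha₃.natArr 8 (by decide)).trans
          ((ha₂.natArr 8 (by decide)).trans (by simp))
        have c3 : s₃.realArr 3 = s₁.realArr 3 := (ha₃.realArr 3 (by decide)).trans
          ((ha₂.realArr 3 (by decide)).trans (by simp))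
        refine ⟨by simp [NatExp.eval, e3'']; omega, ?_⟩
        simp only [NatExp.eval, State.putNat_natReg, Function.update_self, e3'']
        refine ⟨⟨h₃.1, h₃.2, h₃.3, h₃.4, h₃.5, h₃.6⟩, ?_, ?_, ?_, ?_⟩
        · rw [State.putNat_realReg, c1]; exact h₁.1
        · rw [State.putNat_natArr, c7]; exact h₁.2.1
        · rw [State.putNat_natArr, c8]; exact h₁.2.2.1
        · rw [State.putNat_realArr, c3]; exact h₁.2.2.2
  · refine ⟨by simp [NatExp.eval], ?_⟩
    simp only [NatExp.eval, State.putNat_natReg, Function.update_self]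
    exact ⟨⟨hs.1, hs.2, hs.3, hs.4, hs.5, hs.6⟩, 
      by simp [RealExp.eval, NatExp.eval, edgePrefix], fun e he => by simp at he,
      fun e he => by simp at he, fun e he => by simp at he⟩

end Graph

end TableConstruction

/-- The program for `SparsifyG^k`. -/
def Program.sparsify (C₀ : ℕ) : Program :=
  .seq callEstimator <| .seq initRows <| .seq scanEdges <| .seq (computeOverhead C₀) drawSamples

/-! ### The whole program: output law and running time -/

section Correctness

variable {ans : (G : Graph) → Fin G.m → ℝ} {ω : ℕ → unitInterval}

namespace Graph

variable {G : Graph} {k : ℕ} {r : Fin G.m → ℝ}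

/-- A simple graph has at most `n²` edges, so `2 ⌈log₂ n⌉` rounds of bisection suffice in every
table. -/
theorem m_le_two_pow (G : Graph) : G.m ≤ 2 ^ (2 * Nat.clog 2 G.n) := by
  have hinj : Function.Injective fun e : Fin G.m => (G.fst e, G.snd e) := by
    intro e e' h
    simp only [Prod.mk.injEq] at h
    exact G.simple (by simp [h.1, h.2])
  have h1 := Fintype.card_le_of_injective _ hinj
  simp only [Fintype.card_fin, Fintype.card_prod] at h1
  have h2 : G.n ≤ 2 ^ Nat.clog 2 G.n := Nat.le_pow_clog (by norm_num) _
  calc G.m ≤ G.n * G.n := h1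
    _ ≤ 2 ^ Nat.clog 2 G.n * 2 ^ Nat.clog 2 G.n := Nat.mul_le_mul h2 h2
    _ = 2 ^ (2 * Nat.clog 2 G.n) := by rw [← pow_add]; ring_nf

/-- The output of the algorithm as a function of the random numbers. -/
def output (G : Graph) (C₀ k : ℕ) (ε : ℝ) (r : Fin G.m → ℝ) (ω : ℕ → unitInterval) :
    List (Fin G.n × Fin G.n × ℝ) :=
  if hm : 0 < G.m then repeatSample (k + 1) (G.sample hm k r
    (G.numSamples C₀ k ε r / (k * ∑ e, G.w e * r e))) (G.numSamples C₀ k ε r) ω else []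

theorem uniformSeq_output [NeZero k] (C₀ : ℕ) (ε : ℝ) (hr : ∀ e, 0 < r e)
    (H : List (Fin G.n × Fin G.n × ℝ)) :
    uniformSeq {ω | G.output C₀ k ε r ω = H} = G.sparsify C₀ k ε r H := by
  by_cases hm : 0 < G.m
  · rw [sparsify_eq _ _ _ _ hm, ← ((G.samples_sample hm hr _).repeat _).law]
    simp only [output, dif_pos hm]
  · rw [sparsify_eq_pure _ _ _ _ (by omega), ← (samples_pure _).law]
    simp only [output, dif_neg hm]

theorem numSamples_eq_zero (C₀ : ℕ) (ε : ℝ) (hm : G.m = 0) : G.numSamples C₀ k ε r = 0 := by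
  have : IsEmpty (Fin G.m) := by
    rw [hm]
    infer_instance
  simp [numSamples]

theorem Scanned.tables {s : State} {h : ℝ} (hs : G.Scanned r G.m s) (h1 : s.natReg 1 = G.m)
    (h2 : s.natReg 2 = k) (h3 : s.realReg 3 = h) (hr : ∀ e : Fin G.m, s.realArr 2 e = r e) :
    G.Tables k r h s where
  edges := h1
  length := h2
  total := hs.total.trans (G.edgePrefix_m r)
  overhead := h3
  fst e := hs.fst e e.2
  snd e := hs.snd e e.2
  estimate := hr
  edgePrefix e := hs.edgePrefix e e.2
  rowLength := hs.rows.rowLength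
  degree u := (hs.rows.degree u).trans (G.sum_row_weights u)
  neighbour u j hj := by
    rw [hs.rows.offset]
    exact hs.rows.neighbour u j hj
  rowEstimate u j hj := by
    rw [hs.rows.offset]
    exact hs.rows.rowEstimate u j hj
  rowPrefix u j hj := by
    rw [hs.rows.offset]
    exact hs.rows.rowPrefix u j hj

theorem runs_sparsify (C₀ : ℕ) (hk : 0 < k) (ε : ℝ)
    (hr : ∀ e, 0 < G.pullEstimates k (ans (G.estimatorInput k)) e) :
    Runs ans ω (.sparsify C₀) (input G k ε)
      (30 * G.m + 7 * G.n + 22 + G.numSamples C₀ k ε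
        (G.pullEstimates k (ans (G.estimatorInput k))) * (k * (16 * Nat.clog 2 G.n + 35) + 3))
      [G.estimatorInput k] fun s' => s'.Outputs
        (G.output C₀ k ε (G.pullEstimates k (ans (G.estimatorInput k))) ω) := by
  set r := G.pullEstimates k (ans (G.estimatorInput k)) with hrdef
  set N := G.numSamples C₀ k ε r with hN
  have hS : (input G k ε).Stores 0 1 0 1 0 G := by
    refine ⟨rfl, rfl, fun e => ?_⟩
    simp [input]
  refine Runs.of_le (t := (8 * G.m + 6) + ((4 * G.n + 3) + ((22 * G.m + 3) +
    ((3 * G.n + 2 * N + 7) + (N * (k * (2 * Nat.clog 2 G.n * 8 + 35) + 1) + 3))))) ?_ ?_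
  swap
  -- The `2 N` steps of counting up to the ceiling are charged to the samples.
  · have : N * (k * (16 * Nat.clog 2 G.n + 35) + 3) =
        N * (k * (2 * Nat.clog 2 G.n * 8 + 35) + 1) + 2 * N := by ring
    omega
  refine Runs.seq (Q' := []) (runs_callEstimator hS rfl) fun s₁ h₁ ha₁ => ?_
  have hS₁ := State.Stores.of_agree hS ha₁ (by decide)
  refine Runs.seq (Q := []) (Q' := []) (runs_initRows (r := r) hS₁.1 hS₁.2.1
    ((ha₁.natArr 5 (by decide)).trans ?_) ((ha₁.realArr 6 (by decide)).trans ?_))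
    fun s₂ h₂ ha₂ => ?_
  · funext i
    simp [input]
  · funext i
    simp [input]
  have hS₂ := State.Stores.of_agree hS₁ ha₂ (by decide)
  have hr₂ : ∀ e : Fin G.m, s₂.realArr 2 e = r e := by
    rw [ha₂.realArr 2 (by decide)]
    exact h₁
  refine Runs.seq (Q := []) (Q' := []) (runs_scanEdges hS₂ hr₂ h₂) fun s₃ h₃ ha₃ => ?_
  have hS₃ := State.Stores.of_agree hS₂ ha₃ (by decide)
  have e2 : s₃.natReg 2 = k := (ha₃.natReg 2 (by decide)).trans
    ((ha₂.natReg 2 (by decide)).trans ((ha₁.natReg 2 (by decide)).trans rfl))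
  have eε : s₃.realReg 0 = ε := (ha₃.realReg 0 (by decide)).trans
    ((ha₂.realReg 0 (by decide)).trans ((ha₁.realReg 0 (by decide)).trans rfl))
  have ep : s₃.pos = 0 := (ha₃.pos (by decide)).trans
    ((ha₂.pos (by decide)).trans ((ha₁.pos (by decide)).trans rfl))
  refine Runs.seq (Q := []) (Q' := []) (runs_computeOverhead hS₃.1 e2 eε
    (h₃.total.trans (G.edgePrefix_m r))) fun s₄ h₄ ha₄ => ?_
  -- The written cells do not depend on `C₀`; a literal in its place makes them decidable by
  -- evaluation.
  replace ha₄ : Agree (Program.computeOverhead 0).writes s₃ s₄ := ha₄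
  have hS₄ := State.Stores.of_agree hS₃ ha₄ (by decide)
  have hT : G.Tables k r (N / (k * ∑ e, G.w e * r e)) s₄ := by
    refine Scanned.tables ⟨h₃.rows.of_agree ha₄ (by decide), ?_, ?_, ?_, ?_⟩ hS₄.2.1
      ((ha₄.natReg 2 (by decide)).trans e2) h₄.2 ?_
    · rw [ha₄.realReg 1 (by decide)]
      exact h₃.total
    · rw [ha₄.natArr 7 (by decide)]
      exact h₃.fst
    · rw [ha₄.natArr 8 (by decide)]
      exact h₃.snd
    · rw [ha₄.realArr 3 (by decide)]
      exact h₃.edgePrefix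
    · rw [ha₄.realArr 2 (by decide), ha₃.realArr 2 (by decide)]
      exact hr₂
  by_cases hm : 0 < G.m
  · simp only [output, dif_pos hm]
    exact runs_drawSamples G.m_le_two_pow hT hm hk hr h₄.1 ((ha₄.pos (by decide)).trans ep)
  · have hN0 : N = 0 := numSamples_eq_zero C₀ ε (by omega)
    simp only [output, dif_neg hm]
    exact (runs_drawSamples_zero (h₄.1.trans hN0)).of_le (by omega)

/-- The event that the program outputs `H` has the probability of `H` under the algorithm. -/
theorem uniformSeq_outputs [NeZero k] (C₀ : ℕ) (ε : ℝ)
    (hr : ∀ e, 0 < G.pullEstimates k (ans (G.estimatorInput k)) e)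
    (H : List (Fin G.n × Fin G.n × ℝ)) :
    uniformSeq {ω | ∃ (t : ℕ) (Q : List Graph) (s : State),
      Exec ans ω (.sparsify C₀) (input G k ε) t Q s ∧ s.Outputs H} =
      G.sparsify C₀ k ε (G.pullEstimates k (ans (G.estimatorInput k))) H := by
  rw [← uniformSeq_output C₀ ε hr]
  congr 1
  ext ω
  obtain ⟨t, -, s, he, hs⟩ := runs_sparsify (ω := ω) C₀ (Nat.pos_of_ne_zero (NeZero.ne k)) ε hr
  constructor
  · rintro ⟨t', Q, s', he', hs'⟩
    rw [he.unique he'] at hs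
    exact hs.unique hs'
  · rintro rfl
    exact ⟨t, _, s, he, hs⟩

theorem T_estimatorInput_le {T : ℕ → ℕ → ℕ} (hT : ∀ n m, T n m ≤ T (2 * n) (2 * m)) :
    T (G.estimatorInput k).n (G.estimatorInput k).m ≤ T (2 * G.n) (2 * G.m) := by
  unfold estimatorInput
  split_ifs
  · exact hT _ _
  · rw [two_mul, two_mul]
    exact le_rfl

/-- The number of steps of the sampling phase. -/
theorem numSamples_mul_le {C₀ : ℕ} (hC₀ : 0 < C₀) (hk : 0 < k) {ε : ℝ} (hε : 0 < ε) (hε1 : ε < 1)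
    (hr : G.Admissible k r) {F : ℝ} (hF : ∑ e, G.w e * r e ≤ F) :
    ((G.numSamples C₀ k ε r * (k * (16 * Nat.clog 2 G.n + 35) + 3) : ℕ) : ℝ) ≤
      1000 * C₀ * (ε⁻¹ ^ 2 * k ^ 2 * Real.log G.n ^ 2 * F) := by
  have hlog : 0 ≤ Real.log G.n := Real.log_natCast_nonneg _
  have hF0 : 0 ≤ F := le_trans (Finset.sum_nonneg fun e _ =>
    (mul_pos (G.w_pos e) (hr.pos e)).le) hF
  rcases Nat.eq_zero_or_pos G.m with hm | hm
  · rw [numSamples_eq_zero C₀ ε hm, zero_mul, Nat.cast_zero]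
    positivity
  · have hN := numSamples_le hC₀ hk.ne' hε hε1 hr hm
    have hc := clog_le_log (two_le_n hm)
    have hc1 : 1 ≤ Nat.clog 2 G.n := Nat.clog_pos (by norm_num) (two_le_n hm)
    -- Here `54 = 16 + 35 + 3`, since both factors are at least 1; below, `6 · 54 · 3 = 972` is
    -- rounded up to 1000.
    have hstep : k * (16 * Nat.clog 2 G.n + 35) + 3 ≤ 54 * (k * Nat.clog 2 G.n) := by
      nlinarith
    have hstep' : ((k * (16 * Nat.clog 2 G.n + 35) + 3 : ℕ) : ℝ) ≤
        54 * (k * (3 * Real.log G.n)) := by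
      refine (Nat.cast_le.2 hstep).trans ?_
      push_cast
      gcongr
    rw [Nat.cast_mul]
    calc _ ≤ 6 * C₀ * (ε⁻¹ ^ 2 * k * Real.log G.n * ∑ e, G.w e * r e) *
          (54 * (k * (3 * Real.log G.n))) :=
          mul_le_mul hN hstep' (Nat.cast_nonneg _) ((Nat.cast_nonneg _).trans hN)
      _ ≤ 6 * C₀ * (ε⁻¹ ^ 2 * k * Real.log G.n * F) * (54 * (k * (3 * Real.log G.n))) := by
          gcongr
      _ = 972 * (C₀ * (ε⁻¹ ^ 2 * k ^ 2 * Real.log G.n ^ 2 * F)) := by ring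
      _ ≤ 1000 * (C₀ * (ε⁻¹ ^ 2 * k ^ 2 * Real.log G.n ^ 2 * F)) := by
          gcongr
          norm_num
      _ = _ := by ring

end Graph

end Correctness

end WalkSparsify

end

/-! ### The main theorem -/

theorem mainTheorem2 (c : ℕ) :
    ∃ (C₀ : ℕ) (C : ℝ) (P : Program), 0 < C ∧
      ∀ (f : ℕ → ℕ → ℝ) (T : ℕ → ℕ → ℕ) (δ : ℕ → ENNReal)
        (est : (G : Graph) → Measure (Fin G.m → ℝ)),
        (∀ n m, f n m ≤ f (2 * n) (2 * m)) →
        (∀ n m, T n m ≤ T (2 * n) (2 * m)) →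
        (∀ n m, n + m ≤ T n m) →
        (∀ G, IsProbabilityMeasure (est G)) →
        (∀ G, est G {r | ¬ G.IsGoodEstimate f r} ≤ δ G.n) →
        ∀ (G : Graph) (k : ℕ) [NeZero k] (ε : ℝ), 0 < G.n → 0 < ε → ε < 1 →
          -- quality and size of the output, with the randomness of the estimator and of the sampling
          ∫⁻ r, (G.sparsify C₀ k ε (G.pullEstimates k r)).toOuterMeasure
              {H | ¬ (IsSparsifier ε (G.powLaplacian k) H ∧
                (H.length : ℝ) ≤ C * (ε⁻¹ ^ 2 * k * Real.log G.n * f (2 * G.n) (2 * G.m)))}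
              ∂(est (G.estimatorInput k))
            ≤ δ (G.estimatorInput k).n + ((G.n : ENNReal) ^ c)⁻¹ ∧
          -- implementation and running time, whenever the answer of the estimator is admissible
          ∀ ans : (G' : Graph) → Fin G'.m → ℝ,
            (G.estimatorInput k).IsGoodEstimate f (ans (G.estimatorInput k)) →
            (∀ ω : ℕ → unitInterval, ∃ (t : ℕ) (s : State),
              Exec ans ω P (input G k ε) t [G.estimatorInput k] s ∧
              (t + T (G.estimatorInput k).n (G.estimatorInput k).m : ℝ) ≤
                C * T (2 * G.n) (2 * G.m) +
                C * (ε⁻¹ ^ 2 * k ^ 2 * Real.log G.n ^ 2 * f (2 * G.n) (2 * G.m))) ∧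
            ∀ H : List (Fin G.n × Fin G.n × ℝ),
              uniformSeq {ω | ∃ (t : ℕ) (Q : List Graph) (s : State),
                  Exec ans ω P (input G k ε) t Q s ∧ s.Outputs H} =
                G.sparsify C₀ k ε (G.pullEstimates k (ans (G.estimatorInput k))) H := by
  -- The term `1000 C₀` covers the number of edges and the time of the sampling phase; `31` is 30
  -- for the preprocessing plus 1 for the call itself.
  refine ⟨8 * (c + 2), 1000 * (8 * (c + 2) : ℕ) + 31, .sparsify (8 * (c + 2)), by positivity, ?_⟩
  intro f T δ est hf hT hnm hprob hest G k _ ε hn hε hε1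
  have hk : 0 < k := Nat.pos_of_ne_zero (NeZero.ne k)
  have hC₀ : 0 < 8 * (c + 2) := by omega
  have hC₀' : (0 : ℝ) < (8 * (c + 2) : ℕ) := by exact_mod_cast hC₀
  refine ⟨?_, fun ans hans => ?_⟩
  · have := hprob (G.estimatorInput k)
    exact G.lintegral_sparsify_bad_le c hε hε1 (by linarith) hf _ (hest _)
  obtain ⟨hadm, hsum⟩ := G.good_estimate (NeZero.ne k) hf hans
  refine ⟨fun ω => ?_, fun H => Graph.uniformSeq_outputs _ ε hadm.pos H⟩
  obtain ⟨t, ht, s, he, -⟩ := Graph.runs_sparsify (ω := ω) (8 * (c + 2)) hk ε hadm.pos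
  refine ⟨t, s, he, ?_⟩
  have h1 := Graph.numSamples_mul_le hC₀ hk hε hε1 hadm hsum
  have h2 : (T (G.estimatorInput k).n (G.estimatorInput k).m : ℝ) ≤ T (2 * G.n) (2 * G.m) :=
    Nat.cast_le.2 (Graph.T_estimatorInput_le hT)
  have h3 : ((30 * G.m + 7 * G.n + 22 : ℕ) : ℝ) ≤ 30 * T (2 * G.n) (2 * G.m) := by
    have := (hnm G.n G.m).trans (hT _ _)
    -- The additive constant is absorbed because `n ≥ 1` gives `7 n + 22 ≤ 30 n`.
    have h4 : 30 * G.m + 7 * G.n + 22 ≤ 30 * T (2 * G.n) (2 * G.m) := by omega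
    exact_mod_cast h4
  have h5 : (t : ℝ) ≤ _ := Nat.cast_le.2 ht
  rw [Nat.cast_add] at h5
  have hF : 0 ≤ f (2 * G.n) (2 * G.m) := le_trans (Finset.sum_nonneg fun e _ =>
    (mul_pos (G.w_pos e) (hadm.pos e)).le) hsum
  have hlog : 0 ≤ Real.log G.n := Real.log_natCast_nonneg _
  have h6 : 0 ≤ ε⁻¹ ^ 2 * k ^ 2 * Real.log G.n ^ 2 * f (2 * G.n) (2 * G.m) := by positivity
  have h7 : (0 : ℝ) ≤ 1000 * (8 * (c + 2) : ℕ) * T (2 * G.n) (2 * G.m) := by positivity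
  linarith
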